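/- Let $a,Q_1,D_p>0$, $p\in(1,\infty]$ and $\delta\in(0,1)$; for $p=\infty$ expressions in $p$ below are understood as their limits as $p\to\infty$. For an integrable $q:(0,\infty)\to\mathbb C$ with (essential) support in $[0,a]$ and for $\operatorname{Im}z\ge 0$ let $y_q(\cdot,z)$ be the Jost solution, i.e. the unique solution of $-y''+q(x)y=z^2y$ on $[0,\infty)$ with $y_q(x,z)/e^{izx}\to1$ as $x\to\infty$. The Jost function $\psi_q$ is the entire function with $\psi_q(z)=y_q(0,z)$ for $\operatorname{Im}z\ge0$. There exist a constant $R_0>0$ and functions $\chi(R)$ and $\psi(R,\varepsilon)$, depending only on $\delta,Q_1,p,D_p,a$, such that $$\chi(R)=O\Big(R^{-(1-\delta)\frac{(p-1)^2}{p(3p-2)}}(\ln R)^{\frac{p-1}{p}}\Big)\quad (R\to\infty),\qquad \psi(R,\varepsilon)=O(\varepsilon)\quad(\varepsilon\to0+)\ \text{ for each fixed } R>R_0,$$ and the following holds. Let $q_1,q_2$ be potentials on $(0,\infty)$ with supports in $[0,a]$, $\|q_j\|_1\le Q_1$ $(j=1,2)$ and $\|q_2-q_1\|_p\le D_p$. Let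 $R>R_0$ and $\varepsilon>0$. Suppose that $\psi_{q_1}$ and $\psi_{q_2}$ vanish at $0$ to the same order (possibly $0$), that they have the same number $N$ of zeros in $0<|z|\le R$, counted with multiplicity, and that these zeros can be numbered $z^{(j)}_1,\dots,z^{(j)}_N$ so that $$\left|\frac1{z^{(2)}_n}-\frac1{z^{(1)}_n}\right|<\varepsilon,\qquad n=1,\dots,N.$$ Then $$\max_{0\le x\le a}\left|\int_x^a(q_2(t)-q_1(t))\,dt\right|\le\psi(R,\varepsilon)+C_0R^{-(1-\delta)\frac{p-1}{3p-2}}\,(1+\chi(R)),$$ where $$C_0=2\left(D_p^{\frac p{2p-1}}\Big(\frac{2Q_1e^{aQ_1}}{\pi}\Big)^{\frac{p-1}{2p-1}}+e^{2aQ_1}\big(1+aQ_1e^{aQ_1}\big)\right).$$ -/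

import Mathlib

open MeasureTheory Filter Topology Asymptotics
open scoped ENNReal

/-- `q` is a (complex-valued) potential on the half-line `(0, ∞)`: an `L₁` function whose
(essential) support lies in `[0, a]` and whose `L₁` norm is at most `Q₁`.
Only the values of `q` on `(0, ∞)` matter. -/
def IsPotential (a Q₁ : ℝ) (q : ℝ → ℂ) : Prop :=
  AEStronglyMeasurable q (volume.restrict (Set.Ioi 0)) ∧
  eLpNorm q 1 (volume.restrict (Set.Ioi 0)) ≤ ENNReal.ofReal Q₁ ∧
  ∀ᵐ x ∂(volume.restrict (Set.Ioi (0 : ℝ))), a < x → q x = 0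

/-- `y` is a solution on `[0, ∞)` of `-y'' + q y = z² y`: it is differentiable there, with a
derivative `y'` which is locally absolutely continuous and satisfies `(y')' = (q - z²) y` almost
everywhere, that is, `y'` is an indefinite integral of `(q - z²) y`. -/
def IsSchrodingerSolution (q : ℝ → ℂ) (z : ℂ) (y : ℝ → ℂ) : Prop :=
  ∃ y' : ℝ → ℂ,
    (∀ x, 0 ≤ x → HasDerivWithinAt y (y' x) (Set.Ici 0) x) ∧
    ∀ x, 0 ≤ x → IntervalIntegrable (fun t => (q t - z ^ 2) * y t) volume 0 x ∧
      y' x = y' 0 + ∫ t in (0 : ℝ)..x, (q t - z ^ 2) * y t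

/-- `y` is the Jost solution at the spectral parameter `z` (used for `Im z ≥ 0`): the solution
of `-y'' + q y = z² y` on `[0, ∞)` with `y(x) / e^{izx} → 1` as `x → ∞`. -/
def IsJostSolution (q : ℝ → ℂ) (z : ℂ) (y : ℝ → ℂ) : Prop :=
  IsSchrodingerSolution q z y ∧
  Tendsto (fun x : ℝ => y x / Complex.exp (Complex.I * z * x)) atTop (𝓝 1)

/-- `ψ` is the entire function which, on the closed upper half-plane, is `z ↦ y(0, z)`,
where `y(·, z)` is the Jost solution. -/
def IsJostFunction (q : ℝ → ℂ) (ψ : ℂ → ℂ) : Prop :=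
  Differentiable ℂ ψ ∧
  ∀ z : ℂ, 0 ≤ z.im → ∃ y : ℝ → ℂ, IsJostSolution q z y ∧ ψ z = y 0

/-- The Jost function of `q`: for a compactly supported integrable `q` there is exactly one
function with the property `IsJostFunction q`, and this is it. -/
noncomputable def jostFunction (q : ℝ → ℂ) : ℂ → ℂ :=
  Classical.epsilon (IsJostFunction q)

/-- `z₁, …, z_N` is a list of all nonzero zeros of `ψ` in the closed disk `|z| ≤ R`,
each repeated according to its multiplicity. -/
def IsZeroList (ψ : ℂ → ℂ) (R : ℝ) {N : ℕ} (z : Fin N → ℂ) : Prop :=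
  (∀ n, z n ≠ 0 ∧ ‖z n‖ ≤ R) ∧
  ∀ w : ℂ, w ≠ 0 → ‖w‖ ≤ R → (Nat.card {n : Fin N // z n = w} : ℕ∞) = analyticOrderAt ψ w

/-- `ψ₁` and `ψ₂` vanish to the same order at `0`, they have the same number of zeros in
`0 < |z| ≤ R` (with multiplicity), and these can be numbered so that the reciprocals of zeros
with the same number differ by less than `ε`. -/
def ZerosClose (ψ₁ ψ₂ : ℂ → ℂ) (R ε : ℝ) : Prop :=
  analyticOrderAt ψ₁ 0 = analyticOrderAt ψ₂ 0 ∧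
  ∃ (N : ℕ) (z₁ z₂ : Fin N → ℂ), IsZeroList ψ₁ R z₁ ∧ IsZeroList ψ₂ R z₂ ∧
    ∀ n, ‖(z₂ n)⁻¹ - (z₁ n)⁻¹‖ < ε

/-- `1 / p` as a real number, equal to `0` for `p = ∞`. Expressions in `p` are written through
it, so that they also make sense (as limits) for `p = ∞`. -/
noncomputable def recip (p : ℝ≥0∞) : ℝ := (p⁻¹).toReal

/-- The exponent `(1 - δ) (p - 1) / (3p - 2)`. -/
noncomputable def rateExp (δ : ℝ) (p : ℝ≥0∞) : ℝ :=
  (1 - δ) * ((1 - recip p) / (3 - 2 * recip p))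

/-- The exponent `(1 - δ) (p - 1)² / (p (3p - 2))`. -/
noncomputable def remainderExp (δ : ℝ) (p : ℝ≥0∞) : ℝ :=
  (1 - δ) * ((1 - recip p) ^ 2 / (3 - 2 * recip p))

/-- The constant `C₀ = 2 (D_p^{p/(2p-1)} (2 Q₁ e^{aQ₁} / π)^{(p-1)/(2p-1)}
+ e^{2aQ₁} (1 + a Q₁ e^{aQ₁}))`. -/
noncomputable def constC₀ (a Q₁ : ℝ) (p : ℝ≥0∞) (D : ℝ) : ℝ :=
  2 * (D ^ (1 / (2 - recip p)) *
      (2 * Q₁ * Real.exp (a * Q₁) / Real.pi) ^ ((1 - recip p) / (2 - recip p)) +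
    Real.exp (2 * a * Q₁) * (1 + a * Q₁ * Real.exp (a * Q₁)))

/-!
The theorem holds with `χ = 0` and `Ψ R ε = K R * ε`: the exponent `rateExp δ p` is strictly
smaller than `β = (1 - r) / (3 - 2 r)`, `r = 1 / p`, so a bound `O(R ^ (-β)) + K R * ε` for the
primitive `f(x) = ∫_x^a (q₂ - q₁)` suffices, and the constants are absorbed for large `R`.

*From Jost functions to potentials.* Let `φ_j` be the solution with `φ_j(0) = 0`, `φ_j'(0) = 1`.
The Wronskian of `φ₁` and `φ₂` gives
`∫_0^a f · z (φ₁ φ₂)' dx = (i / 2) (ψ₁(z) ψ₂(-z) - ψ₁(-z) ψ₂(z))`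
(`integral_tailDiff_mul_waveDiff`). The factor `z (φ₁ φ₂)'` is `(X(z) - X(-z)) / (2 i)` with `X` the
product of the two waves `φ_j' + i z φ_j`, and `X(z)` is `exp (2 i z x)` up to the Fourier transform
of a bounded function supported in `[-2x, 2x]`; the representation by transformation operators is
used in its dual form, that is, after integration against a weight `W`. Choosing for `W` a rapidly
decaying function whose Fourier transform is a bump of width `l` to the right of `2 t₀`, one obtains
a Volterra inequality for `f`, and Grönwall's inequality bounds `f` by its oscillation over
intervals of length `l`, the distance of the Jost functions on a real interval `[-T, T]`, and a
rapidly decreasing remainder (`exists_norm_tailDiff_le`). The oscillation is at most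
`D l ^ (1 - r)` by Hölder's inequality.

*From zeros to Jost functions.* Write `ψ_j = P_j F_j` with `P_j` the monic polynomial that has the
zeros of `ψ_j` in `|z| ≤ R`. By Borel–Carathéodory, `log F_j` grows at most linearly, so
`G = log (F₂ / F₁)` is `O(R)` in a disk of radius `R / 4`. On a half-plane `Im z ≥ const` both
functions are `1 + O(1 / |z|)` and all zeros stay at a distance, so `z G(z) = O(1)` there. A
two-constants estimate (`norm_le_mul_exp_of_rectangle`) carries this bound downwards to
`|z| ≤ R / (16 log R)`, where hence `G = O(log R / R)`, while `F₁ (P₂ - P₁) = O(ε)` for fixed `R` by the maximum principle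
(`exists_norm_sub_le_of_zerosClose`).

The choices `l = R ^ (-1 / (3 - 2 r))` and `T = R / (16 log R)` balance the error terms.
-/

/-! ### Calculus with indefinite integrals -/

/-- The product of two integrals over the line, split along the diagonal of the plane. -/
theorem integral_mul_integral_eq_add {𝕜 : Type*} [RCLike 𝕜] {f g : ℝ → 𝕜} (hf : Integrable f)
    (hg : Integrable g) :
    (∫ t, f t) * (∫ t, g t) =
      (∫ t, f t * ∫ s in Set.Iic t, g s) + ∫ t, (∫ s in Set.Iic t, f s) * g t := by
  have hI : Integrable (fun p : ℝ × ℝ => f p.1 * g p.2) (volume.prod volume) := hf.mul_prod hg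
  have hm : MeasurableSet {p : ℝ × ℝ | p.2 ≤ p.1} :=
    measurableSet_le measurable_snd measurable_fst
  rw [← integral_prod_mul, ← integral_add_compl hm hI, ← integral_indicator hm,
    ← integral_indicator hm.compl, integral_prod _ (hI.indicator hm),
    integral_prod_symm _ (hI.indicator hm.compl)]
  congr 1
  · refine integral_congr_ae (Eventually.of_forall fun t => ?_)
    simp only
    rw [← integral_const_mul, ← integral_indicator measurableSet_Iic]
    congr 1 with s
  · refine integral_congr_ae (Eventually.of_forall fun t => ?_)
    simp only
    rw [← integral_mul_const, integral_Iic_eq_integral_Iio,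
      ← integral_indicator measurableSet_Iio]
    congr 1 with s
    by_cases h : s < t <;> simp [Set.indicator, h]

/-- The product rule for indefinite integrals of integrable functions, where a pointwise derivative
need not exist. -/
theorem mul_eq_add_integral_of_eq_add_integral {𝕜 : Type*} [RCLike 𝕜] {b : ℝ} {f g F G : ℝ → 𝕜}
    (hf : IntervalIntegrable f volume 0 b) (hg : IntervalIntegrable g volume 0 b) (hb : 0 ≤ b)
    (hF : ∀ x ∈ Set.Icc 0 b, F x = F 0 + ∫ t in (0 : ℝ)..x, f t)
    (hG : ∀ x ∈ Set.Icc 0 b, G x = G 0 + ∫ t in (0 : ℝ)..x, g t) :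
    F b * G b = F 0 * G 0 + ∫ t in (0 : ℝ)..b, (f t * G t + F t * g t) := by
  have hf' : IntegrableOn f (Set.Ioc 0 b) := (intervalIntegrable_iff_integrableOn_Ioc_of_le hb).1 hf
  have hg' : IntegrableOn g (Set.Ioc 0 b) := (intervalIntegrable_iff_integrableOn_Ioc_of_le hb).1 hg
  have key := integral_mul_integral_eq_add (hf'.integrable_indicator measurableSet_Ioc)
    (hg'.integrable_indicator measurableSet_Ioc)
  have aux : ∀ (h : ℝ → 𝕜) (t : ℝ), t ∈ Set.Ioc 0 b →
      ∫ s in Set.Iic t, (Set.Ioc 0 b).indicator h s = ∫ s in (0 : ℝ)..t, h s := by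
    intro h t ht
    rw [intervalIntegral.integral_of_le ht.1.le, setIntegral_indicator measurableSet_Ioc]
    congr 2
    ext s
    simp only [Set.mem_inter_iff, Set.mem_Iic, Set.mem_Ioc]
    constructor
    · rintro ⟨h1, h2, h3⟩; exact ⟨h2, h1⟩
    · rintro ⟨h1, h2⟩; exact ⟨h2, h1, h2.trans ht.2⟩
  have e1 : ∀ h : ℝ → 𝕜, ∫ t, (Set.Ioc 0 b).indicator h t = ∫ t in (0:ℝ)..b, h t := fun h => by
    rw [intervalIntegral.integral_of_le hb, integral_indicator measurableSet_Ioc]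
  have e2 : ∀ u v : ℝ → 𝕜, ∫ t, (Set.Ioc 0 b).indicator u t *
      ∫ s in Set.Iic t, (Set.Ioc 0 b).indicator v s =
      ∫ t in (0:ℝ)..b, u t * ∫ s in (0:ℝ)..t, v s := by
    intro u v
    rw [← e1]
    refine integral_congr_ae (Eventually.of_forall fun t => ?_)
    by_cases ht : t ∈ Set.Ioc 0 b
    · simp only [Set.indicator_of_mem ht, aux v t ht]
    · simp only [Set.indicator_of_notMem ht, zero_mul]
  have e3 : ∫ t, (∫ s in Set.Iic t, (Set.Ioc 0 b).indicator f s) * (Set.Ioc 0 b).indicator g t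
      = ∫ t in (0:ℝ)..b, g t * ∫ s in (0:ℝ)..t, f s := by
    rw [← e2]; simp_rw [mul_comm]
  rw [e1, e1, e2, e3] at key
  have hcf := intervalIntegral.continuousOn_primitive_interval' hf Set.left_mem_uIcc
  have hcg := intervalIntegral.continuousOn_primitive_interval' hg Set.left_mem_uIcc
  have e4 : ∫ t in (0 : ℝ)..b, (f t * G t + F t * g t) =
      ∫ t in (0 : ℝ)..b, (G 0 * f t + F 0 * g t +
        (f t * (∫ s in (0:ℝ)..t, g s) + g t * ∫ s in (0:ℝ)..t, f s)) := by
    refine intervalIntegral.integral_congr fun t ht => ?_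
    rw [Set.uIcc_of_le hb] at ht
    simp only [hF t ht, hG t ht]; ring
  have i1 := hf.mul_continuousOn hcg
  have i2 := hg.mul_continuousOn hcf
  rw [e4, intervalIntegral.integral_add ((hf.const_mul _).add (hg.const_mul _)) (i1.add i2),
    intervalIntegral.integral_add (hf.const_mul _) (hg.const_mul _),
    intervalIntegral.integral_add i1 i2, ← key, intervalIntegral.integral_const_mul,
    intervalIntegral.integral_const_mul, hF b ⟨hb, le_rfl⟩, hG b ⟨hb, le_rfl⟩]
  ring

/-- The powers of `∫_0^x ρ` are differentiated by the chain rule, in integrated form. -/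
theorem integral_mul_primitive_pow {ρ : ℝ → ℝ} (hρ : Integrable ρ) (n : ℕ) {x : ℝ} (hx : 0 ≤ x) :
    ∫ t in (0 : ℝ)..x, ρ t * (∫ s in (0 : ℝ)..t, ρ s) ^ n =
      (∫ t in (0 : ℝ)..x, ρ t) ^ (n + 1) / (n + 1) := by
  have hc : Continuous fun t => ∫ s in (0 : ℝ)..t, ρ s :=
    intervalIntegral.continuous_primitive (fun _ _ => hρ.intervalIntegrable) 0
  have hi : ∀ (m : ℕ) (u v : ℝ),
      IntervalIntegrable (fun t => ρ t * (∫ s in (0 : ℝ)..t, ρ s) ^ m) volume u v := fun m u v =>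
    hρ.intervalIntegrable.mul_continuousOn (hc.pow m).continuousOn
  induction n generalizing x with
  | zero => simp
  | succ n ih =>
    have h1 := mul_eq_add_integral_of_eq_add_integral
      (f := fun t => (n + 1 : ℝ) * (ρ t * (∫ s in (0 : ℝ)..t, ρ s) ^ n)) (g := ρ)
      (F := fun t => (∫ s in (0 : ℝ)..t, ρ s) ^ (n + 1)) (G := fun t => ∫ s in (0 : ℝ)..t, ρ s)
      ((hi n 0 x).const_mul _) (hρ.intervalIntegrable (a := 0) (b := x)) hx
      (fun y hy => by
        rw [intervalIntegral.integral_const_mul, ih hy.1, intervalIntegral.integral_same]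
        field_simp
        simp)
      (fun y _ => by simp)
    have h2 : ∫ t in (0 : ℝ)..x, ((n + 1 : ℝ) * (ρ t * (∫ s in (0 : ℝ)..t, ρ s) ^ n) *
        (∫ s in (0 : ℝ)..t, ρ s) + (∫ s in (0 : ℝ)..t, ρ s) ^ (n + 1) * ρ t) =
        (n + 2 : ℝ) * ∫ t in (0 : ℝ)..x, ρ t * (∫ s in (0 : ℝ)..t, ρ s) ^ (n + 1) := by
      rw [← intervalIntegral.integral_const_mul]
      congr 1 with t
      ring
    rw [h2] at h1
    have h3 : (n + 2 : ℝ) ≠ 0 := by positivity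
    push_cast
    rw [show ((n : ℝ) + 1 + 1) = n + 2 by ring, eq_div_iff h3, mul_comm, pow_succ _ (n + 1), h1]
    simp

/-- A parametric integral against an integrable density carried by a compact interval is continuous
when the kernel is jointly continuous. -/
theorem continuous_integral_kernel_mul {X : Type*} [TopologicalSpace X] [FirstCountableTopology X]
    [LocallyCompactSpace X] {k : X → ℝ → ℂ} (hk : Continuous (Function.uncurry k)) {g : ℝ → ℂ}
    (hg : Integrable g) {a : ℝ} (hg0 : ∀ t, t ∉ Set.Icc 0 a → g t = 0) :
    Continuous fun p => ∫ t, k p t * g t := by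
  rw [continuous_iff_continuousAt]
  intro p₀
  obtain ⟨K, hK, hp⟩ := exists_compact_mem_nhds p₀
  obtain ⟨M, hM⟩ := (hK.prod (isCompact_Icc (a := (0 : ℝ)) (b := a))).exists_bound_of_continuousOn
    hk.continuousOn
  refine continuousAt_of_dominated (bound := fun t => M * ‖g t‖) ?_ ?_ (hg.norm.const_mul M) ?_
  · refine Eventually.of_forall fun p => ?_
    exact (hk.comp (Continuous.prodMk_right p)).aestronglyMeasurable.mul hg.1
  · filter_upwards [hp] with p hpK
    refine Eventually.of_forall fun t => ?_
    by_cases ht : t ∈ Set.Icc 0 a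
    · rw [norm_mul]
      exact mul_le_mul_of_nonneg_right (hM (p, t) ⟨hpK, ht⟩) (norm_nonneg _)
    · simp [hg0 t ht]
  · refine Eventually.of_forall fun t => ?_
    exact ((hk.comp (Continuous.prodMk_left t)).mul continuous_const).continuousAt

/-- A parametric integral against an integrable density carried by a compact interval is entire
when the kernel is jointly continuous and entire in the parameter. -/
theorem differentiable_integral_kernel_mul {k : ℂ → ℝ → ℂ}
    (hk : Continuous (Function.uncurry k)) (hd : ∀ t, Differentiable ℂ fun z => k z t) {g : ℝ → ℂ}
    (hg : Integrable g) {a : ℝ} (hg0 : ∀ t, t ∉ Set.Icc 0 a → g t = 0) :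
    Differentiable ℂ fun z => ∫ t, k z t * g t := by
  intro z₀
  obtain ⟨M, hM⟩ := ((isCompact_closedBall z₀ 2).prod
    (isCompact_Icc (a := (0 : ℝ)) (b := a))).exists_bound_of_continuousOn hk.continuousOn
  have hmeas : ∀ z, AEStronglyMeasurable (fun t => k z t * g t) volume := fun z =>
    (hk.comp (Continuous.prodMk_right z)).aestronglyMeasurable.mul hg.1
  have hderiv : ∀ z t, HasDerivAt (fun z => k z t * g t) (deriv (fun z => k z t) z * g t) z :=
    fun z t => ((hd t) z).hasDerivAt.mul_const _
  refine (hasDerivAt_integral_of_dominated_loc_of_deriv_le (F := fun z t => k z t * g t)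
    (F' := fun z t => deriv (fun z => k z t) z * g t) (bound := fun t => M * ‖g t‖)
    (Metric.ball_mem_nhds z₀ one_pos) (Eventually.of_forall hmeas) ?_ ?_ ?_ (hg.norm.const_mul M)
    (Eventually.of_forall fun t z _ => hderiv z t)).2.differentiableAt
  · refine (hg.norm.const_mul M).mono' (hmeas z₀) (Eventually.of_forall fun t => ?_)
    by_cases ht : t ∈ Set.Icc 0 a
    · rw [norm_mul]
      exact mul_le_mul_of_nonneg_right (hM (z₀, t) ⟨by simp, ht⟩) (norm_nonneg _)
    · simp [hg0 t ht]
  -- the derivative is measurable in `t`, being a limit of difference quotients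
  · refine aestronglyMeasurable_of_tendsto_ae atTop
      (f := fun (n : ℕ) t => ((n : ℂ) + 1) * (k (z₀ + 1 / ((n : ℂ) + 1)) t * g t - k z₀ t * g t))
      (fun n => ((hmeas _).sub (hmeas _)).const_mul _) (Eventually.of_forall fun t => ?_)
    have h1 := (hderiv z₀ t).tendsto_slope_zero
    have h2 : Tendsto (fun n : ℕ => 1 / ((n : ℂ) + 1)) atTop (𝓝[≠] 0) := by
      refine tendsto_nhdsWithin_iff.2 ⟨tendsto_one_div_add_atTop_nhds_zero_nat, ?_⟩
      exact Eventually.of_forall fun n => one_div_ne_zero (Nat.cast_add_one_ne_zero n)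
    refine (h1.comp h2).congr fun n => ?_
    simp
  · refine Eventually.of_forall fun t z hz => ?_
    by_cases ht : t ∈ Set.Icc 0 a
    · rw [norm_mul]
      refine mul_le_mul_of_nonneg_right ?_ (norm_nonneg _)
      -- Cauchy's estimate on the unit disc around `z`
      have := Complex.norm_deriv_le_of_forall_mem_sphere_norm_le (c := z) one_pos
        (hd t).diffContOnCl (C := M) (fun w hw => hM (w, t) ⟨?_, ht⟩)
      · simpa using this
      · have h1 := dist_triangle w z z₀
        rw [mem_sphere_iff_norm, ← dist_eq_norm] at hw
        rw [Metric.mem_ball] at hz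
        simp only [Metric.mem_closedBall]
        linarith
    · simp [hg0 t ht]

/-! ### The free kernel `sin (z x) / z` -/

/-- The function `sin (z x) / z`, extended by its limit `x` to `z = 0`. -/
noncomputable def freeSine (z : ℂ) (x : ℝ) : ℂ := x * dslope Complex.sin 0 (z * x)

theorem differentiable_dslope_sin : Differentiable ℂ (dslope Complex.sin 0) := by
  rw [← differentiableOn_univ, Complex.differentiableOn_dslope univ_mem]
  exact Complex.differentiable_sin.differentiableOn

theorem continuous_freeSine : Continuous fun p : ℂ × ℝ => freeSine p.1 p.2 := by
  unfold freeSine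
  exact (Complex.continuous_ofReal.comp continuous_snd).mul
    (differentiable_dslope_sin.continuous.comp
      (continuous_fst.mul (Complex.continuous_ofReal.comp continuous_snd)))

theorem differentiable_freeSine (x : ℝ) : Differentiable ℂ fun z => freeSine z x := by
  unfold freeSine
  exact (differentiable_dslope_sin.comp (differentiable_id.mul_const _)).const_mul _

theorem freeSine_of_ne_zero {z : ℂ} (hz : z ≠ 0) (x : ℝ) :
    freeSine z x = Complex.sin (z * x) / z := by
  unfold freeSine
  rcases eq_or_ne x 0 with rfl | hx
  · simp
  · have hx' : (x : ℂ) ≠ 0 := by exact_mod_cast hx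
    rw [dslope_of_ne _ (mul_ne_zero hz hx'), slope_def_field]
    simp
    field_simp

theorem freeSine_zero_left (x : ℝ) : freeSine 0 x = x := by
  simp [freeSine, dslope_same]

@[simp] theorem freeSine_zero_right (z : ℂ) : freeSine z 0 = 0 := by simp [freeSine]

theorem mul_freeSine (z : ℂ) (x : ℝ) : z * freeSine z x = Complex.sin (z * x) := by
  rcases eq_or_ne z 0 with rfl | hz
  · simp
  · rw [freeSine_of_ne_zero hz, mul_div_cancel₀ _ hz]

theorem freeSine_neg_left (z : ℂ) (x : ℝ) : freeSine (-z) x = freeSine z x := by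
  rcases eq_or_ne z 0 with rfl | hz
  · simp
  · rw [freeSine_of_ne_zero hz, freeSine_of_ne_zero (neg_ne_zero.2 hz)]
    simp

theorem hasDerivAt_cos_mul (z : ℂ) (x : ℝ) :
    HasDerivAt (fun t : ℝ => Complex.cos (z * t)) (-z ^ 2 * freeSine z x) x := by
  have h := ((Complex.hasDerivAt_cos (z * x)).comp (x : ℂ)
    ((hasDerivAt_id (x : ℂ)).const_mul z)).comp_ofReal
  refine h.congr_deriv ?_
  rw [← mul_freeSine]
  ring

theorem hasDerivAt_freeSine (z : ℂ) (x : ℝ) :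
    HasDerivAt (fun t : ℝ => freeSine z t) (Complex.cos (z * x)) x := by
  rcases eq_or_ne z 0 with rfl | hz
  · simp only [freeSine_zero_left, zero_mul, Complex.cos_zero]
    exact (hasDerivAt_id (x : ℂ)).comp_ofReal
  · simp only [freeSine_of_ne_zero hz]
    have h := ((Complex.hasDerivAt_sin (z * x)).comp (x : ℂ)
      ((hasDerivAt_id (x : ℂ)).const_mul z)).comp_ofReal
    refine (h.div_const z).congr_deriv ?_
    field_simp

theorem continuous_freeSine_right (z : ℂ) : Continuous fun t => freeSine z t :=
  continuous_freeSine.comp (Continuous.prodMk_right z)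

theorem continuous_cos_mul (z : ℂ) : Continuous fun t : ℝ => Complex.cos (z * t) := by
  fun_prop

theorem freeSine_eq_integral_cos (z : ℂ) (x : ℝ) :
    freeSine z x = ∫ t in (0 : ℝ)..x, Complex.cos (z * t) := by
  rw [intervalIntegral.integral_eq_sub_of_hasDerivAt (fun t _ => hasDerivAt_freeSine z t)
    ((continuous_cos_mul z).intervalIntegrable _ _)]
  simp

theorem cos_eq_integral_freeSine (z : ℂ) (x : ℝ) :
    Complex.cos (z * x) = 1 + ∫ t in (0 : ℝ)..x, -z ^ 2 * freeSine z t := by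
  rw [intervalIntegral.integral_eq_sub_of_hasDerivAt (fun t _ => hasDerivAt_cos_mul z t)
    (((continuous_freeSine_right z).const_mul _).intervalIntegrable _ _)]
  simp

theorem freeSine_sub (z : ℂ) (x t : ℝ) : freeSine z (x - t) =
    freeSine z x * Complex.cos (z * t) - Complex.cos (z * x) * freeSine z t := by
  rcases eq_or_ne z 0 with rfl | hz
  · simp [freeSine_zero_left]
  · simp only [freeSine_of_ne_zero hz]
    push_cast
    rw [mul_sub, Complex.sin_sub]
    ring

theorem cos_mul_sub (z : ℂ) (x t : ℝ) : Complex.cos (z * (x - t : ℝ)) =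
    Complex.cos (z * x) * Complex.cos (z * t) + z ^ 2 * (freeSine z x * freeSine z t) := by
  push_cast
  rw [mul_sub, Complex.cos_sub, ← mul_freeSine, ← mul_freeSine]
  ring

theorem cos_sq_add_freeSine_sq (z : ℂ) (x : ℝ) :
    Complex.cos (z * x) ^ 2 + z ^ 2 * freeSine z x ^ 2 = 1 := by
  rw [← mul_pow, mul_freeSine, add_comm, Complex.sin_sq_add_cos_sq]

theorem cos_add_freeSine (z : ℂ) (x : ℝ) :
    Complex.cos (z * x) + Complex.I * z * freeSine z x = Complex.exp (Complex.I * z * x) := by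
  rw [mul_assoc, mul_freeSine, mul_assoc, mul_comm Complex.I, mul_comm Complex.I, Complex.exp_mul_I]

theorem cos_sub_freeSine (z : ℂ) (x : ℝ) :
    Complex.cos (z * x) - Complex.I * z * freeSine z x = Complex.exp (-(Complex.I * z * x)) := by
  have h := cos_add_freeSine (-z) x
  rw [freeSine_neg_left] at h
  rw [show -(Complex.I * z * x) = Complex.I * -z * x by ring, ← h, neg_mul, Complex.cos_neg]
  ring

theorem norm_exp_I_mul (z : ℂ) (x : ℝ) :
    ‖Complex.exp (Complex.I * z * x)‖ = Real.exp (-(z.im * x)) := by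
  rw [Complex.norm_exp]
  simp

theorem norm_exp_I_mul_le (z : ℂ) {x : ℝ} (hx : 0 ≤ x) :
    ‖Complex.exp (Complex.I * z * x)‖ ≤ Real.exp (|z.im| * x) := by
  rw [norm_exp_I_mul]
  exact Real.exp_le_exp.2 (by nlinarith [neg_abs_le z.im])

theorem norm_cos_mul_le (z : ℂ) {x : ℝ} (hx : 0 ≤ x) :
    ‖Complex.cos (z * x)‖ ≤ Real.exp (|z.im| * x) := by
  have h1 := norm_exp_I_mul_le z hx
  have h2 := norm_exp_I_mul_le (-z) hx
  rw [Complex.neg_im, abs_neg] at h2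
  have h3 : Complex.cos (z * x) =
      (Complex.exp (Complex.I * z * x) + Complex.exp (Complex.I * -z * x)) / 2 := by
    rw [Complex.cos]
    congr 3 <;> ring
  rw [h3, norm_div]
  have h4 := norm_add_le (Complex.exp (Complex.I * z * x)) (Complex.exp (Complex.I * -z * x))
  simp only [Complex.norm_ofNat]
  linarith

theorem norm_sin_mul_le (z : ℂ) {x : ℝ} (hx : 0 ≤ x) :
    ‖Complex.sin (z * x)‖ ≤ Real.exp (|z.im| * x) := by
  have h1 := norm_exp_I_mul_le z hx
  have h2 := norm_exp_I_mul_le (-z) hx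
  rw [Complex.neg_im, abs_neg] at h2
  have h3 : Complex.sin (z * x) =
      (Complex.exp (Complex.I * -z * x) - Complex.exp (Complex.I * z * x)) * Complex.I / 2 := by
    rw [Complex.sin]
    congr 4 <;> ring
  rw [h3, norm_div, norm_mul]
  have h4 := norm_sub_le (Complex.exp (Complex.I * -z * x)) (Complex.exp (Complex.I * z * x))
  simp only [Complex.norm_ofNat, Complex.norm_I]
  linarith

theorem norm_freeSine_le (z : ℂ) {x : ℝ} (hx : 0 ≤ x) :
    ‖freeSine z x‖ ≤ x * Real.exp (|z.im| * x) := by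
  rw [freeSine_eq_integral_cos]
  refine (intervalIntegral.norm_integral_le_of_norm_le_const
    (C := Real.exp (|z.im| * x)) fun t ht => ?_).trans ?_
  · rw [Set.uIoc_of_le hx] at ht
    exact (norm_cos_mul_le z ht.1.le).trans
      (Real.exp_le_exp.2 (mul_le_mul_of_nonneg_left ht.2 (abs_nonneg _)))
  · rw [sub_zero, abs_of_nonneg hx, mul_comm]

theorem norm_freeSine_le_div {z : ℂ} (hz : z ≠ 0) {x : ℝ} (hx : 0 ≤ x) :
    ‖freeSine z x‖ ≤ ‖z‖⁻¹ * Real.exp (|z.im| * x) := by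
  rw [freeSine_of_ne_zero hz, norm_div, div_eq_inv_mul]
  exact mul_le_mul_of_nonneg_left (norm_sin_mul_le z hx) (by positivity)

/-- Variation of constants: `F = ∫_0^x sin (z (x - t)) / z · g` has the derivative
`v = ∫_0^x cos (z (x - t)) g`, and `v' = g - z² F`; both in integrated form. -/
theorem duhamel {g : ℝ → ℂ} (hg : Integrable g) (z : ℂ) {F v : ℝ → ℂ}
    (hF : ∀ x, 0 ≤ x → F x = ∫ t in (0 : ℝ)..x, freeSine z (x - t) * g t)
    (hv : ∀ x, 0 ≤ x → v x = ∫ t in (0 : ℝ)..x, Complex.cos (z * (x - t : ℝ)) * g t)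
    {x : ℝ} (hx : 0 ≤ x) :
    F x = (∫ t in (0 : ℝ)..x, v t) ∧ v x = ∫ t in (0 : ℝ)..x, (g t - z ^ 2 * F t) := by
  have hcg : ∀ u w, IntervalIntegrable (fun t => Complex.cos (z * t) * g t) volume u w := fun u w =>
    hg.intervalIntegrable.continuousOn_mul (continuous_cos_mul z).continuousOn
  have hsg : ∀ u w, IntervalIntegrable (fun t => freeSine z t * g t) volume u w := fun u w =>
    hg.intervalIntegrable.continuousOn_mul (continuous_freeSine_right z).continuousOn
  -- the addition theorems express `F` and `v` through the primitives of `cos (z t) g` and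
  -- `sin (z t) / z · g`, to which the product rule applies
  set Cg : ℝ → ℂ := fun x => ∫ t in (0 : ℝ)..x, Complex.cos (z * t) * g t
  set Sg : ℝ → ℂ := fun x => ∫ t in (0 : ℝ)..x, freeSine z t * g t
  have hF' : ∀ y, 0 ≤ y → F y = freeSine z y * Cg y - Complex.cos (z * y) * Sg y := by
    intro y hy
    rw [hF y hy, ← intervalIntegral.integral_const_mul, ← intervalIntegral.integral_const_mul,
      ← intervalIntegral.integral_sub ((hcg _ _).const_mul _) ((hsg _ _).const_mul _)]
    congr 1 with t
    rw [freeSine_sub]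
    ring
  have hv' : ∀ y, 0 ≤ y → v y = Complex.cos (z * y) * Cg y + z ^ 2 * (freeSine z y * Sg y) := by
    intro y hy
    rw [hv y hy, ← mul_assoc, ← intervalIntegral.integral_const_mul,
      ← intervalIntegral.integral_const_mul,
      ← intervalIntegral.integral_add ((hcg _ _).const_mul _) ((hsg _ _).const_mul _)]
    congr 1 with t
    rw [cos_mul_sub]
    ring
  have hCc : Continuous Cg := intervalIntegral.continuous_primitive hcg 0
  have hSc : Continuous Sg := intervalIntegral.continuous_primitive hsg 0
  have hsc := continuous_freeSine_right z
  have hcc := continuous_cos_mul z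
  have hs'c : ∀ u w, IntervalIntegrable (fun t => -z ^ 2 * freeSine z t) volume u w := fun u w =>
    (hsc.const_mul _).intervalIntegrable _ _
  have pr : ∀ {f F' : ℝ → ℂ}, (∀ u w, IntervalIntegrable f volume u w) →
      (∀ x, F' x = F' 0 + ∫ t in (0 : ℝ)..x, f t) → ∀ {k K : ℝ → ℂ},
      (∀ u w, IntervalIntegrable k volume u w) → (∀ x, K x = K 0 + ∫ t in (0 : ℝ)..x, k t) →
      F' x * K x = F' 0 * K 0 + ∫ t in (0 : ℝ)..x, (f t * K t + F' t * k t) :=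
    fun h1 h2 _ _ h3 h4 => mul_eq_add_integral_of_eq_add_integral (h1 _ _) (h3 _ _) hx
      (fun y _ => h2 y) (fun y _ => h4 y)
  have h1 := pr (fun u w => hcc.intervalIntegrable u w) (F' := fun x => freeSine z x)
    (fun x => by rw [freeSine_zero_right, zero_add, freeSine_eq_integral_cos]) hcg
    (K := Cg) (fun x => by simp [Cg])
  have h2 := pr hs'c (F' := fun x : ℝ => Complex.cos (z * x))
    (fun x => by simp only [Complex.ofReal_zero, mul_zero, Complex.cos_zero]
                 exact cos_eq_integral_freeSine z x) hsg
    (K := Sg) (fun x => by simp [Sg])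
  have h3 := pr hs'c (F' := fun x : ℝ => Complex.cos (z * x))
    (fun x => by simp only [Complex.ofReal_zero, mul_zero, Complex.cos_zero]
                 exact cos_eq_integral_freeSine z x) hcg
    (K := Cg) (fun x => by simp [Cg])
  have h4 := pr (fun u w => hcc.intervalIntegrable u w) (F' := fun x => freeSine z x)
    (fun x => by rw [freeSine_zero_right, zero_add, freeSine_eq_integral_cos]) hsg
    (K := Sg) (fun x => by simp [Sg])
  have ic : ∀ {f K k l : ℝ → ℂ}, Continuous f → Continuous K → Continuous k →
      (∀ u w, IntervalIntegrable l volume u w) →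
      IntervalIntegrable (fun t => f t * K t + k t * l t) volume 0 x := fun hf hK hk hl =>
    ((hf.mul hK).intervalIntegrable _ _).add ((hl _ _).continuousOn_mul hk.continuousOn)
  have i1 := ic hcc hCc hsc hcg
  have i2 := ic (hsc.const_mul (-z ^ 2)) hSc hcc hsg
  have i3 := ic (hsc.const_mul (-z ^ 2)) hCc hcc hcg
  have i4 := ic hcc hSc hsc hsg
  constructor
  · rw [hF' x hx, h1, h2]
    simp only [freeSine_zero_right, zero_mul, zero_add, Complex.ofReal_zero, mul_zero,
      Complex.cos_zero, one_mul]
    have : Sg 0 = 0 := by simp [Sg]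
    rw [this, zero_add, ← intervalIntegral.integral_sub i1 i2]
    refine intervalIntegral.integral_congr fun t ht => ?_
    rw [Set.uIcc_of_le hx] at ht
    simp only [hv' t ht.1]
    ring
  · rw [hv' x hx, h3, h4]
    simp only [freeSine_zero_right, zero_mul, zero_add, Complex.ofReal_zero, mul_zero,
      Complex.cos_zero, one_mul]
    have : Cg 0 = 0 := by simp [Cg]
    rw [this, zero_add, ← intervalIntegral.integral_const_mul,
      ← intervalIntegral.integral_add i3 (i4.const_mul _)]
    refine intervalIntegral.integral_congr fun t ht => ?_
    rw [Set.uIcc_of_le hx] at ht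
    simp only [hF' t ht.1]
    linear_combination g t * cos_sq_add_freeSine_sq z t

/-! ### Volterra equations with an integrable potential -/

/-- An integrable function on the line which vanishes outside `[0, a]` and has `L₁` norm at
most `Q`: a potential from the class `IsPotential a Q`, extended by zero. -/
structure IsTruncatedPotential (a Q : ℝ) (q : ℝ → ℂ) : Prop where
  integrable : Integrable q
  eq_zero : ∀ t, t ∉ Set.Icc 0 a → q t = 0
  norm_le : ∫ t, ‖q t‖ ≤ Q

/-- The terms of the Neumann series of the equation
`y(x) = u(x) + ∫_0^x sin (z (x - t)) / z · q(t) y(t) dt`. The integral is written over the whole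
line with the kernel extended by zero to `t > x`, which keeps the kernel jointly continuous. -/
noncomputable def volterraIter (q : ℝ → ℂ) (u : ℂ → ℝ → ℂ) : ℕ → ℂ → ℝ → ℂ
  | 0 => u
  | n + 1 => fun z x => ∫ t, (freeSine z (max (x - t) 0) * volterraIter q u n z t) * q t

/-- The solution of `y(x) = u(x) + ∫_0^x sin (z (x - t)) / z · q(t) y(t) dt`. -/
noncomputable def volterra (q : ℝ → ℂ) (u : ℂ → ℝ → ℂ) (z : ℂ) (x : ℝ) : ℂ :=
  ∑' n, volterraIter q u n z x

namespace IsTruncatedPotential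

variable {a Q : ℝ} {q : ℝ → ℂ} {u : ℂ → ℝ → ℂ}

theorem nonneg (hq : IsTruncatedPotential a Q q) : 0 ≤ Q :=
  (integral_nonneg fun _ => norm_nonneg _).trans hq.norm_le

theorem integral_norm_le (hq : IsTruncatedPotential a Q q) {x : ℝ} (hx : 0 ≤ x) :
    ∫ t in (0 : ℝ)..x, ‖q t‖ ≤ Q := by
  rw [intervalIntegral.integral_of_le hx]
  exact (setIntegral_le_integral hq.integrable.norm
    (Eventually.of_forall fun _ => norm_nonneg _)).trans hq.norm_le

theorem continuous_kernel (x : ℝ) {v : ℝ → ℂ} (hv : Continuous v) (z : ℂ) :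
    Continuous fun t => freeSine z (max (x - t) 0) * v t :=
  ((continuous_freeSine_right z).comp (by fun_prop)).mul hv

theorem integral_kernel_of_nonneg (hq : IsTruncatedPotential a Q q) (z : ℂ) (v : ℝ → ℂ) {x : ℝ}
    (hx : 0 ≤ x) : ∫ t, (freeSine z (max (x - t) 0) * v t) * q t =
      ∫ t in (0 : ℝ)..x, freeSine z (x - t) * (q t * v t) := by
  rw [intervalIntegral.integral_of_le hx, ← integral_Icc_eq_integral_Ioc,
    ← integral_indicator measurableSet_Icc]
  congr 1 with t
  by_cases ht : t ∈ Set.Icc 0 x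
  · rw [Set.indicator_of_mem ht, max_eq_left (by linarith [ht.2])]
    ring
  · rw [Set.indicator_of_notMem ht]
    by_cases h0 : 0 ≤ t
    · have : x < t := not_le.1 fun h => ht ⟨h0, h⟩
      simp [max_eq_right (by linarith : x - t ≤ 0)]
    · simp [hq.eq_zero t fun h => h0 h.1]

theorem integral_kernel_of_nonpos (hq : IsTruncatedPotential a Q q) (z : ℂ) (v : ℝ → ℂ) {x : ℝ}
    (hx : x ≤ 0) : ∫ t, (freeSine z (max (x - t) 0) * v t) * q t = 0 := by
  refine integral_eq_zero_of_ae (Eventually.of_forall fun t => ?_)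
  by_cases h0 : 0 ≤ t
  · simp [max_eq_right (by linarith : x - t ≤ 0)]
  · simp [hq.eq_zero t fun h => h0 h.1]

theorem continuous_volterraIter (hq : IsTruncatedPotential a Q q)
    (hu : Continuous (Function.uncurry u)) (n : ℕ) :
    Continuous (Function.uncurry (volterraIter q u n)) := by
  induction n with
  | zero => exact hu
  | succ n ih =>
    refine continuous_integral_kernel_mul (X := ℂ × ℝ)
      (k := fun p t => freeSine p.1 (max (p.2 - t) 0) * volterraIter q u n p.1 t) ?_
      hq.integrable hq.eq_zero
    refine (continuous_freeSine.comp (f := fun w : (ℂ × ℝ) × ℝ => (w.1.1, max (w.1.2 - w.2) 0))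
      (by fun_prop)).mul (ih.comp (f := fun w : (ℂ × ℝ) × ℝ => (w.1.1, w.2)) (by fun_prop))

theorem differentiable_volterraIter (hq : IsTruncatedPotential a Q q)
    (hu : Continuous (Function.uncurry u)) (hud : ∀ x, Differentiable ℂ fun z => u z x) (n : ℕ)
    (x : ℝ) : Differentiable ℂ fun z => volterraIter q u n z x := by
  induction n generalizing x with
  | zero => exact hud x
  | succ n ih =>
    refine differentiable_integral_kernel_mul
      (k := fun z t => freeSine z (max (x - t) 0) * volterraIter q u n z t) ?_ ?_
      hq.integrable hq.eq_zero
    · exact (continuous_freeSine.comp (f := fun w : ℂ × ℝ => (w.1, max (x - w.2) 0))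
        (by fun_prop)).mul (hq.continuous_volterraIter hu n)
    · exact fun t => (differentiable_freeSine _).mul (ih t)

/-- The factorial decay of the Neumann series. -/
theorem norm_volterraIter_le (hq : IsTruncatedPotential a Q q) {z : ℂ} {b M κ η : ℝ} (hκ : 0 ≤ κ)
    (hub : ∀ t ∈ Set.Icc 0 b, ‖u z t‖ ≤ M * Real.exp (η * t))
    (hsb : ∀ t ∈ Set.Icc 0 b, ‖freeSine z t‖ ≤ κ * Real.exp (η * t)) (n : ℕ) {x : ℝ}
    (hx : x ∈ Set.Icc 0 b) : ‖volterraIter q u n z x‖ ≤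
      M * Real.exp (η * x) * ((κ * ∫ t in (0 : ℝ)..x, ‖q t‖) ^ n / n.factorial) := by
  induction n generalizing x with
  | zero => simpa [volterraIter] using hub x hx
  | succ n ih =>
    have hc : Continuous fun t => ∫ s in (0 : ℝ)..t, ‖q s‖ :=
      intervalIntegral.continuous_primitive (fun _ _ => hq.integrable.norm.intervalIntegrable) 0
    simp only [volterraIter]
    rw [hq.integral_kernel_of_nonneg z _ hx.1]
    calc ‖∫ t in (0 : ℝ)..x, freeSine z (x - t) * (q t * volterraIter q u n z t)‖
        ≤ ∫ t in (0 : ℝ)..x, M * Real.exp (η * x) * (κ ^ (n + 1) / n.factorial) *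
            (‖q t‖ * (∫ s in (0 : ℝ)..t, ‖q s‖) ^ n) := by
          refine intervalIntegral.norm_integral_le_of_norm_le hx.1 ?_ ?_
          · refine Eventually.of_forall fun t ht => ?_
            have h1 := hsb (x - t) ⟨by linarith [ht.2], by linarith [ht.1, hx.2]⟩
            have h2 := ih (x := t) ⟨ht.1.le, ht.2.trans hx.2⟩
            rw [norm_mul, norm_mul]
            calc ‖freeSine z (x - t)‖ * (‖q t‖ * ‖volterraIter q u n z t‖)
                ≤ (κ * Real.exp (η * (x - t))) * (‖q t‖ * (M * Real.exp (η * t) *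
                    ((κ * ∫ s in (0 : ℝ)..t, ‖q s‖) ^ n / n.factorial))) := by gcongr
              _ = _ := by
                rw [show η * x = η * (x - t) + η * t by ring, Real.exp_add, mul_pow]
                ring
          · exact (hq.integrable.norm.intervalIntegrable.mul_continuousOn
              (hc.pow n).continuousOn).const_mul _
      _ = _ := by
          rw [intervalIntegral.integral_const_mul, integral_mul_primitive_pow hq.integrable.norm n
            hx.1, mul_pow, Nat.factorial_succ]
          push_cast
          field_simp

theorem exists_norm_volterraIter_le (hq : IsTruncatedPotential a Q q)
    (hu : Continuous (Function.uncurry u)) (Z : ℝ) {b : ℝ} (hb : 0 ≤ b) :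
    ∃ M, ∀ (n : ℕ) (z : ℂ) (x : ℝ), ‖z‖ ≤ Z → |x| ≤ b →
      ‖volterraIter q u n z x‖ ≤ M * ((b * Q) ^ n / n.factorial) := by
  obtain ⟨M, hM⟩ := ((isCompact_closedBall (0 : ℂ) Z).prod
    (isCompact_Icc (a := -b) (b := b))).exists_bound_of_continuousOn hu.continuousOn
  have hQ := hq.nonneg
  refine ⟨max M 0 * Real.exp (Z * b), fun n z x hz hx => ?_⟩
  have hZ : 0 ≤ Z := (norm_nonneg z).trans hz
  have him : |z.im| ≤ Z := (Complex.abs_im_le_norm z).trans hz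
  have hub : ∀ t ∈ Set.Icc (-b) b, ‖u z t‖ ≤ max M 0 := fun t ht =>
    (hM (z, t) ⟨by simpa using hz, ht⟩).trans (le_max_left _ _)
  have hM0 : 0 ≤ max M 0 := le_max_right _ _
  rcases le_or_gt 0 x with h0 | h0
  · rw [abs_of_nonneg h0] at hx
    refine (hq.norm_volterraIter_le (b := b) (M := max M 0) (η := Z) hb ?_ ?_ n ⟨h0, hx⟩).trans ?_
    · exact fun t ht => (hub t ⟨by linarith [ht.1], ht.2⟩).trans
        (le_mul_of_one_le_right hM0 (Real.one_le_exp (mul_nonneg hZ ht.1)))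
    · refine fun t ht => (norm_freeSine_le z ht.1).trans ?_
      have := ht.1
      have := ht.2
      gcongr
    · have h1 := hq.integral_norm_le h0
      have h2 : 0 ≤ ∫ t in (0 : ℝ)..x, ‖q t‖ :=
        intervalIntegral.integral_nonneg h0 fun _ _ => norm_nonneg _
      gcongr
  · cases n with
    | zero =>
      simp only [volterraIter, pow_zero, Nat.factorial_zero, Nat.cast_one, div_one, mul_one]
      exact (hub x (abs_le.1 hx)).trans
        (le_mul_of_one_le_right hM0 (Real.one_le_exp (mul_nonneg hZ hb)))
    | succ n =>
      simp only [volterraIter]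
      rw [hq.integral_kernel_of_nonpos z _ h0.le, norm_zero]
      positivity

theorem continuous_volterra (hq : IsTruncatedPotential a Q q)
    (hu : Continuous (Function.uncurry u)) : Continuous (Function.uncurry (volterra q u)) := by
  rw [continuous_iff_continuousAt]
  rintro ⟨z₀, x₀⟩
  obtain ⟨M, hM⟩ := hq.exists_norm_volterraIter_le hu (‖z₀‖ + 1) (b := |x₀| + 1) (by positivity)
  have h : ContinuousOn (Function.uncurry (volterra q u))
      (Metric.ball z₀ 1 ×ˢ Metric.ball x₀ 1) := by
    refine continuousOn_tsum (f := fun n => Function.uncurry (volterraIter q u n))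
      (fun n => (hq.continuous_volterraIter hu n).continuousOn)
      ((Real.summable_pow_div_factorial ((|x₀| + 1) * Q)).mul_left M) ?_
    rintro n ⟨z, x⟩ ⟨h1, h2⟩
    simp only [Metric.mem_ball, dist_eq_norm, Real.norm_eq_abs] at h1 h2
    refine hM n z x ?_ ?_
    · have := norm_sub_norm_le z z₀
      linarith
    · have := abs_sub_abs_le_abs_sub x x₀
      linarith
  exact h.continuousAt (prod_mem_nhds (Metric.ball_mem_nhds _ one_pos)
    (Metric.ball_mem_nhds _ one_pos))

theorem differentiable_volterra (hq : IsTruncatedPotential a Q q)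
    (hu : Continuous (Function.uncurry u)) (hud : ∀ x, Differentiable ℂ fun z => u z x) (x : ℝ) :
    Differentiable ℂ fun z => volterra q u z x := by
  intro z₀
  obtain ⟨M, hM⟩ := hq.exists_norm_volterraIter_le hu (‖z₀‖ + 1) (abs_nonneg x)
  have h := Complex.differentiableOn_tsum_of_summable_norm
    ((Real.summable_pow_div_factorial (|x| * Q)).mul_left M)
    (fun n => (hq.differentiable_volterraIter hu hud n x).differentiableOn)
    (Metric.isOpen_ball (x := z₀) (ε := 1)) (fun n z hz => hM n z x ?_ le_rfl)
  · exact h.differentiableAt (Metric.ball_mem_nhds _ one_pos)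
  · rw [Metric.mem_ball, dist_eq_norm] at hz
    have := norm_sub_norm_le z z₀
    linarith

theorem summable_volterraIter (hq : IsTruncatedPotential a Q q)
    (hu : Continuous (Function.uncurry u)) (z : ℂ) (x : ℝ) :
    Summable fun n => volterraIter q u n z x := by
  obtain ⟨M, hM⟩ := hq.exists_norm_volterraIter_le hu ‖z‖ (abs_nonneg x)
  exact ((Real.summable_pow_div_factorial (|x| * Q)).mul_left M).of_norm_bounded
    fun n => hM n z x le_rfl le_rfl

theorem volterra_eq (hq : IsTruncatedPotential a Q q) (ha : 0 ≤ a)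
    (hu : Continuous (Function.uncurry u)) (z : ℂ) (x : ℝ) :
    volterra q u z x = u z x + ∫ t, (freeSine z (max (x - t) 0) * volterra q u z t) * q t := by
  obtain ⟨M, hM⟩ := hq.exists_norm_volterraIter_le hu ‖z‖ ha
  obtain ⟨S, hS⟩ := (isCompact_Icc (a := (0 : ℝ)) (b := a)).exists_bound_of_continuousOn
    ((continuous_freeSine_right z).comp
      (by fun_prop : Continuous fun t => max (x - t) 0)).continuousOn
  have hiter : ∀ n, Continuous fun t => volterraIter q u n z t := fun n =>
    (hq.continuous_volterraIter hu n).comp (Continuous.prodMk_right z)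
  have hbd : ∀ n t, ‖(freeSine z (max (x - t) 0) * volterraIter q u n z t) * q t‖ ≤
      (S * (M * ((a * Q) ^ n / n.factorial))) * ‖q t‖ := by
    intro n t
    by_cases ht : t ∈ Set.Icc 0 a
    · rw [norm_mul, norm_mul]
      have h1 := hS t ht
      have h2 := hM n z t le_rfl (by rw [abs_of_nonneg ht.1]; exact ht.2)
      have h3 : 0 ≤ S := (norm_nonneg _).trans h1
      simp only [Function.comp] at h1
      gcongr
    · simp [hq.eq_zero t ht]
  have hint : ∀ n, Integrable fun t =>
      (freeSine z (max (x - t) 0) * volterraIter q u n z t) * q t := fun n =>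
    (hq.integrable.norm.const_mul _).mono'
      ((continuous_kernel x (hiter n) z).aestronglyMeasurable.mul hq.integrable.1)
      (Eventually.of_forall (hbd n))
  have hsum : Summable fun n =>
      ∫ t, ‖(freeSine z (max (x - t) 0) * volterraIter q u n z t) * q t‖ := by
    refine Summable.of_nonneg_of_le (fun n => integral_nonneg fun _ => norm_nonneg _)
      (fun n => integral_mono (hint n).norm (hq.integrable.norm.const_mul _) (hbd n)) ?_
    simp_rw [integral_const_mul]
    exact ((((Real.summable_pow_div_factorial (a * Q)).mul_left M).mul_left S).mul_right _)
  rw [volterra, (hq.summable_volterraIter hu z x).tsum_eq_zero_add]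
  congr 1
  simp only [volterraIter]
  refine (integral_tsum_of_summable_integral_norm hint hsum).trans ?_
  congr 1 with t
  rw [tsum_mul_right, tsum_mul_left, volterra]

theorem volterra_of_nonneg (hq : IsTruncatedPotential a Q q) (ha : 0 ≤ a)
    (hu : Continuous (Function.uncurry u)) (z : ℂ) {x : ℝ} (hx : 0 ≤ x) :
    volterra q u z x =
      u z x + ∫ t in (0 : ℝ)..x, freeSine z (x - t) * (q t * volterra q u z t) := by
  rw [hq.volterra_eq ha hu, hq.integral_kernel_of_nonneg z _ hx]

theorem volterra_of_nonpos (hq : IsTruncatedPotential a Q q) (ha : 0 ≤ a)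
    (hu : Continuous (Function.uncurry u)) (z : ℂ) {x : ℝ} (hx : x ≤ 0) :
    volterra q u z x = u z x := by
  rw [hq.volterra_eq ha hu, hq.integral_kernel_of_nonpos z _ hx, add_zero]

theorem norm_volterra_le (hq : IsTruncatedPotential a Q q) {z : ℂ} {b M κ η : ℝ} (hM : 0 ≤ M)
    (hκ : 0 ≤ κ) (hub : ∀ t ∈ Set.Icc 0 b, ‖u z t‖ ≤ M * Real.exp (η * t))
    (hsb : ∀ t ∈ Set.Icc 0 b, ‖freeSine z t‖ ≤ κ * Real.exp (η * t)) {x : ℝ}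
    (hx : x ∈ Set.Icc 0 b) :
    ‖volterra q u z x‖ ≤ M * Real.exp (η * x) * Real.exp (κ * Q) := by
  have hs := (Real.summable_pow_div_factorial (κ * Q)).mul_left (M * Real.exp (η * x))
  refine (tsum_of_norm_bounded hs.hasSum fun n => ?_).trans_eq ?_
  · refine (hq.norm_volterraIter_le hκ hub hsb n hx).trans ?_
    have h1 := hq.integral_norm_le hx.1
    have h2 : 0 ≤ ∫ t in (0 : ℝ)..x, ‖q t‖ :=
      intervalIntegral.integral_nonneg hx.1 fun _ _ => norm_nonneg _
    gcongr
  · rw [tsum_mul_left, Real.exp_eq_exp_ℝ, NormedSpace.exp_eq_tsum_div]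

end IsTruncatedPotential

/-! ### Solutions of the Schrödinger equation and their Wronskians -/

/-- `y` solves `-y'' + q y = z² y` on `[0, b]` and `y'` is its derivative, in integrated form. -/
structure IsSolutionOn (q : ℝ → ℂ) (z : ℂ) (b : ℝ) (y y' : ℝ → ℂ) : Prop where
  continuousOn : ContinuousOn y (Set.Icc 0 b)
  continuousOn_deriv : ContinuousOn y' (Set.Icc 0 b)
  intervalIntegrable : IntervalIntegrable (fun t => (q t - z ^ 2) * y t) volume 0 b
  eq_add_integral : ∀ x ∈ Set.Icc 0 b, y x = y 0 + ∫ t in (0 : ℝ)..x, y' t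
  deriv_eq_add_integral :
    ∀ x ∈ Set.Icc 0 b, y' x = y' 0 + ∫ t in (0 : ℝ)..x, (q t - z ^ 2) * y t

/-- The change of the Wronskian of two solutions at the same spectral parameter, possibly for
different potentials. -/
theorem IsSolutionOn.wronskian {q₁ q₂ : ℝ → ℂ} {z : ℂ} {b : ℝ} (hb : 0 ≤ b)
    {y y' w w' : ℝ → ℂ} (hy : IsSolutionOn q₁ z b y y') (hw : IsSolutionOn q₂ z b w w') :
    y b * w' b - y' b * w b = y 0 * w' 0 - y' 0 * w 0 +
      ∫ t in (0 : ℝ)..b, (q₂ t - q₁ t) * (y t * w t) := by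
  have hI : Set.uIcc 0 b = Set.Icc 0 b := Set.uIcc_of_le hb
  have iy : IntervalIntegrable y' volume 0 b :=
    (hI ▸ hy.continuousOn_deriv : ContinuousOn y' (Set.uIcc 0 b)).intervalIntegrable
  have iw : IntervalIntegrable w' volume 0 b :=
    (hI ▸ hw.continuousOn_deriv : ContinuousOn w' (Set.uIcc 0 b)).intervalIntegrable
  rw [mul_eq_add_integral_of_eq_add_integral iy hw.intervalIntegrable hb hy.eq_add_integral
      hw.deriv_eq_add_integral,
    mul_eq_add_integral_of_eq_add_integral hy.intervalIntegrable iw hb hy.deriv_eq_add_integral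
      hw.eq_add_integral, add_sub_add_comm, ← intervalIntegral.integral_sub]
  · congr 2 with t
    ring
  · exact (iy.mul_continuousOn (hI ▸ hw.continuousOn_deriv)).add
      (hw.intervalIntegrable.continuousOn_mul (hI ▸ hy.continuousOn))
  · exact (hy.intervalIntegrable.mul_continuousOn (hI ▸ hw.continuousOn)).add
      (iw.continuousOn_mul (hI ▸ hy.continuousOn_deriv))

theorem isSolutionOn_exp (z : ℂ) {σ : ℂ} (hσ : σ ^ 2 = -1) (b : ℝ) :
    IsSolutionOn 0 z b (fun x => Complex.exp (σ * z * x))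
      (fun x => σ * z * Complex.exp (σ * z * x)) := by
  have hd : ∀ x : ℝ, HasDerivAt (fun x : ℝ => Complex.exp (σ * z * x))
      (σ * z * Complex.exp (σ * z * x)) x := by
    intro x
    have h := (((hasDerivAt_id (x : ℂ)).const_mul (σ * z)).cexp).comp_ofReal
    refine h.congr_deriv ?_
    simp
    ring
  have hc : Continuous fun x : ℝ => Complex.exp (σ * z * x) := by fun_prop
  have hc' : Continuous fun x : ℝ => σ * z * Complex.exp (σ * z * x) := by fun_prop
  refine ⟨hc.continuousOn, hc'.continuousOn, ?_, fun x _ => ?_, fun x _ => ?_⟩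
  · simp only [Pi.zero_apply]
    exact (hc.const_mul _).intervalIntegrable _ _
  · rw [intervalIntegral.integral_eq_sub_of_hasDerivAt (fun t _ => hd t)
      (hc'.intervalIntegrable _ _)]
    ring
  · have h2 : ∀ t : ℝ, HasDerivAt (fun x : ℝ => σ * z * Complex.exp (σ * z * x))
        (((0 : ℝ → ℂ) t - z ^ 2) * Complex.exp (σ * z * t)) t := fun t => by
      refine ((hd t).const_mul (σ * z)).congr_deriv ?_
      simp only [Pi.zero_apply]
      linear_combination z ^ 2 * Complex.exp (σ * z * t) * hσ
    rw [intervalIntegral.integral_eq_sub_of_hasDerivAt (fun t _ => h2 t)]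
    · ring
    · simp only [Pi.zero_apply]
      exact (hc.const_mul _).intervalIntegrable _ _

theorem IsSchrodingerSolution.exists_isSolutionOn {q : ℝ → ℂ} {z : ℂ} {y : ℝ → ℂ}
    (h : IsSchrodingerSolution q z y) : ∃ y', ∀ b, 0 ≤ b → IsSolutionOn q z b y y' := by
  obtain ⟨y', h1, h2⟩ := h
  refine ⟨y', fun b hb => ?_⟩
  have hI : Set.uIcc 0 b = Set.Icc 0 b := Set.uIcc_of_le hb
  have hc : ContinuousOn y (Set.Icc 0 b) := fun x hx =>
    (h1 x hx.1).continuousWithinAt.mono Set.Icc_subset_Ici_self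
  have hc' : ContinuousOn y' (Set.Icc 0 b) := by
    have := intervalIntegral.continuousOn_primitive_interval' (h2 b hb).1 Set.left_mem_uIcc
    rw [hI] at this
    exact (continuousOn_const.add this).congr fun x hx => (h2 x hx.1).2
  refine ⟨hc, hc', (h2 b hb).1, fun x hx => ?_, fun x hx => (h2 x hx.1).2⟩
  have h3 := intervalIntegral.integral_eq_sub_of_hasDeriv_right_of_le (f := y) (f' := y') hx.1
    (hc.mono (Set.Icc_subset_Icc_right hx.2))
    (fun t ht => (h1 t ht.1.le).mono (Set.Ioi_subset_Ici ht.1.le))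
    (ContinuousOn.intervalIntegrable
      (by rw [Set.uIcc_of_le hx.1]; exact hc'.mono (Set.Icc_subset_Icc_right hx.2)))
  rw [h3]
  ring

namespace IsTruncatedPotential

variable {a Q : ℝ} {q : ℝ → ℂ} {u : ℂ → ℝ → ℂ}

theorem integrable_mul (hq : IsTruncatedPotential a Q q) {v : ℝ → ℂ} (hv : Continuous v) :
    Integrable fun t => q t * v t := by
  obtain ⟨M, hM⟩ := (isCompact_Icc (a := (0 : ℝ)) (b := a)).exists_bound_of_continuousOn
    hv.continuousOn
  refine (hq.integrable.norm.const_mul M).mono' (hq.integrable.1.mul hv.aestronglyMeasurable)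
    (Eventually.of_forall fun t => ?_)
  by_cases ht : t ∈ Set.Icc 0 a
  · rw [norm_mul, mul_comm]
    exact mul_le_mul_of_nonneg_right (hM t ht) (norm_nonneg _)
  · simp [hq.eq_zero t ht]

theorem intervalIntegral_eq_zero (hq : IsTruncatedPotential a Q q) (v : ℝ → ℂ) {x : ℝ}
    (hx : x ≤ 0) : ∫ t in (0 : ℝ)..x, q t * v t = 0 := by
  rw [intervalIntegral.integral_symm, intervalIntegral.integral_of_le hx,
    integral_Ioc_eq_integral_Ioo, setIntegral_eq_zero_of_forall_eq_zero, neg_zero]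
  intro t ht
  rw [hq.eq_zero t fun h => absurd ht.2 (not_lt.2 h.1), zero_mul]

/-- A Volterra solution whose free term `u` solves the free equation solves the Schrödinger
equation on the whole line, with the derivative `v`. -/
theorem volterra_isSolution (hq : IsTruncatedPotential a Q q) (ha : 0 ≤ a)
    (hu : Continuous (Function.uncurry u)) {z : ℂ} {u' : ℝ → ℂ}
    (hu1 : ∀ x, HasDerivAt (u z) (u' x) x) (hu2 : ∀ x, HasDerivAt u' (-z ^ 2 * u z x) x)
    {v : ℝ → ℂ} (hv : ∀ x, v x = u' x +
      ∫ t in (0 : ℝ)..x, Complex.cos (z * (x - t : ℝ)) * (q t * volterra q u z t)) :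
    Continuous v ∧ (∀ x, HasDerivAt (volterra q u z) (v x) x) ∧
      ∀ x, v x = v 0 + ∫ t in (0 : ℝ)..x, (q t - z ^ 2) * volterra q u z t := by
  set y := volterra q u z with hy
  have hyc : Continuous y := (hq.continuous_volterra hu).comp (Continuous.prodMk_right z)
  have huc : Continuous (u z) := hu.comp (Continuous.prodMk_right z)
  have hu'c : Continuous u' := continuous_iff_continuousAt.2 fun x => (hu2 x).continuousAt
  have hg : Integrable fun t => q t * y t := hq.integrable_mul hyc
  have hcg : ∀ c d, IntervalIntegrable (fun t => Complex.cos (z * t) * (q t * y t)) volume c d :=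
    fun c d => hg.intervalIntegrable.continuousOn_mul (continuous_cos_mul z).continuousOn
  have hsg : ∀ c d, IntervalIntegrable (fun t => freeSine z t * (q t * y t)) volume c d :=
    fun c d => hg.intervalIntegrable.continuousOn_mul (continuous_freeSine_right z).continuousOn
  have hvc : Continuous v := by
    have h : v = fun x => u' x + (Complex.cos (z * x) *
        (∫ t in (0 : ℝ)..x, Complex.cos (z * t) * (q t * y t)) + z ^ 2 * (freeSine z x *
        ∫ t in (0 : ℝ)..x, freeSine z t * (q t * y t))) := by
      ext x
      rw [hv x, ← mul_assoc, ← intervalIntegral.integral_const_mul,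
        ← intervalIntegral.integral_const_mul,
        ← intervalIntegral.integral_add ((hcg _ _).const_mul _) ((hsg _ _).const_mul _)]
      congr 2 with t
      rw [cos_mul_sub]
      ring
    rw [h]
    exact hu'c.add (((continuous_cos_mul z).mul
      (intervalIntegral.continuous_primitive hcg 0)).add (continuous_const.mul
      ((continuous_freeSine_right z).mul (intervalIntegral.continuous_primitive hsg 0))))
  have hu1' : ∀ x, u z x = u z 0 + ∫ t in (0 : ℝ)..x, u' t := fun x => by
    rw [intervalIntegral.integral_eq_sub_of_hasDerivAt (fun t _ => hu1 t)
      (hu'c.intervalIntegrable _ _)]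
    ring
  have hu2' : ∀ x, u' x = u' 0 + ∫ t in (0 : ℝ)..x, -z ^ 2 * u z t := fun x => by
    rw [intervalIntegral.integral_eq_sub_of_hasDerivAt (fun t _ => hu2 t)
      ((huc.const_mul _).intervalIntegrable _ _)]
    ring
  have hv0 : v 0 = u' 0 := by simp [hv 0]
  have hy0 : y 0 = u z 0 := hq.volterra_of_nonpos ha hu z le_rfl
  have hneg : ∀ x, x ≤ 0 → v x = u' x := fun x hx => by
    rw [hv x, ← add_zero (u' x)]
    congr 1
    · ring
    · rw [← hq.intervalIntegral_eq_zero (fun t => y t * Complex.cos (z * (x - t : ℝ))) hx]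
      congr 1 with t
      ring
  have key : ∀ x, y x = y 0 + (∫ t in (0 : ℝ)..x, v t) ∧
      v x = v 0 + ∫ t in (0 : ℝ)..x, (q t - z ^ 2) * y t := by
    intro x
    have e1 : ∀ t, (q t - z ^ 2) * y t = q t * y t - z ^ 2 * y t := fun t => by ring
    simp only [e1, hy0, hv0]
    rcases le_total 0 x with hx | hx
    · have hd := duhamel hg z (F := fun x => y x - u z x) (v := fun x => v x - u' x)
        (fun s hs => by
          rw [hy, hq.volterra_of_nonneg ha hu z hs, add_sub_cancel_left])
        (fun s _ => by rw [hv s, add_sub_cancel_left]) hx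
      rw [intervalIntegral.integral_sub (hvc.intervalIntegrable _ _)
        (hu'c.intervalIntegrable _ _)] at hd
      refine ⟨by linear_combination hd.1 + hu1' x, ?_⟩
      have h2 : ∫ t in (0 : ℝ)..x, (q t * y t - z ^ 2 * (y t - u z t)) =
          (∫ t in (0 : ℝ)..x, (q t * y t - z ^ 2 * y t)) -
            ∫ t in (0 : ℝ)..x, -z ^ 2 * u z t := by
        rw [← intervalIntegral.integral_sub]
        · congr 1 with t
          ring
        · exact hg.intervalIntegrable.sub ((hyc.const_mul _).intervalIntegrable _ _)
        · exact (huc.const_mul _).intervalIntegrable _ _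
      have h3 := hd.2
      rw [h2] at h3
      linear_combination h3 + hu2' x
    · constructor
      · rw [hy, hq.volterra_of_nonpos ha hu z hx, hu1' x]
        congr 1
        refine intervalIntegral.integral_congr fun t ht => ?_
        rw [Set.uIcc_of_ge hx] at ht
        exact (hneg t ht.2).symm
      · rw [intervalIntegral.integral_sub hg.intervalIntegrable
          ((hyc.const_mul _).intervalIntegrable _ _), hq.intervalIntegral_eq_zero _ hx, hneg x hx,
          hu2' x, zero_sub, ← intervalIntegral.integral_neg]
        congr 1
        refine intervalIntegral.integral_congr fun t ht => ?_
        rw [Set.uIcc_of_ge hx] at ht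
        simp only [hy, hq.volterra_of_nonpos ha hu z ht.2]
        ring
  refine ⟨hvc, fun x => ?_, fun x => (key x).2⟩
  have h := (intervalIntegral.integral_hasDerivAt_right (hvc.intervalIntegrable 0 x)
    (hvc.stronglyMeasurableAtFilter _ _) hvc.continuousAt).const_add (y 0)
  exact h.congr_of_eventuallyEq (Eventually.of_forall fun x => (key x).1)

end IsTruncatedPotential

theorem isSolutionOn_of_hasDerivAt {q : ℝ → ℂ} {z : ℂ} {y y' : ℝ → ℂ} (hc : Continuous y')
    (hd : ∀ x, HasDerivAt y (y' x) x) (hq : ∀ u v, IntervalIntegrable q volume u v)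
    (h : ∀ x, y' x = y' 0 + ∫ t in (0 : ℝ)..x, (q t - z ^ 2) * y t) (b : ℝ) :
    IsSolutionOn q z b y y' := by
  have hyc : Continuous y := continuous_iff_continuousAt.2 fun x => (hd x).continuousAt
  refine ⟨hyc.continuousOn, hc.continuousOn,
    ((hq 0 b).sub intervalIntegrable_const).mul_continuousOn
    hyc.continuousOn, fun x _ => ?_, fun x _ => h x⟩
  rw [intervalIntegral.integral_eq_sub_of_hasDerivAt (fun t _ => hd t) (hc.intervalIntegrable _ _)]
  ring

/-! ### The regular solution and the Jost function -/

/-- The solution `φ` of `-y'' + q y = z² y` with `φ(0) = 0`, `φ'(0) = 1`. -/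
noncomputable def regularSolution (q : ℝ → ℂ) (z : ℂ) (x : ℝ) : ℂ := volterra q freeSine z x

/-- The derivative in `x` of the regular solution. -/
noncomputable def regularDeriv (q : ℝ → ℂ) (z : ℂ) (x : ℝ) : ℂ := Complex.cos (z * x) +
  ∫ t in (0 : ℝ)..x, Complex.cos (z * (x - t : ℝ)) * (q t * regularSolution q z t)

/-- The combination `φ' + i z φ` of the regular solution, a perturbation of `e^{izx}`. -/
noncomputable def regularWave (q : ℝ → ℂ) (z : ℂ) (x : ℝ) : ℂ :=
  regularDeriv q z x + Complex.I * z * regularSolution q z x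

/-- The Jost function of a truncated potential, as an integral over the regular solution. -/
noncomputable def jostIntegral (q : ℝ → ℂ) (z : ℂ) : ℂ :=
  1 + ∫ t : ℝ, (Complex.exp (Complex.I * z * t) * regularSolution q z t) * q t

theorem continuous_uncurry_freeSine : Continuous (Function.uncurry freeSine) := continuous_freeSine

namespace IsTruncatedPotential

variable {a Q : ℝ} {q : ℝ → ℂ}

theorem continuous_regularSolution (hq : IsTruncatedPotential a Q q) :
    Continuous (Function.uncurry (regularSolution q)) :=
  hq.continuous_volterra continuous_uncurry_freeSine

theorem continuous_regularSolution_right (hq : IsTruncatedPotential a Q q) (z : ℂ) :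
    Continuous (regularSolution q z) :=
  hq.continuous_regularSolution.comp (Continuous.prodMk_right z)

theorem regular_isSolution (hq : IsTruncatedPotential a Q q) (ha : 0 ≤ a) (z : ℂ) :
    Continuous (regularDeriv q z) ∧
      (∀ x, HasDerivAt (regularSolution q z) (regularDeriv q z x) x) ∧
      ∀ x, regularDeriv q z x = regularDeriv q z 0 +
        ∫ t in (0 : ℝ)..x, (q t - z ^ 2) * regularSolution q z t :=
  hq.volterra_isSolution ha continuous_uncurry_freeSine (hasDerivAt_freeSine z)
    (hasDerivAt_cos_mul z) fun _ => rfl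

theorem regular_isSolutionOn (hq : IsTruncatedPotential a Q q) (ha : 0 ≤ a) (z : ℂ) (b : ℝ) :
    IsSolutionOn q z b (regularSolution q z) (regularDeriv q z) := by
  obtain ⟨h1, h2, h3⟩ := hq.regular_isSolution ha z
  exact isSolutionOn_of_hasDerivAt h1 h2 (fun _ _ => hq.integrable.intervalIntegrable) h3 b

theorem regularSolution_zero (hq : IsTruncatedPotential a Q q) (ha : 0 ≤ a) (z : ℂ) :
    regularSolution q z 0 = 0 := by
  rw [regularSolution, hq.volterra_of_nonpos ha continuous_uncurry_freeSine z le_rfl,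
    freeSine_zero_right]

theorem regularDeriv_zero (q : ℝ → ℂ) (z : ℂ) : regularDeriv q z 0 = 1 := by simp [regularDeriv]

theorem regularSolution_neg (q : ℝ → ℂ) (z : ℂ) (x : ℝ) :
    regularSolution q (-z) x = regularSolution q z x := by
  have h : ∀ (n : ℕ) (x : ℝ), volterraIter q freeSine n (-z) x = volterraIter q freeSine n z x := by
    intro n
    induction n with
    | zero => exact freeSine_neg_left z
    | succ n ih => intro x; simp only [volterraIter, ih, freeSine_neg_left]
  simp only [regularSolution, volterra, h]

theorem regularDeriv_neg (q : ℝ → ℂ) (z : ℂ) (x : ℝ) :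
    regularDeriv q (-z) x = regularDeriv q z x := by
  simp only [regularDeriv, regularSolution_neg, neg_mul, Complex.cos_neg]

theorem regularWave_neg (q : ℝ → ℂ) (z : ℂ) (x : ℝ) : regularWave q (-z) x =
    regularDeriv q z x - Complex.I * z * regularSolution q z x := by
  rw [regularWave, regularSolution_neg, regularDeriv_neg]
  ring

theorem regularWave_eq (hq : IsTruncatedPotential a Q q) (ha : 0 ≤ a) (z : ℂ) {x : ℝ}
    (hx : 0 ≤ x) : regularWave q z x = Complex.exp (Complex.I * z * x) +
      ∫ t in (0 : ℝ)..x, Complex.exp (Complex.I * z * (x - t : ℝ)) *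
        (q t * regularSolution q z t) := by
  have hg := hq.integrable_mul (hq.continuous_regularSolution_right z)
  rw [regularWave, regularDeriv]
  conv_lhs => rw [regularSolution, hq.volterra_of_nonneg ha continuous_uncurry_freeSine z hx]
  rw [← cos_add_freeSine, mul_add, add_add_add_comm, ← intervalIntegral.integral_const_mul,
    ← intervalIntegral.integral_add]
  · congr 2 with t
    rw [← cos_add_freeSine, regularSolution]
    ring
  · exact hg.intervalIntegrable.continuousOn_mul
      ((continuous_cos_mul z).comp (by fun_prop : Continuous fun t : ℝ => x - t)).continuousOn
  · exact (hg.intervalIntegrable.continuousOn_mul ((continuous_freeSine_right z).comp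
      (by fun_prop : Continuous fun t : ℝ => x - t)).continuousOn).const_mul _

theorem jostIntegral_eq (hq : IsTruncatedPotential a Q q) (ha : 0 ≤ a) (z : ℂ) :
    jostIntegral q z = Complex.exp (Complex.I * z * a) * regularWave q (-z) a := by
  rw [hq.regularWave_eq ha (-z) ha, mul_add, ← Complex.exp_add,
    ← intervalIntegral.integral_const_mul,
    jostIntegral]
  congr 1
  · rw [show Complex.I * z * a + Complex.I * -z * a = 0 by ring, Complex.exp_zero]
  · rw [intervalIntegral.integral_of_le ha, ← integral_Icc_eq_integral_Ioc,
      ← integral_indicator measurableSet_Icc]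
    congr 1 with t
    by_cases ht : t ∈ Set.Icc 0 a
    · rw [Set.indicator_of_mem ht, ← mul_assoc, ← Complex.exp_add, regularSolution_neg]
      have : Complex.I * z * a + Complex.I * -z * (a - t : ℝ) = Complex.I * z * t := by
        push_cast
        ring
      rw [this]
      ring
    · rw [Set.indicator_of_notMem ht, hq.eq_zero t ht, mul_zero]

theorem differentiable_jostIntegral (hq : IsTruncatedPotential a Q q) :
    Differentiable ℂ (jostIntegral q) := by
  refine (differentiable_integral_kernel_mul
    (k := fun z t => Complex.exp (Complex.I * z * t) * regularSolution q z t) ?_ (fun t => ?_)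
    hq.integrable hq.eq_zero).const_add 1
  · have h : Continuous fun p : ℂ × ℝ => Complex.exp (Complex.I * p.1 * p.2) := by fun_prop
    exact h.mul hq.continuous_regularSolution
  · have h : Differentiable ℂ fun z : ℂ => Complex.exp (Complex.I * z * t) := by fun_prop
    exact h.mul (hq.differentiable_volterra continuous_uncurry_freeSine differentiable_freeSine t)

theorem reflect (hq : IsTruncatedPotential a Q q) :
    IsTruncatedPotential a Q fun t => q (a - t) := by
  refine ⟨hq.integrable.comp_sub_left a, fun t ht => hq.eq_zero _ fun h => ht ?_, ?_⟩
  · exact ⟨by linarith [h.2], by linarith [h.1]⟩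
  · rw [integral_sub_left_eq_self (fun t => ‖q t‖) volume a]
    exact hq.norm_le

/-- The Jost solution is the reflection of a Volterra solution for the reflected potential, and
its value at `0` is a Wronskian with the regular solution. -/
theorem exists_isJostSolution (hq : IsTruncatedPotential a Q q) (ha : 0 ≤ a) (z : ℂ) :
    ∃ y, IsJostSolution q z y ∧ jostIntegral q z = y 0 := by
  set u : ℂ → ℝ → ℂ := fun z x => Complex.exp (Complex.I * z * (a - x : ℝ)) with hu
  have huc : Continuous (Function.uncurry u) := by
    simp only [hu, Function.uncurry_def]
    fun_prop
  have hu1 : ∀ x, HasDerivAt (u z) (-(Complex.I * z) * u z x) x := by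
    intro x
    have h := ((((hasDerivAt_id (x : ℂ)).const_sub (a : ℂ)).const_mul
      (Complex.I * z)).cexp).comp_ofReal
    simp only [hu]
    push_cast
    refine h.congr_deriv ?_
    simp
    ring
  obtain ⟨v, hvdef⟩ : ∃ v : ℝ → ℂ, ∀ x, v x = -(Complex.I * z) * u z x +
      ∫ t in (0 : ℝ)..x, Complex.cos (z * (x - t : ℝ)) *
        (q (a - t) * volterra (fun t => q (a - t)) u z t) := ⟨_, fun _ => rfl⟩
  obtain ⟨hvc, hd, hv⟩ := hq.reflect.volterra_isSolution ha huc (z := z) hu1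
    (fun x => ((hu1 x).const_mul _).congr_deriv
      (by linear_combination z ^ 2 * u z x * Complex.I_sq))
    hvdef
  set Y := volterra (fun t => q (a - t)) u z with hY
  have hdy : ∀ x, HasDerivAt (fun x => Y (a - x)) (-v (a - x)) x := fun x => by
    have := (hd (a - x)).scomp x ((hasDerivAt_id x).const_sub a)
    simpa [Function.comp_def] using this
  have hqi : ∀ c d, IntervalIntegrable q volume c d := fun _ _ => hq.integrable.intervalIntegrable
  have hvc' : Continuous fun x => -v (a - x) := (hvc.comp (by fun_prop)).neg
  have hv' : ∀ x, -v (a - x) = -v (a - 0) + ∫ t in (0 : ℝ)..x, (q t - z ^ 2) * Y (a - t) := by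
    intro x
    have hYc : Continuous Y := continuous_iff_continuousAt.2 fun x => (hd x).continuousAt
    have h1 := intervalIntegral.integral_comp_sub_left (a := 0) (b := x)
      (fun t => (q (a - t) - z ^ 2) * Y t) a
    simp only [sub_sub_cancel, sub_zero] at h1
    have hi : ∀ c d, IntervalIntegrable (fun t => (q (a - t) - z ^ 2) * Y t) volume c d :=
      fun c d => ((hq.reflect.integrable.intervalIntegrable).sub
        intervalIntegrable_const).mul_continuousOn hYc.continuousOn
    rw [h1, ← intervalIntegral.integral_interval_sub_left (hi 0 a) (hi 0 (a - x)), sub_zero,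
      hv (a - x), hv a]
    ring
  have hsol := isSolutionOn_of_hasDerivAt hvc' hdy hqi hv'
  have hYa : ∀ x, x ≤ 0 → Y x = u z x := fun x hx => hq.reflect.volterra_of_nonpos ha huc z hx
  refine ⟨fun x => Y (a - x), ⟨⟨fun x => -v (a - x), fun x _ => (hdy x).hasDerivWithinAt,
    fun x _ => ⟨(hsol x).intervalIntegrable, hv' x⟩⟩, ?_⟩, ?_⟩
  · refine tendsto_const_nhds.congr' ?_
    filter_upwards [eventually_ge_atTop a] with x hx
    rw [hYa _ (by linarith), hu]
    simp only [sub_sub_cancel]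
    rw [div_self (Complex.exp_ne_zero _)]
  · have hW := (hsol a).wronskian ha (hq.regular_isSolutionOn ha z a)
    simp only [sub_self, zero_mul, intervalIntegral.integral_zero, add_zero,
      hq.regularSolution_zero ha, regularDeriv_zero, mul_one, mul_zero, sub_zero] at hW
    change jostIntegral q z = Y (a - 0)
    rw [sub_zero, ← hW, hq.jostIntegral_eq ha, regularWave_neg, hYa 0 le_rfl]
    have hv0 : v 0 = -(Complex.I * z) * u z 0 := by simp [hvdef]
    rw [hv0]
    simp only [hu, sub_zero]
    ring

/-- For `Im z > 0` the value at `0` of a Jost solution is determined: beyond the support of the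
potential the asymptotics exclude the growing exponential. -/
theorem eq_jostIntegral_of_isJostSolution (hq : IsTruncatedPotential a Q q) (ha : 0 ≤ a) {z : ℂ}
    (hz : 0 < z.im) {y : ℝ → ℂ} (hy : IsJostSolution q z y) : y 0 = jostIntegral q z := by
  obtain ⟨hs, hlim⟩ := hy
  obtain ⟨y', hy'⟩ := hs.exists_isSolutionOn
  have hz0 : z ≠ 0 := fun h => by simp [h] at hz
  -- the Wronskians with the exponentials `e^{± i z x}` are constant beyond the support
  have hconst : ∀ σ : ℂ, σ ^ 2 = -1 → ∃ c : ℂ, ∀ b, a ≤ b →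
      Complex.exp (σ * z * b) * (σ * z * y b - y' b) = c := by
    intro σ hσ
    refine ⟨y 0 * (σ * z) - y' 0 + ∫ t in (0 : ℝ)..a, (0 - q t) * (y t * Complex.exp (σ * z * t)),
      fun b hb => ?_⟩
    have hW := (hy' b (ha.trans hb)).wronskian (ha.trans hb) (isSolutionOn_exp z hσ b)
    simp only [Complex.ofReal_zero, mul_zero, Complex.exp_zero, mul_one, Pi.zero_apply] at hW
    have hI : ∫ t in (0 : ℝ)..b, (0 - q t) * (y t * Complex.exp (σ * z * t)) =
        ∫ t in (0 : ℝ)..a, (0 - q t) * (y t * Complex.exp (σ * z * t)) := by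
      rw [intervalIntegral.integral_of_le ha, intervalIntegral.integral_of_le (ha.trans hb)]
      refine (setIntegral_eq_of_subset_of_forall_sdiff_eq_zero measurableSet_Ioc
        (Set.Ioc_subset_Ioc_right hb) fun t ht => ?_)
      rw [hq.eq_zero t fun h => ht.2 ⟨ht.1.1, h.2⟩]
      simp
    rw [← hI, ← hW]
    ring
  obtain ⟨c, hc⟩ := hconst Complex.I Complex.I_sq
  obtain ⟨d, hd⟩ := hconst (-Complex.I) (by simp)
  have hexp : ∀ b : ℝ, Complex.exp (-Complex.I * z * b) * Complex.exp (Complex.I * z * b) = 1 :=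
    fun b => by
      rw [← Complex.exp_add, show -Complex.I * z * b + Complex.I * z * b = 0 by ring,
        Complex.exp_zero]
  have hz' : 2 * Complex.I * z ≠ 0 := by simp [hz0]
  have hform : ∀ b : ℝ, a ≤ b → y b * (2 * Complex.I * z) =
      c * Complex.exp (-Complex.I * z * b) - d * Complex.exp (Complex.I * z * b) := by
    intro b hb
    rw [← hc b hb, ← hd b hb]
    linear_combination (-(2 * Complex.I * z * y b)) * hexp b
  have hratio : ∀ b : ℝ, a ≤ b → y b / Complex.exp (Complex.I * z * b) * (2 * Complex.I * z) + d =
      c * Complex.exp (-Complex.I * z * b) ^ 2 := by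
    intro b hb
    have h1 : y b / Complex.exp (Complex.I * z * b) = y b * Complex.exp (-Complex.I * z * b) := by
      rw [div_eq_iff (Complex.exp_ne_zero _), mul_assoc, hexp, mul_one]
    rw [h1]
    linear_combination Complex.exp (-Complex.I * z * b) * hform b hb - d * hexp b
  have hlim' := (hlim.mul_const (2 * Complex.I * z)).add_const d
  -- otherwise `y(x) / e^{izx}` would grow like `e^{2 Im z x}`
  have hc0 : c = 0 := by
    by_contra hne
    have h1 : Tendsto (fun b : ℝ => ‖c‖ * Real.exp (2 * z.im * b)) atTop atTop :=
      Tendsto.const_mul_atTop (norm_pos_iff.2 hne)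
        (Real.tendsto_exp_atTop.comp (tendsto_id.const_mul_atTop (by linarith)))
    refine not_tendsto_atTop_of_tendsto_nhds hlim'.norm (h1.congr' ?_)
    filter_upwards [eventually_ge_atTop a] with b hb
    rw [hratio b hb, norm_mul, norm_pow, Complex.norm_exp, ← Real.exp_nat_mul]
    congr 2
    simp
    ring
  have hd0 : d = -(2 * Complex.I * z) := by
    have h1 : Tendsto (fun b : ℝ => y b / Complex.exp (Complex.I * z * b) * (2 * Complex.I * z) + d)
        atTop (𝓝 0) := by
      refine tendsto_const_nhds.congr' ?_
      filter_upwards [eventually_ge_atTop a] with b hb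
      rw [hratio b hb, hc0, zero_mul]
    have := tendsto_nhds_unique h1 hlim'
    linear_combination -this
  have hya : y a = Complex.exp (Complex.I * z * a) := by
    have := hform a le_rfl
    rw [hc0, hd0] at this
    refine mul_right_cancel₀ hz' ?_
    linear_combination this
  have hya' : y' a = Complex.I * z * y a := by
    have h1 := hc a le_rfl
    rw [hc0, mul_eq_zero] at h1
    have := h1.resolve_left (Complex.exp_ne_zero _)
    linear_combination -this
  -- now the Wronskian with the regular solution at `a` and at `0`
  have hW := (hy' a ha).wronskian ha (hq.regular_isSolutionOn ha z a)
  simp only [sub_self, zero_mul, intervalIntegral.integral_zero, add_zero,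
    hq.regularSolution_zero ha, regularDeriv_zero, mul_one, mul_zero, sub_zero] at hW
  rw [← hW, hq.jostIntegral_eq ha, regularWave_neg, hya', hya]
  ring

theorem isJostFunction (hq : IsTruncatedPotential a Q q) (ha : 0 ≤ a) :
    IsJostFunction q (jostIntegral q) :=
  ⟨hq.differentiable_jostIntegral, fun z _ => hq.exists_isJostSolution ha z⟩

theorem jostFunction_eq (hq : IsTruncatedPotential a Q q) (ha : 0 ≤ a) :
    jostFunction q = jostIntegral q := by
  have h : IsJostFunction q (jostFunction q) := Classical.epsilon_spec ⟨_, hq.isJostFunction ha⟩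
  refine AnalyticOnNhd.eq_of_eventuallyEq (z₀ := Complex.I)
    (h.1.differentiableOn.analyticOnNhd isOpen_univ)
    (hq.differentiable_jostIntegral.differentiableOn.analyticOnNhd isOpen_univ) ?_
  filter_upwards [(isOpen_lt continuous_const Complex.continuous_im).mem_nhds
    (by simp : (0 : ℝ) < Complex.I.im)] with z hz
  obtain ⟨y, hy, hψ⟩ := h.2 z (le_of_lt hz)
  rw [hψ, hq.eq_jostIntegral_of_isJostSolution ha hz hy]

end IsTruncatedPotential

/-! ### Reduction to truncated potentials -/

theorem IsPotential.ae_eq_indicator {a Q : ℝ} {q : ℝ → ℂ} (h : IsPotential a Q q) :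
    (Set.Ioc 0 a).indicator q =ᵐ[volume.restrict (Set.Ioi 0)] q := by
  filter_upwards [h.2.2, ae_restrict_mem measurableSet_Ioi] with x hx h0
  by_cases hxa : x ≤ a
  · rw [Set.indicator_of_mem (Set.mem_Ioc.2 ⟨h0, hxa⟩)]
  · rw [hx (not_le.1 hxa), Set.indicator_of_notMem fun h => hxa h.2]

theorem IsPotential.isTruncatedPotential {a Q : ℝ} (hQ : 0 ≤ Q) {q : ℝ → ℂ}
    (h : IsPotential a Q q) : IsTruncatedPotential a Q ((Set.Ioc 0 a).indicator q) := by
  have hm : MemLp q 1 (volume.restrict (Set.Ioi 0)) :=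
    ⟨h.1, h.2.1.trans_lt ENNReal.ofReal_lt_top⟩
  have hi : IntegrableOn q (Set.Ioi 0) := memLp_one_iff_integrable.1 hm
  refine ⟨(hi.mono_set Set.Ioc_subset_Ioi_self).integrable_indicator measurableSet_Ioc,
    fun t ht => Set.indicator_of_notMem (fun h => ht ⟨h.1.le, h.2⟩) _, ?_⟩
  simp_rw [norm_indicator_eq_indicator_norm]
  rw [integral_indicator measurableSet_Ioc]
  calc ∫ t in Set.Ioc 0 a, ‖q t‖ ≤ ∫ t in Set.Ioi 0, ‖q t‖ :=
        setIntegral_mono_set hi.norm (Eventually.of_forall fun _ => norm_nonneg _)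
          (LE.le.eventuallyLE Set.Ioc_subset_Ioi_self)
    _ = (eLpNorm q 1 (volume.restrict (Set.Ioi 0))).toReal := by
        rw [eLpNorm_one_eq_lintegral_enorm, integral_norm_eq_lintegral_enorm h.1]
    _ ≤ Q := ENNReal.toReal_le_of_le_ofReal hQ h.2.1

theorem isSchrodingerSolution_congr {q r : ℝ → ℂ} (h : q =ᵐ[volume.restrict (Set.Ioi 0)] r) :
    IsSchrodingerSolution q = IsSchrodingerSolution r := by
  have key : ∀ {q r : ℝ → ℂ}, q =ᵐ[volume.restrict (Set.Ioi 0)] r → ∀ z y,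
      IsSchrodingerSolution q z y → IsSchrodingerSolution r z y := by
    rintro q r h z y ⟨y', h1, h2⟩
    refine ⟨y', h1, fun x hx => ?_⟩
    have h3 : (fun t => (q t - z ^ 2) * y t) =ᵐ[volume.restrict (Set.uIoc 0 x)]
        fun t => (r t - z ^ 2) * y t := by
      rw [Set.uIoc_of_le hx]
      filter_upwards [ae_restrict_of_ae_restrict_of_subset Set.Ioc_subset_Ioi_self h] with t ht
      rw [ht]
    refine ⟨(h2 x hx).1.congr_ae h3, ?_⟩
    rw [(h2 x hx).2, intervalIntegral.integral_congr_ae_restrict h3]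
  ext z y
  exact ⟨key h z y, key h.symm z y⟩

theorem IsPotential.jostFunction_eq {a Q : ℝ} (ha : 0 ≤ a) (hQ : 0 ≤ Q) {q : ℝ → ℂ}
    (h : IsPotential a Q q) : jostFunction q = jostIntegral ((Set.Ioc 0 a).indicator q) := by
  rw [← (h.isTruncatedPotential hQ).jostFunction_eq ha, jostFunction, jostFunction]
  congr 1
  ext ψ
  simp only [IsJostFunction, IsJostSolution, isSchrodingerSolution_congr h.ae_eq_indicator]

/-! ### Bounds for the Jost function -/

/-- The properties of a Jost function which enter the comparison of two of them: it is entire of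
exponential type, bounded in the closed upper half-plane, and tends to `1` there like `1 / |z|`. -/
structure IsJostLike (A : ℝ) (ψ : ℂ → ℂ) : Prop where
  differentiable : Differentiable ℂ ψ
  norm_le_exp : ∀ z, ‖ψ z‖ ≤ A * Real.exp (A * ‖z‖)
  norm_le : ∀ z : ℂ, 0 ≤ z.im → ‖ψ z‖ ≤ A
  norm_sub_one_le : ∀ z : ℂ, 0 ≤ z.im → 1 ≤ ‖z‖ → ‖ψ z - 1‖ ≤ A / ‖z‖

namespace IsTruncatedPotential

variable {a Q : ℝ} {q : ℝ → ℂ}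

theorem norm_regularSolution_le (hq : IsTruncatedPotential a Q q) {z : ℂ} {κ : ℝ} (hκ : 0 ≤ κ)
    (hs : ∀ t ∈ Set.Icc 0 a, ‖freeSine z t‖ ≤ κ * Real.exp (|z.im| * t)) {x : ℝ}
    (hx : x ∈ Set.Icc 0 a) :
    ‖regularSolution q z x‖ ≤ κ * Real.exp (|z.im| * x) * Real.exp (κ * Q) :=
  hq.norm_volterra_le hκ hκ hs hs hx

theorem norm_freeSine_le_of_mem (z : ℂ) {t : ℝ} (ht : t ∈ Set.Icc 0 a) :
    ‖freeSine z t‖ ≤ a * Real.exp (|z.im| * t) :=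
  (norm_freeSine_le z ht.1).trans (mul_le_mul_of_nonneg_right ht.2 (Real.exp_pos _).le)

theorem norm_integral_mul_le (hq : IsTruncatedPotential a Q q) {v : ℝ → ℂ} {M : ℝ} (hM : 0 ≤ M)
    (hv : ∀ t ∈ Set.Icc 0 a, ‖v t‖ ≤ M) : ‖∫ t, v t * q t‖ ≤ M * Q := by
  calc ‖∫ t, v t * q t‖ ≤ ∫ t, M * ‖q t‖ := by
        refine norm_integral_le_of_norm_le (hq.integrable.norm.const_mul M)
          (Eventually.of_forall fun t => ?_)
        by_cases ht : t ∈ Set.Icc 0 a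
        · rw [norm_mul]
          exact mul_le_mul_of_nonneg_right (hv t ht) (norm_nonneg _)
        · simp [hq.eq_zero t ht]
    _ ≤ M * Q := by
        rw [integral_const_mul]
        exact mul_le_mul_of_nonneg_left hq.norm_le hM

theorem norm_jostIntegral_sub_one_le (hq : IsTruncatedPotential a Q q) {z : ℂ} {κ : ℝ}
    (hκ : 0 ≤ κ) (hs : ∀ t ∈ Set.Icc 0 a, ‖freeSine z t‖ ≤ κ * Real.exp (|z.im| * t)) {B : ℝ}
    (hB : ∀ t ∈ Set.Icc 0 a, -(z.im * t) + |z.im| * t ≤ B) :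
    ‖jostIntegral q z - 1‖ ≤ κ * Real.exp (κ * Q) * Real.exp B * Q := by
  rw [jostIntegral, add_sub_cancel_left]
  refine hq.norm_integral_mul_le (by positivity) fun t ht => ?_
  rw [norm_mul, norm_exp_I_mul]
  calc Real.exp (-(z.im * t)) * ‖regularSolution q z t‖
      ≤ Real.exp (-(z.im * t)) * (κ * Real.exp (|z.im| * t) * Real.exp (κ * Q)) := by
        gcongr
        exact hq.norm_regularSolution_le hκ hs ht
    _ = κ * Real.exp (κ * Q) * Real.exp (-(z.im * t) + |z.im| * t) := by
        rw [Real.exp_add]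
        ring
    _ ≤ _ := by
        gcongr
        exact hB t ht

/-- The bounds for the Jost function are uniform over the class of potentials. -/
theorem isJostLike (hq : IsTruncatedPotential a Q q) (ha : 0 ≤ a) :
    IsJostLike (1 + 2 * a + a * Real.exp (a * Q) * Q + Real.exp Q * Q) (jostIntegral q) := by
  have hQ := hq.nonneg
  set A := 1 + 2 * a + a * Real.exp (a * Q) * Q + Real.exp Q * Q with hA
  have h1 : 0 ≤ a * Real.exp (a * Q) * Q := by positivity
  have h2 : 0 ≤ Real.exp Q * Q := by positivity
  have hup : ∀ z : ℂ, 0 ≤ z.im → ∀ t ∈ Set.Icc 0 a, -(z.im * t) + |z.im| * t ≤ 0 := by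
    intro z hz t _
    rw [abs_of_nonneg hz]
    linarith
  refine ⟨hq.differentiable_jostIntegral, fun z => ?_, fun z hz => ?_, fun z hz hz1 => ?_⟩
  · have h3 := hq.norm_jostIntegral_sub_one_le ha (fun t ht => norm_freeSine_le_of_mem z ht)
      (B := A * ‖z‖) fun t ht => by
        have h4 := Complex.abs_im_le_norm z
        have h5 := neg_abs_le z.im
        have h6 : |z.im| * t ≤ ‖z‖ * a := mul_le_mul h4 ht.2 ht.1 (norm_nonneg _)
        have h7 : -(z.im * t) ≤ |z.im| * t := by nlinarith [ht.1]
        have h8 : 2 * a * ‖z‖ ≤ A * ‖z‖ := by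
          gcongr
          linarith
        linarith
    have h4 := norm_le_norm_add_norm_sub' (jostIntegral q z) 1
    have h5 : 1 ≤ Real.exp (A * ‖z‖) := Real.one_le_exp (by positivity)
    rw [norm_one] at h4
    calc ‖jostIntegral q z‖ ≤ 1 + a * Real.exp (a * Q) * Real.exp (A * ‖z‖) * Q := by linarith
      _ ≤ Real.exp (A * ‖z‖) + a * Real.exp (a * Q) * Real.exp (A * ‖z‖) * Q := by gcongr
      _ = (1 + a * Real.exp (a * Q) * Q) * Real.exp (A * ‖z‖) := by ring
      _ ≤ A * Real.exp (A * ‖z‖) := by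
        gcongr
        linarith
  · have h3 := hq.norm_jostIntegral_sub_one_le ha (fun t ht => norm_freeSine_le_of_mem z ht)
      (hup z hz)
    have h4 := norm_le_norm_add_norm_sub' (jostIntegral q z) 1
    rw [norm_one] at h4
    rw [Real.exp_zero, mul_one] at h3
    linarith
  · have hz0 : z ≠ 0 := fun h => by norm_num [h] at hz1
    have hi : ‖z‖⁻¹ ≤ 1 := inv_le_one_of_one_le₀ hz1
    have h3 := hq.norm_jostIntegral_sub_one_le (κ := ‖z‖⁻¹) (by positivity)
      (fun t ht => norm_freeSine_le_div hz0 ht.1) (hup z hz)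
    rw [Real.exp_zero, mul_one] at h3
    calc _ ≤ ‖z‖⁻¹ * Real.exp (‖z‖⁻¹ * Q) * Q := h3
      _ ≤ ‖z‖⁻¹ * Real.exp (1 * Q) * Q := by gcongr
      _ = (Real.exp Q * Q) / ‖z‖ := by
        rw [one_mul]
        ring
      _ ≤ A / ‖z‖ := by
        gcongr
        linarith

theorem norm_freeSine_ofReal_le (z : ℝ) {t : ℝ} (ht : 0 ≤ t) : ‖freeSine z t‖ ≤ t := by
  simpa using norm_freeSine_le z ht

theorem norm_regularSolution_ofReal_le (hq : IsTruncatedPotential a Q q) (ha : 0 ≤ a) (z : ℝ)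
    {x : ℝ} (hx : x ∈ Set.Icc 0 a) : ‖regularSolution q z x‖ ≤ a * Real.exp (a * Q) := by
  simpa using hq.norm_regularSolution_le ha (fun t ht => norm_freeSine_le_of_mem (z : ℂ) ht) hx

theorem norm_regularWave_ofReal_le (hq : IsTruncatedPotential a Q q) (ha : 0 ≤ a) (z : ℝ)
    {x : ℝ} (hx : x ∈ Set.Icc 0 a) : ‖regularWave q z x‖ ≤ 1 + a * Real.exp (a * Q) * Q := by
  have hQ := hq.nonneg
  have hn : ∀ t : ℝ, ‖Complex.exp (Complex.I * z * t)‖ = 1 := fun t => by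
    rw [norm_exp_I_mul]
    simp
  rw [hq.regularWave_eq ha _ hx.1]
  refine (norm_add_le _ _).trans ?_
  rw [hn]
  gcongr
  calc _ ≤ ∫ t in (0 : ℝ)..x, a * Real.exp (a * Q) * ‖q t‖ := by
        refine intervalIntegral.norm_integral_le_of_norm_le hx.1
          (Eventually.of_forall fun t ht => ?_) (hq.integrable.norm.intervalIntegrable.const_mul _)
        rw [norm_mul, hn, one_mul, norm_mul, mul_comm]
        gcongr
        exact hq.norm_regularSolution_ofReal_le ha z ⟨ht.1.le, ht.2.trans hx.2⟩
    _ ≤ _ := by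
        rw [intervalIntegral.integral_const_mul]
        gcongr
        exact hq.integral_norm_le hx.1

end IsTruncatedPotential

/-! ### Duality estimates: transformation operators tested against integrable weights -/

/-- The Fourier transform `∫ W(z) e^{izs} dz` of a weight on the real line. -/
noncomputable def waveTransform (W : ℝ → ℂ) (s : ℝ) : ℂ :=
  ∫ z : ℝ, W z * Complex.exp (Complex.I * z * s)

/-- The `L₁` norm over `[-x, x]` of the Fourier transform of a weight. -/
noncomputable def waveNorm (W : ℝ → ℂ) (x : ℝ) : ℝ := ∫ s in (-x)..x, ‖waveTransform W s‖

theorem norm_exp_I_mul_ofReal (z s : ℝ) : ‖Complex.exp (Complex.I * z * s)‖ = 1 := by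
  rw [norm_exp_I_mul]
  simp

theorem integrable_mul_bounded {W : ℝ → ℂ} (hW : Integrable W) {v : ℝ → ℂ} (hv : Continuous v)
    {M : ℝ} (hM : ∀ z, ‖v z‖ ≤ M) : Integrable fun z => W z * v z :=
  hW.mul_bdd hv.aestronglyMeasurable (Eventually.of_forall hM)

theorem continuous_exp_I_mul (s : ℝ) : Continuous fun z : ℝ => Complex.exp (Complex.I * z * s) := by
  fun_prop

theorem integrable_mul_exp {W : ℝ → ℂ} (hW : Integrable W) (s : ℝ) :
    Integrable fun z : ℝ => W z * Complex.exp (Complex.I * z * s) :=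
  integrable_mul_bounded hW (continuous_exp_I_mul s) fun z => (norm_exp_I_mul_ofReal z s).le

theorem continuous_waveTransform {W : ℝ → ℂ} (hW : Integrable W) :
    Continuous (waveTransform W) := by
  refine continuous_of_dominated (bound := fun z => ‖W z‖)
    (fun s => (integrable_mul_exp hW s).1) (fun s => Eventually.of_forall fun z => ?_) hW.norm
    (Eventually.of_forall fun z => by fun_prop)
  rw [norm_mul, norm_exp_I_mul_ofReal, mul_one]

theorem waveTransform_mul_exp (W : ℝ → ℂ) (r s : ℝ) :
    waveTransform (fun z => W z * Complex.exp (Complex.I * z * r)) s = waveTransform W (s + r) := by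
  unfold waveTransform
  congr 1 with z
  rw [mul_assoc, ← Complex.exp_add]
  congr 2
  push_cast
  ring

theorem waveNorm_nonneg (W : ℝ → ℂ) {x : ℝ} (hx : 0 ≤ x) : 0 ≤ waveNorm W x :=
  intervalIntegral.integral_nonneg (by linarith) fun _ _ => norm_nonneg _

theorem integral_norm_waveTransform_add_le {W : ℝ → ℂ} (hW : Integrable W) {r x y : ℝ}
    (hy : 0 ≤ y) (h : |r| + y ≤ x) :
    ∫ s in (-y)..y, ‖waveTransform W (s + r)‖ ≤ waveNorm W x := by
  have h1 := neg_abs_le r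
  have h2 := le_abs_self r
  rw [intervalIntegral.integral_comp_add_right fun s => ‖waveTransform W s‖]
  exact intervalIntegral.integral_mono_interval (by linarith) (by linarith) (by linarith)
    (Eventually.of_forall fun _ => norm_nonneg _)
    ((continuous_waveTransform hW).norm.intervalIntegrable _ _)

theorem waveNorm_mul_exp_le {W : ℝ → ℂ} (hW : Integrable W) {r x y : ℝ}
    (hy : 0 ≤ y) (h : |r| + y ≤ x) :
    waveNorm (fun z => W z * Complex.exp (Complex.I * z * r)) y ≤ waveNorm W x := by
  simp only [waveNorm, waveTransform_mul_exp]
  exact integral_norm_waveTransform_add_le hW hy h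

theorem integral_kernel_swap {W g : ℝ → ℂ} (hW : Integrable W) (hg : Integrable g)
    {K : ℝ → ℝ → ℂ} (hK : StronglyMeasurable (Function.uncurry K)) {M : ℝ}
    (hM : ∀ z t, g t ≠ 0 → ‖K z t‖ ≤ M) :
    ∫ z, W z * ∫ t, K z t * g t = ∫ t, (∫ z, W z * K z t) * g t := by
  have hi : Integrable (Function.uncurry fun z t => W z * (K z t * g t))
      (volume.prod volume) := by
    refine ((hW.mul_prod hg).norm.const_mul M).mono' ?_ (Eventually.of_forall ?_)
    · exact (hW.1.comp_fst).mul (hK.aestronglyMeasurable.mul hg.1.comp_snd)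
    · rintro ⟨z, t⟩
      simp only [Function.uncurry]
      by_cases h : g t = 0
      · simp [h]
      · rw [norm_mul, norm_mul, norm_mul]
        have := mul_le_mul_of_nonneg_right (hM z t h) (mul_nonneg (norm_nonneg (W z))
          (norm_nonneg (g t)))
        linarith
  simp_rw [← integral_const_mul, ← integral_mul_const]
  rw [integral_integral_swap hi]
  congr 1 with t
  congr 1 with z
  ring

theorem freeSine_eq_integral_exp (z : ℂ) (x : ℝ) :
    freeSine z x = 2⁻¹ * ∫ s in (-x)..x, Complex.exp (Complex.I * z * s) := by
  have hi : ∀ c d, IntervalIntegrable (fun s : ℝ => Complex.exp (Complex.I * z * s)) volume c d :=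
    fun c d => (by fun_prop : Continuous fun s : ℝ =>
      Complex.exp (Complex.I * z * s)).intervalIntegrable c d
  have h1 := intervalIntegral.integral_comp_neg (a := 0) (b := x)
    fun s : ℝ => Complex.exp (Complex.I * z * s)
  rw [neg_zero] at h1
  rw [← intervalIntegral.integral_add_adjacent_intervals (hi (-x) 0) (hi 0 x), ← h1,
    ← intervalIntegral.integral_add, freeSine_eq_integral_cos,
    ← intervalIntegral.integral_const_mul]
  · congr 1 with t
    have h2 := cos_sub_freeSine z t
    push_cast
    rw [show Complex.I * z * -(t : ℂ) = -(Complex.I * z * t) by ring, ← h2, ← cos_add_freeSine z t]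
    ring
  · exact (by fun_prop : Continuous fun s : ℝ =>
      Complex.exp (Complex.I * z * (-s : ℝ))).intervalIntegrable _ _
  · exact hi _ _

theorem integral_mul_freeSine {W : ℝ → ℂ} (hW : Integrable W) {x : ℝ} (hx : 0 ≤ x) :
    ∫ z : ℝ, W z * freeSine z x = 2⁻¹ * ∫ s in (-x)..x, waveTransform W s := by
  have h := integral_kernel_swap hW (g := (Set.Ioc (-x) x).indicator fun _ => (1 : ℂ))
    ((integrable_indicator_iff measurableSet_Ioc).2 (integrableOn_const (by simp)))
    (K := fun z s => Complex.exp (Complex.I * z * s))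
    (by simp only [Function.uncurry_def]; fun_prop : Continuous _).stronglyMeasurable
    (M := 1) fun z t _ => (norm_exp_I_mul_ofReal z t).le
  have e : ∀ v : ℝ → ℂ, ∫ t, v t * (Set.Ioc (-x) x).indicator (fun _ => (1 : ℂ)) t =
      ∫ t in (-x)..x, v t := by
    intro v
    rw [intervalIntegral.integral_of_le (by linarith), ← integral_indicator measurableSet_Ioc]
    congr 1 with t
    by_cases ht : t ∈ Set.Ioc (-x) x <;> simp [ht]
  simp only [e] at h
  unfold waveTransform
  rw [← h, ← integral_const_mul]
  congr 1 with z
  rw [freeSine_eq_integral_exp]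
  ring

theorem norm_integral_mul_freeSine_le {W : ℝ → ℂ} (hW : Integrable W) {x : ℝ} (hx : 0 ≤ x) :
    ‖∫ z : ℝ, W z * freeSine z x‖ ≤ 2⁻¹ * waveNorm W x := by
  rw [integral_mul_freeSine hW hx, norm_mul, norm_inv, Complex.norm_ofNat]
  gcongr
  exact intervalIntegral.norm_integral_le_integral_norm (by linarith)

theorem continuous_freeSine_ofReal (y : ℝ) : Continuous fun z : ℝ => freeSine z y :=
  continuous_freeSine.comp (by fun_prop : Continuous fun z : ℝ => ((z : ℂ), y))

theorem integrable_mul_freeSine {W : ℝ → ℂ} (hW : Integrable W) {y : ℝ} (hy : 0 ≤ y) :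
    Integrable fun z : ℝ => W z * freeSine z y :=
  integrable_mul_bounded hW (continuous_freeSine_ofReal y) fun z =>
    IsTruncatedPotential.norm_freeSine_ofReal_le z hy

theorem waveNorm_mul_freeSine_le {W : ℝ → ℂ} (hW : Integrable W) {x y t : ℝ} (hy : 0 ≤ y)
    (ht : 0 ≤ t) (h : t + y ≤ x) :
    waveNorm (fun z => W z * freeSine z y) t ≤ t * waveNorm W x := by
  have hp : ∀ r ∈ Set.Icc (-t) t,
      ‖waveTransform (fun z => W z * freeSine z y) r‖ ≤ 2⁻¹ * waveNorm W x := by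
    intro r hr
    have h1 := norm_integral_mul_freeSine_le (integrable_mul_exp hW r) hy
    have h2 := waveNorm_mul_exp_le hW (r := r) (x := x) hy (by linarith [abs_le.2 hr])
    calc _ = ‖∫ z : ℝ, W z * Complex.exp (Complex.I * z * r) * freeSine z y‖ := by
          unfold waveTransform
          congr 2 with z
          ring
      _ ≤ _ := h1.trans (by gcongr)
  calc waveNorm (fun z => W z * freeSine z y) t ≤ ∫ r in (-t)..t, 2⁻¹ * waveNorm W x :=
        intervalIntegral.integral_mono_on (by linarith)
          ((continuous_waveTransform (integrable_mul_freeSine hW hy)).norm.intervalIntegrable _ _)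
          intervalIntegrable_const hp
    _ = _ := by
      rw [intervalIntegral.integral_const, smul_eq_mul]
      ring

namespace IsTruncatedPotential

variable {a Q : ℝ} {q : ℝ → ℂ}

theorem norm_volterraIter_ofReal_le (hq : IsTruncatedPotential a Q q) (ha : 0 ≤ a) (n : ℕ) (z : ℝ)
    {x : ℝ} (hx : x ∈ Set.Icc 0 a) :
    ‖volterraIter q freeSine n z x‖ ≤ a * ((a * Q) ^ n / n.factorial) := by
  have h := hq.norm_volterraIter_le (u := freeSine) (z := z) (η := 0) (M := a) ha (b := a)
    (fun t ht => by simpa using (norm_freeSine_ofReal_le z ht.1).trans ht.2)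
    (fun t ht => by simpa using (norm_freeSine_ofReal_le z ht.1).trans ht.2) n hx
  have h1 := hq.integral_norm_le hx.1
  have h2 : 0 ≤ ∫ t in (0 : ℝ)..x, ‖q t‖ :=
    intervalIntegral.integral_nonneg hx.1 fun _ _ => norm_nonneg _
  rw [zero_mul, Real.exp_zero, mul_one] at h
  refine h.trans ?_
  gcongr

theorem continuous_volterraIter_ofReal (hq : IsTruncatedPotential a Q q) (n : ℕ) :
    Continuous (Function.uncurry fun (z : ℝ) t => volterraIter q freeSine n z t) :=
  (hq.continuous_volterraIter continuous_uncurry_freeSine n).comp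
    (by fun_prop : Continuous fun p : ℝ × ℝ => ((p.1 : ℂ), p.2))

/-- Each term of the series of the regular solution is, as a function of `z`, the Fourier transform
of a bounded function on `[-x, x]`; stated by duality, with the factorial gain. -/
theorem norm_integral_mul_volterraIter_le (hq : IsTruncatedPotential a Q q) (ha : 0 ≤ a) (n : ℕ)
    {W : ℝ → ℂ} (hW : Integrable W) {x : ℝ} (hx : x ∈ Set.Icc 0 a) :
    ‖∫ z : ℝ, W z * volterraIter q freeSine n z x‖ ≤
      2⁻¹ * ((a * ∫ t in (0 : ℝ)..x, ‖q t‖) ^ n / n.factorial) * waveNorm W x := by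
  induction n generalizing W x with
  | zero => simpa [volterraIter] using norm_integral_mul_freeSine_le hW hx.1
  | succ n ih =>
    have hQ := hq.nonneg
    have hc : Continuous fun t => ∫ s in (0 : ℝ)..t, ‖q s‖ :=
      intervalIntegral.continuous_primitive (fun _ _ => hq.integrable.norm.intervalIntegrable) 0
    have hN := waveNorm_nonneg W hx.1
    have hK : Continuous (Function.uncurry fun z t : ℝ =>
        freeSine z (max (x - t) 0) * volterraIter q freeSine n z t) :=
      (continuous_freeSine.comp (f := fun p : ℝ × ℝ => ((p.1 : ℂ), max (x - p.2) 0))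
        (by fun_prop)).mul (hq.continuous_volterraIter_ofReal n)
    have hsw := integral_kernel_swap hW hq.integrable hK.stronglyMeasurable
      (M := x * (a * ((a * Q) ^ n / n.factorial))) fun z t ht => by
        have ht' : t ∈ Set.Icc 0 a := by
          by_contra h
          exact ht (hq.eq_zero t h)
        rw [norm_mul]
        have h1 := (norm_freeSine_ofReal_le z (le_max_right (x - t) 0)).trans
          (max_le (by linarith [ht'.1]) hx.1 : max (x - t) 0 ≤ x)
        exact mul_le_mul h1 (hq.norm_volterraIter_ofReal_le ha n z ht') (norm_nonneg _) hx.1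
    simp only [volterraIter]
    rw [hsw]
    -- apply the induction hypothesis to the weights `W(z) sin (z (x - t)) / z`; the point `t = 0`,
    -- which lies outside `Ioc 0 x`, is a null set
    have hin : ∀ t, ‖(∫ z : ℝ, W z * (freeSine z (max (x - t) 0) *
        volterraIter q freeSine n z t)) * q t‖ ≤ (Set.Ioc 0 x).indicator (fun t =>
          2⁻¹ * (a ^ (n + 1) / n.factorial) * waveNorm W x *
            (‖q t‖ * (∫ s in (0 : ℝ)..t, ‖q s‖) ^ n)) t ∨ t = 0 := by
      intro t
      rcases lt_trichotomy t 0 with h0 | h0 | h0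
      · left
        simp [hq.eq_zero t fun h => absurd h.1 (not_le.2 h0), not_lt.2 h0.le]
      · exact Or.inr h0
      · left
        by_cases htx : t ≤ x
        · have ht : t ∈ Set.Ioc 0 x := ⟨h0, htx⟩
          rw [Set.indicator_of_mem ht, norm_mul, max_eq_left (by linarith)]
          have h1 : ‖∫ z : ℝ, W z * (freeSine z (x - t) * volterraIter q freeSine n z t)‖ ≤
              2⁻¹ * ((a * ∫ s in (0 : ℝ)..t, ‖q s‖) ^ n / n.factorial) *
                waveNorm (fun z => W z * freeSine z (x - t)) t := by
            simpa only [mul_assoc] using ih (integrable_mul_freeSine hW (y := x - t) (by linarith))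
              (x := t) ⟨h0.le, htx.trans hx.2⟩
          have h2 := waveNorm_mul_freeSine_le hW (x := x) (y := x - t) (t := t) (by linarith) h0.le
            (by linarith)
          have h3 : t * waveNorm W x ≤ a * waveNorm W x := by
            gcongr
            exact htx.trans hx.2
          have h4 : 0 ≤ ∫ s in (0 : ℝ)..t, ‖q s‖ :=
            intervalIntegral.integral_nonneg h0.le fun _ _ => norm_nonneg _
          have h5 := h1.trans (mul_le_mul_of_nonneg_left (h2.trans h3) (by positivity))
          refine (mul_le_mul_of_nonneg_right h5 (norm_nonneg _)).trans_eq ?_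
          rw [mul_pow]
          ring
        · rw [Set.indicator_of_notMem fun h => htx h.2, max_eq_right (by linarith)]
          simp
    calc _ ≤ ∫ t, (Set.Ioc 0 x).indicator (fun t =>
          2⁻¹ * (a ^ (n + 1) / n.factorial) * waveNorm W x *
            (‖q t‖ * (∫ s in (0 : ℝ)..t, ‖q s‖) ^ n)) t := by
          refine norm_integral_le_of_norm_le ?_ ?_
          · refine IntegrableOn.integrable_indicator ?_ measurableSet_Ioc
            rw [← intervalIntegrable_iff_integrableOn_Ioc_of_le hx.1]
            exact (hq.integrable.norm.intervalIntegrable.mul_continuousOn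
              (hc.pow n).continuousOn).const_mul _
          · filter_upwards [compl_mem_ae_iff.2 (measure_singleton (0 : ℝ))] with t ht
            exact (hin t).resolve_right ht
      _ = _ := by
          rw [integral_indicator measurableSet_Ioc, ← intervalIntegral.integral_of_le hx.1,
            intervalIntegral.integral_const_mul, integral_mul_primitive_pow hq.integrable.norm n
            hx.1, mul_pow, Nat.factorial_succ]
          push_cast
          field_simp

theorem continuous_regularSolution_ofReal (hq : IsTruncatedPotential a Q q) :
    Continuous (Function.uncurry fun z t : ℝ => regularSolution q z t) :=
  hq.continuous_regularSolution.comp (by fun_prop : Continuous fun p : ℝ × ℝ => ((p.1 : ℂ), p.2))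

theorem norm_integral_mul_regularSolution_le (hq : IsTruncatedPotential a Q q) (ha : 0 ≤ a)
    {W : ℝ → ℂ} (hW : Integrable W) {x : ℝ} (hx : x ∈ Set.Icc 0 a) :
    ‖∫ z : ℝ, W z * regularSolution q z x‖ ≤ 2⁻¹ * Real.exp (a * Q) * waveNorm W x := by
  have hN := waveNorm_nonneg W hx.1
  have hbd : ∀ n (z : ℝ), ‖W z * volterraIter q freeSine n z x‖ ≤
      (a * ((a * Q) ^ n / n.factorial)) * ‖W z‖ := fun n z => by
    rw [norm_mul, mul_comm]
    gcongr
    exact hq.norm_volterraIter_ofReal_le ha n z hx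
  have hint : ∀ n, Integrable fun z : ℝ => W z * volterraIter q freeSine n z x := fun n =>
    integrable_mul_bounded hW
      ((hq.continuous_volterraIter_ofReal n).comp (Continuous.prodMk_left x)) fun z =>
      hq.norm_volterraIter_ofReal_le ha n z hx
  have hsum : Summable fun n => ∫ z : ℝ, ‖W z * volterraIter q freeSine n z x‖ := by
    refine Summable.of_nonneg_of_le (fun n => integral_nonneg fun _ => norm_nonneg _)
      (fun n => integral_mono (hint n).norm (hW.norm.const_mul _) (hbd n)) ?_
    simp_rw [integral_const_mul]
    exact ((Real.summable_pow_div_factorial (a * Q)).mul_left a).mul_right _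
  have h1 : ∫ z : ℝ, W z * regularSolution q z x =
      ∑' n, ∫ z : ℝ, W z * volterraIter q freeSine n z x := by
    rw [integral_tsum_of_summable_integral_norm hint hsum]
    congr 1 with z
    rw [tsum_mul_left, regularSolution, volterra]
  rw [h1]
  have hs := ((Real.summable_pow_div_factorial (a * Q)).mul_left 2⁻¹).mul_right (waveNorm W x)
  refine (tsum_of_norm_bounded hs.hasSum fun n => ?_).trans_eq ?_
  · refine (hq.norm_integral_mul_volterraIter_le ha n hW hx).trans ?_
    have h1 := hq.integral_norm_le hx.1
    have h2 : 0 ≤ ∫ t in (0 : ℝ)..x, ‖q t‖ :=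
      intervalIntegral.integral_nonneg hx.1 fun _ _ => norm_nonneg _
    gcongr
  · rw [tsum_mul_right, tsum_mul_left, Real.exp_eq_exp_ℝ, NormedSpace.exp_eq_tsum_div]

end IsTruncatedPotential

/-! ### The waves `φ' + i z φ` and their products -/

namespace IsTruncatedPotential

variable {a Q : ℝ} {q q₁ q₂ : ℝ → ℂ}

theorem continuous_regularWave (hq : IsTruncatedPotential a Q q) (x : ℝ) :
    Continuous fun z : ℝ => regularWave q z x := by
  have h1 : Continuous fun z : ℝ => regularSolution q z x :=
    hq.continuous_regularSolution_ofReal.comp (Continuous.prodMk_left x)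
  have h2 : Continuous fun z : ℝ => ∫ t in (0 : ℝ)..x,
      Complex.cos (z * (x - t : ℝ)) * (q t * regularSolution q z t) := by
    have : ∀ z : ℝ, ∫ t in (0 : ℝ)..x, Complex.cos (z * (x - t : ℝ)) *
        (q t * regularSolution q z t) = if 0 ≤ x then ∫ t, (Complex.cos (z * (x - t : ℝ)) *
          regularSolution q z t) * (Set.Icc 0 x).indicator q t else 0 := by
      intro z
      split_ifs with hx
      · rw [intervalIntegral.integral_of_le hx, ← integral_Icc_eq_integral_Ioc,
          ← integral_indicator measurableSet_Icc]
        congr 1 with t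
        by_cases ht : t ∈ Set.Icc 0 x
        · simp only [Set.indicator_of_mem ht]
          ring
        · simp only [Set.indicator_of_notMem ht, mul_zero]
      · rw [← hq.intervalIntegral_eq_zero (fun t => regularSolution q z t *
          Complex.cos (z * (x - t : ℝ))) (not_le.1 hx).le]
        congr 1 with t
        ring
    simp only [this]
    split_ifs with hx
    · refine continuous_integral_kernel_mul (X := ℝ) (a := x)
        (k := fun z t => Complex.cos (z * (x - t : ℝ)) * regularSolution q z t) ?_
        (hq.integrable.indicator measurableSet_Icc) fun t ht => Set.indicator_of_notMem ht _
      exact (by fun_prop : Continuous fun p : ℝ × ℝ => Complex.cos (p.1 * (x - p.2 : ℝ))).mul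
        hq.continuous_regularSolution_ofReal
    · exact continuous_const
  unfold regularWave regularDeriv
  exact ((by fun_prop : Continuous fun z : ℝ => Complex.cos (z * x)).add h2).add
    ((continuous_const.mul Complex.continuous_ofReal).mul h1)

/-- `φ' + i z φ - e^{izx}` is the Fourier transform of a bounded function on `[-x, x]`, stated by
duality. -/
theorem norm_integral_mul_regularWave_sub_le (hq : IsTruncatedPotential a Q q) (ha : 0 ≤ a)
    {W : ℝ → ℂ} (hW : Integrable W) {x : ℝ} (hx : x ∈ Set.Icc 0 a) :
    ‖(∫ z : ℝ, W z * regularWave q z x) - waveTransform W x‖ ≤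
      2⁻¹ * Real.exp (a * Q) * Q * waveNorm W x := by
  have hN := waveNorm_nonneg W hx.1
  have hgi : Integrable ((Set.Ioc 0 x).indicator q) := hq.integrable.indicator measurableSet_Ioc
  have hK : Continuous (Function.uncurry fun z t : ℝ =>
      Complex.exp (Complex.I * z * (x - t : ℝ)) * regularSolution q z t) :=
    (by fun_prop : Continuous fun p : ℝ × ℝ => Complex.exp (Complex.I * p.1 * (x - p.2 : ℝ))).mul
      hq.continuous_regularSolution_ofReal
  have hKb : ∀ z t : ℝ, (Set.Ioc 0 x).indicator q t ≠ 0 →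
      ‖Complex.exp (Complex.I * z * (x - t : ℝ)) * regularSolution q z t‖ ≤
        a * Real.exp (a * Q) := by
    intro z t ht
    have ht' : t ∈ Set.Ioc 0 x := by
      by_contra h
      exact ht (Set.indicator_of_notMem h _)
    rw [norm_mul, norm_exp_I_mul_ofReal, one_mul]
    exact hq.norm_regularSolution_ofReal_le ha z ⟨ht'.1.le, ht'.2.trans hx.2⟩
  have e : ∀ z : ℝ, regularWave q z x - Complex.exp (Complex.I * z * x) =
      ∫ t, (Complex.exp (Complex.I * z * (x - t : ℝ)) * regularSolution q z t) *
        (Set.Ioc 0 x).indicator q t := by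
    intro z
    rw [hq.regularWave_eq ha _ hx.1, add_sub_cancel_left, intervalIntegral.integral_of_le hx.1,
      ← integral_indicator measurableSet_Ioc]
    congr 1 with t
    by_cases ht : t ∈ Set.Ioc 0 x
    · simp only [Set.indicator_of_mem ht]
      ring
    · simp only [Set.indicator_of_notMem ht, mul_zero]
  have hi : Integrable fun z : ℝ => W z * regularWave q z x :=
    integrable_mul_bounded hW (hq.continuous_regularWave x) fun z =>
      hq.norm_regularWave_ofReal_le ha z hx
  rw [waveTransform, ← integral_sub hi (integrable_mul_exp hW x)]
  simp_rw [← mul_sub, e]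
  rw [integral_kernel_swap hW hgi hK.stronglyMeasurable hKb]
  calc _ ≤ ∫ t, 2⁻¹ * Real.exp (a * Q) * waveNorm W x * ‖q t‖ := by
        refine norm_integral_le_of_norm_le (hq.integrable.norm.const_mul _)
          (Eventually.of_forall fun t => ?_)
        by_cases ht : t ∈ Set.Ioc 0 x
        · rw [Set.indicator_of_mem ht, norm_mul]
          refine mul_le_mul_of_nonneg_right ?_ (norm_nonneg _)
          have h1 := hq.norm_integral_mul_regularSolution_le ha (integrable_mul_exp hW (x - t))
            (x := t) ⟨ht.1.le, ht.2.trans hx.2⟩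
          have h2 := waveNorm_mul_exp_le hW (r := x - t) (x := x) ht.1.le
            (by rw [abs_of_nonneg (by linarith [ht.2])]; linarith)
          simp only [← mul_assoc]
          exact h1.trans (by gcongr)
        · rw [Set.indicator_of_notMem ht, mul_zero, norm_zero]
          positivity
    _ ≤ _ := by
        rw [integral_const_mul]
        have := mul_le_mul_of_nonneg_left hq.norm_le
          (by positivity : 0 ≤ 2⁻¹ * Real.exp (a * Q) * waveNorm W x)
        linarith

/-- The product of two waves is `e^{2izx}` up to the Fourier transform of a bounded function on
`[-2x, 2x]`, stated by duality. The boundedness of this function, uniformly over the class of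
potentials, makes the recovery of `q₂ - q₁` a Volterra equation with bounded kernel. -/
theorem norm_integral_mul_regularWave_mul_sub_le (hq₁ : IsTruncatedPotential a Q q₁)
    (hq₂ : IsTruncatedPotential a Q q₂) (ha : 0 ≤ a) {C : ℝ}
    (hC : C = 2⁻¹ * Real.exp (a * Q) * Q)
    {W : ℝ → ℂ} (hW : Integrable W) {x : ℝ} (hx : x ∈ Set.Icc 0 a) :
    ‖(∫ z : ℝ, W z * (regularWave q₁ z x * regularWave q₂ z x)) - waveTransform W (2 * x)‖ ≤
      (2 * C + 2 * a * C ^ 2) * waveNorm W (2 * x) := by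
  have hQ := hq₁.nonneg
  have hC0 : 0 ≤ C := by rw [hC]; positivity
  have hx2 : 0 ≤ 2 * x := by linarith [hx.1]
  have hN := waveNorm_nonneg W hx2
  -- replace first one wave by `e^{izx}` and then, with the new weight, the other one
  have hW2 : Integrable fun z : ℝ => W z * regularWave q₂ z x :=
    integrable_mul_bounded hW (hq₂.continuous_regularWave x) fun z =>
      hq₂.norm_regularWave_ofReal_le ha z hx
  have hr : ∀ r, |r| ≤ x → ‖waveTransform (fun z => W z * regularWave q₂ z x) r -
      waveTransform W (x + r)‖ ≤ C * waveNorm W (2 * x) := by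
    intro r hr
    have h1 := hq₂.norm_integral_mul_regularWave_sub_le ha (integrable_mul_exp hW r) hx
    have h2 := waveNorm_mul_exp_le hW (r := r) (x := 2 * x) hx.1 (by linarith)
    rw [waveTransform_mul_exp, ← hC] at h1
    refine (le_of_eq ?_).trans (h1.trans (by gcongr))
    congr 2
    unfold waveTransform
    congr 1 with z
    ring
  have h1 := hq₁.norm_integral_mul_regularWave_sub_le ha hW2 hx
  rw [← hC] at h1
  have h2 := hr x (abs_of_nonneg hx.1).le
  have h3 : waveNorm (fun z => W z * regularWave q₂ z x) x ≤
      waveNorm W (2 * x) + 2 * x * (C * waveNorm W (2 * x)) := by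
    have hc : Continuous fun s => ‖waveTransform W (s + x)‖ :=
      ((continuous_waveTransform hW).comp (continuous_add_const x)).norm
    have h4 := integral_norm_waveTransform_add_le hW (r := x) (x := 2 * x) hx.1
      (by rw [abs_of_nonneg hx.1]; linarith)
    calc waveNorm (fun z => W z * regularWave q₂ z x) x
        ≤ ∫ s in (-x)..x, (‖waveTransform W (s + x)‖ + C * waveNorm W (2 * x)) := by
          refine intervalIntegral.integral_mono_on (by linarith [hx.1])
            ((continuous_waveTransform hW2).norm.intervalIntegrable _ _)
            ((hc.add continuous_const).intervalIntegrable _ _)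
            fun s hs => ?_
          have h5 := hr s (abs_le.2 hs)
          rw [add_comm x s] at h5
          have h6 := norm_le_norm_add_norm_sub'
            (waveTransform (fun z => W z * regularWave q₂ z x) s) (waveTransform W (s + x))
          linarith
      _ ≤ _ := by
          rw [intervalIntegral.integral_add (hc.intervalIntegrable _ _)
            intervalIntegrable_const, intervalIntegral.integral_const, smul_eq_mul]
          linarith
  have e1 : ∫ z : ℝ, W z * (regularWave q₁ z x * regularWave q₂ z x) =
      ∫ z : ℝ, W z * regularWave q₂ z x * regularWave q₁ z x := by
    congr 1 with z
    ring
  rw [← two_mul] at h2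
  have h5 := norm_sub_le_norm_sub_add_norm_sub
    (∫ z : ℝ, W z * regularWave q₂ z x * regularWave q₁ z x)
    (waveTransform (fun z => W z * regularWave q₂ z x) x) (waveTransform W (2 * x))
  rw [e1]
  have h6 := mul_le_mul_of_nonneg_left h3 hC0
  have h7 : 2 * x * (C * (C * waveNorm W (2 * x))) ≤ 2 * a * (C * (C * waveNorm W (2 * x))) := by
    have := hx.2
    gcongr
  nlinarith

end IsTruncatedPotential

/-! ### A Volterra inequality for the difference of two potentials -/

/-- `∫_x^∞ (q₂ - q₁)`, the quantity to be estimated. -/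
noncomputable def tailDiff (q₁ q₂ : ℝ → ℂ) (x : ℝ) : ℂ := ∫ t in Set.Ioi x, (q₂ t - q₁ t)

/-- The combination `ψ₁(z) ψ₂(-z) - ψ₁(-z) ψ₂(z)` of two Jost functions. -/
noncomputable def jostBracket (ψ₁ ψ₂ : ℂ → ℂ) (z : ℂ) : ℂ := ψ₁ z * ψ₂ (-z) - ψ₁ (-z) * ψ₂ z

/-- The difference at `z` and `-z` of the product of the waves of two potentials; it equals
`2 i z` times the derivative in `x` of the product of the regular solutions. -/
noncomputable def waveDiff (q₁ q₂ : ℝ → ℂ) (z : ℂ) (x : ℝ) : ℂ :=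
  regularWave q₁ z x * regularWave q₂ z x - regularWave q₁ (-z) x * regularWave q₂ (-z) x

namespace IsTruncatedPotential

variable {a Q : ℝ} {q q₁ q₂ : ℝ → ℂ}

theorem tailDiff_eq (hq₁ : IsTruncatedPotential a Q q₁) (hq₂ : IsTruncatedPotential a Q q₂)
    (x y : ℝ) : tailDiff q₁ q₂ x - tailDiff q₁ q₂ y = ∫ t in x..y, (q₂ t - q₁ t) := by
  have hi := hq₂.integrable.sub hq₁.integrable
  have h := intervalIntegral.integral_interval_add_Ioi (f := fun t => q₂ t - q₁ t) (a := x) (b := y)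
    hi.integrableOn hi.integrableOn
  rw [tailDiff, tailDiff, ← h, add_sub_cancel_right]

theorem tailDiff_of_le (hq₁ : IsTruncatedPotential a Q q₁) (hq₂ : IsTruncatedPotential a Q q₂)
    {x : ℝ} (hx : a ≤ x) : tailDiff q₁ q₂ x = 0 := by
  refine setIntegral_eq_zero_of_forall_eq_zero fun t ht => ?_
  have ht' : t ∉ Set.Icc 0 a := fun h => absurd (hx.trans_lt ht) (not_lt.2 h.2)
  rw [hq₁.eq_zero t ht', hq₂.eq_zero t ht', sub_zero]

theorem continuous_tailDiff (hq₁ : IsTruncatedPotential a Q q₁)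
    (hq₂ : IsTruncatedPotential a Q q₂) : Continuous (tailDiff q₁ q₂) := by
  have hi := hq₂.integrable.sub hq₁.integrable
  have h : tailDiff q₁ q₂ = fun x => tailDiff q₁ q₂ 0 - ∫ t in (0 : ℝ)..x, (q₂ t - q₁ t) := by
    ext x
    rw [← hq₁.tailDiff_eq hq₂]
    ring
  rw [h]
  exact continuous_const.sub
    (intervalIntegral.continuous_primitive (fun _ _ => hi.intervalIntegrable) 0)

/-- Integrating the Wronskian identity by parts: the pairing of `∫_x^a (q₂ - q₁)` with the
derivative of the product of regular solutions is determined by the two Jost functions. -/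
theorem integral_tailDiff_mul_waveDiff (hq₁ : IsTruncatedPotential a Q q₁)
    (hq₂ : IsTruncatedPotential a Q q₂) (ha : 0 ≤ a) (z : ℂ) :
    ∫ x in (0 : ℝ)..a, waveDiff q₁ q₂ z x * tailDiff q₁ q₂ x =
      -jostBracket (jostIntegral q₁) (jostIntegral q₂) z := by
  set φ₁ := regularSolution q₁ z with hφ₁
  set φ₂ := regularSolution q₂ z with hφ₂
  set v₁ := regularDeriv q₁ z with hv₁
  set v₂ := regularDeriv q₂ z with hv₂
  set f := tailDiff q₁ q₂ with hf
  have hi := hq₂.integrable.sub hq₁.integrable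
  obtain ⟨hc₁, hd₁, _⟩ := hq₁.regular_isSolution ha z
  obtain ⟨hc₂, hd₂, _⟩ := hq₂.regular_isSolution ha z
  have hφc₁ := hq₁.continuous_regularSolution_right z
  have hφc₂ := hq₂.continuous_regularSolution_right z
  have hfc := hq₁.continuous_tailDiff hq₂
  have hW := (hq₁.regular_isSolutionOn ha z a).wronskian ha (hq₂.regular_isSolutionOn ha z a)
  simp only [hq₁.regularSolution_zero ha, hq₂.regularSolution_zero ha, zero_mul, mul_zero,
    sub_zero, zero_add] at hW
  have hG : ∀ x, φ₁ x * φ₂ x = φ₁ 0 * φ₂ 0 + ∫ t in (0 : ℝ)..x, (v₁ t * φ₂ t + φ₁ t * v₂ t) := by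
    intro x
    rw [intervalIntegral.integral_eq_sub_of_hasDerivAt
      (fun t _ => (hd₁ t).mul (hd₂ t))
      (((hc₁.mul hφc₂).add (hφc₁.mul hc₂)).intervalIntegrable _ _)]
    simp only [Pi.mul_apply, hφ₁, hφ₂]
    ring
  have hP := mul_eq_add_integral_of_eq_add_integral (b := a)
    (f := fun t => -(q₂ t - q₁ t)) (g := fun t => v₁ t * φ₂ t + φ₁ t * v₂ t) (F := f)
    (G := fun x => φ₁ x * φ₂ x) hi.neg.intervalIntegrable
    (((hc₁.mul hφc₂).add (hφc₁.mul hc₂)).intervalIntegrable _ _) ha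
    (fun x _ => by
      rw [intervalIntegral.integral_neg, ← hq₁.tailDiff_eq hq₂]
      simp only [hf]
      ring) (fun x _ => hG x)
  have h0 : φ₁ 0 = 0 := hq₁.regularSolution_zero ha z
  rw [hf, hq₁.tailDiff_of_le hq₂ le_rfl, ← hf, zero_mul, h0, zero_mul, mul_zero, zero_add,
    intervalIntegral.integral_add] at hP
  · have e1 : ∫ t in (0 : ℝ)..a, -(q₂ t - q₁ t) * (φ₁ t * φ₂ t) =
        -∫ t in (0 : ℝ)..a, (q₂ t - q₁ t) * (φ₁ t * φ₂ t) := by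
      rw [← intervalIntegral.integral_neg]
      congr 1 with t
      ring
    rw [e1, ← hW] at hP
    have e2 : ∫ x in (0 : ℝ)..a, waveDiff q₁ q₂ z x * f x =
        2 * Complex.I * z * ∫ t in (0 : ℝ)..a, f t * (v₁ t * φ₂ t + φ₁ t * v₂ t) := by
      rw [← intervalIntegral.integral_const_mul]
      congr 1 with t
      simp only [waveDiff, regularWave_neg]
      simp only [regularWave, ← hφ₁, ← hφ₂, ← hv₁, ← hv₂]
      ring
    rw [e2, jostBracket, hq₁.jostIntegral_eq ha, hq₂.jostIntegral_eq ha, hq₁.jostIntegral_eq ha,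
      hq₂.jostIntegral_eq ha]
    simp only [neg_neg, regularWave_neg]
    simp only [regularWave, ← hφ₁, ← hφ₂, ← hv₁, ← hv₂]
    have hE : Complex.exp (Complex.I * z * a) * Complex.exp (Complex.I * -z * a) = 1 := by
      rw [← Complex.exp_add, show Complex.I * z * a + Complex.I * -z * a = 0 by ring,
        Complex.exp_zero]
    linear_combination (-(2 * Complex.I * z)) * hP + (2 * Complex.I * z *
      (v₁ a * φ₂ a - φ₁ a * v₂ a)) * hE
  · exact hi.neg.intervalIntegrable.mul_continuousOn (hφc₁.mul hφc₂).continuousOn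
  · exact (hfc.mul ((hc₁.mul hφc₂).add (hφc₁.mul hc₂))).intervalIntegrable _ _

theorem continuous_regularWave_right (hq : IsTruncatedPotential a Q q) (ha : 0 ≤ a) (z : ℂ) :
    Continuous (regularWave q z) :=
  (hq.regular_isSolution ha z).1.add
    (continuous_const.mul (hq.continuous_regularSolution_right z))

theorem continuous_regularWave_neg (hq : IsTruncatedPotential a Q q) (x : ℝ) :
    Continuous fun z : ℝ => regularWave q (-(z : ℂ)) x := by
  simpa [Function.comp_def] using (hq.continuous_regularWave x).comp continuous_neg

theorem continuous_waveDiff (hq₁ : IsTruncatedPotential a Q q₁) (hq₂ : IsTruncatedPotential a Q q₂)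
    (x : ℝ) : Continuous fun z : ℝ => waveDiff q₁ q₂ z x :=
  ((hq₁.continuous_regularWave x).mul (hq₂.continuous_regularWave x)).sub
    ((hq₁.continuous_regularWave_neg x).mul (hq₂.continuous_regularWave_neg x))

theorem norm_waveDiff_le (hq₁ : IsTruncatedPotential a Q q₁) (hq₂ : IsTruncatedPotential a Q q₂)
    (ha : 0 ≤ a) (z : ℝ) {x : ℝ} (hx : x ∈ Set.Icc 0 a) :
    ‖waveDiff q₁ q₂ z x‖ ≤ 2 * (1 + a * Real.exp (a * Q) * Q) ^ 2 := by
  have hQ := hq₁.nonneg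
  have h1 := hq₁.norm_regularWave_ofReal_le ha z hx
  have h2 := hq₂.norm_regularWave_ofReal_le ha z hx
  have h3 := hq₁.norm_regularWave_ofReal_le ha (-z) hx
  have h4 := hq₂.norm_regularWave_ofReal_le ha (-z) hx
  push_cast at h3 h4
  refine (norm_sub_le _ _).trans ?_
  rw [norm_mul, norm_mul, two_mul, sq]
  gcongr

theorem integral_mul_comp_neg (W : ℝ → ℂ) (v : ℝ → ℂ) :
    ∫ z : ℝ, W (-z) * v z = ∫ z : ℝ, W z * v (-z) := by
  rw [← integral_neg_eq_self]
  simp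

theorem waveTransform_comp_neg (W : ℝ → ℂ) (s : ℝ) :
    waveTransform (fun z => W (-z)) s = waveTransform W (-s) := by
  unfold waveTransform
  rw [integral_mul_comp_neg]
  congr 1 with z
  congr 2
  push_cast
  ring

theorem waveNorm_comp_neg (W : ℝ → ℂ) (x : ℝ) : waveNorm (fun z => W (-z)) x = waveNorm W x := by
  unfold waveNorm
  simp only [waveTransform_comp_neg]
  rw [intervalIntegral.integral_comp_neg fun s => ‖waveTransform W s‖, neg_neg]

theorem norm_integral_mul_waveDiff_sub_le (hq₁ : IsTruncatedPotential a Q q₁)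
    (hq₂ : IsTruncatedPotential a Q q₂) (ha : 0 ≤ a) {C : ℝ}
    (hC : C = 2⁻¹ * Real.exp (a * Q) * Q)
    {W : ℝ → ℂ} (hW : Integrable W) {x : ℝ} (hx : x ∈ Set.Icc 0 a) :
    ‖(∫ z : ℝ, W z * waveDiff q₁ q₂ z x) -
        (waveTransform W (2 * x) - waveTransform W (-(2 * x)))‖ ≤
      2 * (2 * C + 2 * a * C ^ 2) * waveNorm W (2 * x) := by
  have h1 := hq₁.norm_integral_mul_regularWave_mul_sub_le hq₂ ha hC hW hx
  have h2 := hq₁.norm_integral_mul_regularWave_mul_sub_le hq₂ ha hC hW.comp_neg hx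
  rw [waveTransform_comp_neg, waveNorm_comp_neg,
    integral_mul_comp_neg W fun z : ℝ => regularWave q₁ z x * regularWave q₂ z x] at h2
  have hb : ∀ z : ℝ, ‖regularWave q₁ z x * regularWave q₂ z x‖ ≤
      (1 + a * Real.exp (a * Q) * Q) ^ 2 := by
    intro z
    have hQ := hq₁.nonneg
    rw [norm_mul, sq]
    exact mul_le_mul (hq₁.norm_regularWave_ofReal_le ha z hx)
      (hq₂.norm_regularWave_ofReal_le ha z hx) (norm_nonneg _) (by positivity)
  have hc := (hq₁.continuous_regularWave x).mul (hq₂.continuous_regularWave x)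
  have i1 := integrable_mul_bounded hW hc hb
  have i2 := integrable_mul_bounded hW (hc.comp continuous_neg) fun z => hb (-z)
  have e : ∫ z : ℝ, W z * waveDiff q₁ q₂ z x =
      (∫ z : ℝ, W z * (regularWave q₁ z x * regularWave q₂ z x)) -
        ∫ z : ℝ, W z * (regularWave q₁ (-z : ℝ) x * regularWave q₂ (-z : ℝ) x) := by
    refine Eq.trans ?_ (integral_sub i1 i2)
    congr 1 with z
    simp only [waveDiff]
    push_cast
    exact mul_sub _ _ _
  rw [e, sub_sub_sub_comm]
  refine (norm_sub_le _ _).trans ?_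
  linarith

/-- The Volterra inequality: testing the pairing identity against a weight whose Fourier transform
lives to the right of `2 t₀` only involves `∫_x^a (q₂ - q₁)` for `x > t₀`. -/
theorem norm_integral_tailDiff_mul_waveTransform_le (hq₁ : IsTruncatedPotential a Q q₁)
    (hq₂ : IsTruncatedPotential a Q q₂) (ha : 0 ≤ a) {C : ℝ}
    (hC : C = 2⁻¹ * Real.exp (a * Q) * Q) {W : ℝ → ℂ} (hW : Integrable W) {t₀ : ℝ}
    (ht₀ : t₀ ∈ Set.Icc 0 a) (hneg : ∀ s, s ≤ 2 * t₀ → waveTransform W s = 0)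
    (hmass : ∀ y, 0 ≤ y → waveNorm W y ≤ 1) :
    ‖∫ x in (0 : ℝ)..a, tailDiff q₁ q₂ x * waveTransform W (2 * x)‖ ≤
      ‖∫ z : ℝ, W z * jostBracket (jostIntegral q₁) (jostIntegral q₂) z‖ +
        2 * (2 * C + 2 * a * C ^ 2) * ∫ x in t₀..a, ‖tailDiff q₁ q₂ x‖ := by
  have hQ := hq₁.nonneg
  have hC0 : 0 ≤ C := by rw [hC]; positivity
  set f := tailDiff q₁ q₂ with hf
  have hfc : Continuous f := hq₁.continuous_tailDiff hq₂
  set D : ℝ → ℂ := fun x => ∫ z : ℝ, W z * waveDiff q₁ q₂ z x with hD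
  have hDc : ContinuousOn D (Set.Icc 0 a) := by
    refine continuousOn_of_dominated
      (bound := fun z => ‖W z‖ * (2 * (1 + a * Real.exp (a * Q) * Q) ^ 2))
      (fun x _ => hW.1.mul (hq₁.continuous_waveDiff hq₂ x).aestronglyMeasurable)
      (fun x hx => Eventually.of_forall fun z => ?_) (hW.norm.mul_const _)
      (Eventually.of_forall fun z => Continuous.continuousOn ?_)
    · rw [norm_mul]
      exact mul_le_mul_of_nonneg_left (hq₁.norm_waveDiff_le hq₂ ha z hx) (norm_nonneg _)
    · exact continuous_const.mul (((hq₁.continuous_regularWave_right ha z).mul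
        (hq₂.continuous_regularWave_right ha z)).sub ((hq₁.continuous_regularWave_right ha _).mul
        (hq₂.continuous_regularWave_right ha _)))
  have hK : StronglyMeasurable (Function.uncurry fun z x : ℝ => waveDiff q₁ q₂ z x) := by
    refine stronglyMeasurable_uncurry_of_continuous_of_stronglyMeasurable
      (u := fun z x : ℝ => waveDiff q₁ q₂ z x) (fun x => hq₁.continuous_waveDiff hq₂ x) fun z => ?_
    exact (((hq₁.continuous_regularWave_right ha z).mul
        (hq₂.continuous_regularWave_right ha z)).sub ((hq₁.continuous_regularWave_right ha _).mul
        (hq₂.continuous_regularWave_right ha _))).stronglyMeasurable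
  have hfi : Integrable ((Set.Ioc 0 a).indicator f) :=
    ((hfc.integrableOn_Icc (a := 0) (b := a)).mono_set
      Set.Ioc_subset_Icc_self).integrable_indicator measurableSet_Ioc
  have hsw := integral_kernel_swap hW hfi hK
    (M := 2 * (1 + a * Real.exp (a * Q) * Q) ^ 2) fun z x hx => by
      have hx' : x ∈ Set.Ioc 0 a := by
        by_contra h
        exact hx (Set.indicator_of_notMem h _)
      exact hq₁.norm_waveDiff_le hq₂ ha z ⟨hx'.1.le, hx'.2⟩
  have hind : ∀ v : ℝ → ℂ, ∫ x, v x * (Set.Ioc 0 a).indicator f x =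
      ∫ x in (0 : ℝ)..a, v x * f x := by
    intro v
    rw [intervalIntegral.integral_of_le ha, ← integral_indicator measurableSet_Ioc]
    congr 1 with t
    by_cases ht : t ∈ Set.Ioc 0 a <;> simp [ht]
  simp only [hind] at hsw
  simp_rw [hf, hq₁.integral_tailDiff_mul_waveDiff hq₂ ha] at hsw
  rw [← hf] at hsw
  have hw := (continuous_waveTransform hW).comp (continuous_const_mul (2 : ℝ))
  have hu : Set.uIcc 0 a = Set.Icc 0 a := Set.uIcc_of_le ha
  have i1 : IntervalIntegrable (fun x => D x * f x) volume 0 a :=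
    (hu ▸ hDc.mul hfc.continuousOn : ContinuousOn _ (Set.uIcc 0 a)).intervalIntegrable
  have i2 : IntervalIntegrable (fun x => f x * waveTransform W (2 * x)) volume 0 a :=
    (hfc.mul hw).intervalIntegrable _ _
  have hsplit : ∫ x in (0 : ℝ)..a, f x * waveTransform W (2 * x) =
      (∫ x in (0 : ℝ)..a, (f x * waveTransform W (2 * x) - D x * f x)) +
        ∫ x in (0 : ℝ)..a, D x * f x := by
    rw [intervalIntegral.integral_sub i2 i1]
    ring
  have hJ : ∫ x in (0 : ℝ)..a, D x * f x =
      -∫ z : ℝ, W z * jostBracket (jostIntegral q₁) (jostIntegral q₂) z := by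
    rw [← integral_neg, hD, ← hsw]
    congr 1 with z
    ring
  rw [hsplit, hJ, add_comm]
  refine (norm_add_le _ _).trans ?_
  rw [norm_neg]
  refine add_le_add le_rfl ?_
  have hle : ∀ x ∈ Set.Ioc 0 a, ‖f x * waveTransform W (2 * x) - D x * f x‖ ≤
      (Set.Ioc t₀ a).indicator (fun x => 2 * (2 * C + 2 * a * C ^ 2) * ‖f x‖) x := by
    intro x hx
    have h1 := hq₁.norm_integral_mul_waveDiff_sub_le hq₂ ha hC hW (x := x) ⟨hx.1.le, hx.2⟩
    rw [hneg (-(2 * x)) (by linarith [hx.1, ht₀.1]), sub_zero, norm_sub_rev] at h1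
    have h2 : f x * waveTransform W (2 * x) - D x * f x =
        (waveTransform W (2 * x) - D x) * f x := by
      ring
    rw [h2, norm_mul]
    -- for `x ≤ t₀` the Fourier transform of the weight vanishes on `[-2x, 2x]`
    by_cases hxt : t₀ < x
    · rw [Set.indicator_of_mem (show x ∈ Set.Ioc t₀ a from ⟨hxt, hx.2⟩)]
      refine mul_le_mul_of_nonneg_right (h1.trans ?_) (norm_nonneg _)
      exact mul_le_of_le_one_right (by positivity) (hmass _ (by linarith [hx.1]))
    · rw [Set.indicator_of_notMem fun h => hxt h.1]
      have h3 : waveNorm W (2 * x) = 0 := by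
        unfold waveNorm
        refine intervalIntegral.integral_zero_ae (Eventually.of_forall fun s hs => ?_)
        rw [Set.uIoc_of_le (by linarith [hx.1])] at hs
        rw [hneg s (by linarith [hs.2, not_lt.1 hxt]), norm_zero]
      rw [h3, mul_zero] at h1
      rw [le_antisymm h1 (norm_nonneg _), zero_mul]
  have hint : IntegrableOn (fun x => 2 * (2 * C + 2 * a * C ^ 2) * ‖f x‖) (Set.Ioc t₀ a) :=
    ((hfc.norm.const_mul _).integrableOn_Icc (a := t₀) (b := a)).mono_set Set.Ioc_subset_Icc_self
  refine (intervalIntegral.norm_integral_le_of_norm_le ha (Eventually.of_forall hle)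
    (hint.integrable_indicator measurableSet_Ioc).intervalIntegrable).trans_eq ?_
  rw [intervalIntegral.integral_of_le ha, setIntegral_indicator measurableSet_Ioc,
    Set.inter_eq_right.2 (Set.Ioc_subset_Ioc_left ht₀.1), ← intervalIntegral.integral_of_le ht₀.2,
    intervalIntegral.integral_const_mul]

end IsTruncatedPotential

/-! ### Localisation by a band-limited bump -/

open scoped FourierTransform ContDiff in
/-- A weight on the real line with rapid decay whose Fourier transform is a probability density
supported in `(0, 1)`. -/
theorem exists_bump_weight : ∃ (w : ℝ → ℂ) (ρ : ℝ → ℝ), Continuous w ∧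
    (∀ k : ℕ, Integrable fun z => |z| ^ k * ‖w z‖) ∧ (∀ s, waveTransform w s = ρ s) ∧
    Continuous ρ ∧ (∀ s, 0 ≤ ρ s) ∧ (∀ s, s ≤ 0 → ρ s = 0) ∧ (∀ s, 1 ≤ s → ρ s = 0) ∧
    Integrable ρ ∧ ∫ s, ρ s = 1 := by
  let b : ContDiffBump (1 / 2 : ℝ) := ⟨1 / 8, 1 / 4, by norm_num, by norm_num⟩
  set ρ : ℝ → ℝ := b.normed volume with hρ
  have hcs : HasCompactSupport fun x => (ρ x : ℂ) :=
    (b.hasCompactSupport_normed (μ := volume)).comp_left Complex.ofReal_zero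
  have hcd : ContDiff ℝ ∞ fun x => (ρ x : ℂ) :=
    Complex.ofRealCLM.contDiff.comp (b.contDiff_normed (μ := volume))
  set f : SchwartzMap ℝ ℂ := hcs.toSchwartzMap hcd with hf
  have hsupp : ∀ s, ¬ |s - 1 / 2| < 1 / 4 → ρ s = 0 := by
    intro s hs
    by_contra h
    have h1 : s ∈ Function.support (b.normed volume) := h
    rw [b.support_normed_eq, Metric.mem_ball, Real.dist_eq] at h1
    exact hs h1
  have hinv : 𝓕⁻ (𝓕 (f : ℝ → ℂ)) = f :=
    f.continuous.fourierInv_fourier_eq f.integrable (𝓕 f : SchwartzMap ℝ ℂ).integrable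
  set w₀ : SchwartzMap ℝ ℂ := 𝓕 f with hw₀
  have hπ : (0 : ℝ) < 2 * Real.pi := by positivity
  refine ⟨fun z => (2 * Real.pi : ℂ)⁻¹ * w₀ (z / (2 * Real.pi)), ρ,
    continuous_const.mul (w₀.continuous.comp (by fun_prop)), fun k => ?_, fun s => ?_,
    b.continuous_normed, fun s => b.nonneg_normed s, fun s hs => hsupp s ?_, fun s hs => hsupp s ?_,
    b.integrable_normed, b.integral_normed⟩
  · have h1 := ((w₀.integrable_pow_mul volume k).comp_div hπ.ne').const_mul
      ((2 * Real.pi) ^ k * (2 * Real.pi)⁻¹)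
    refine h1.congr (Eventually.of_forall fun z => ?_)
    simp only [norm_mul, norm_inv, Real.norm_eq_abs, abs_div, abs_of_pos hπ, div_pow]
    have h2 : ‖(2 : ℂ)‖ * ‖(Real.pi : ℂ)‖ = 2 * Real.pi := by
      simp [abs_of_pos Real.pi_pos]
    rw [h2]
    field_simp
  · have h1 := congrFun hinv s
    rw [Real.fourierInv_eq'] at h1
    have h2 : (f : ℝ → ℂ) s = ρ s := rfl
    rw [← h2, ← h1]
    have h3 := Measure.integral_comp_div (fun v : ℝ =>
      Complex.exp (((2 * Real.pi * inner ℝ v s : ℝ) : ℂ) * Complex.I) • 𝓕 (f : ℝ → ℂ) v)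
      (2 * Real.pi)
    rw [abs_of_pos hπ] at h3
    have h4 : waveTransform (fun z => (2 * Real.pi : ℂ)⁻¹ * w₀ (z / (2 * Real.pi))) s =
        (2 * Real.pi : ℂ)⁻¹ * ∫ x : ℝ, Complex.exp
          (((2 * Real.pi * inner ℝ (x / (2 * Real.pi)) s : ℝ) : ℂ) * Complex.I) •
            𝓕 (f : ℝ → ℂ) (x / (2 * Real.pi)) := by
      rw [← integral_const_mul]
      unfold waveTransform
      congr 1 with z
      have h5 : Complex.I * z * s =
          ((2 * Real.pi * inner ℝ (z / (2 * Real.pi)) s : ℝ) : ℂ) * Complex.I := by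
        have h6 : 2 * Real.pi * inner ℝ (z / (2 * Real.pi)) s = z * s := by
          simp only [RCLike.inner_apply, conj_trivial]
          field_simp
        rw [h6]
        push_cast
        ring
      rw [h5, smul_eq_mul, hw₀, SchwartzMap.fourier_coe]
      ring
    have hπ' : (2 * Real.pi : ℂ) ≠ 0 := by exact_mod_cast hπ.ne'
    rw [h4, h3, Complex.real_smul]
    push_cast
    rw [inv_mul_cancel_left₀ hπ']
  · intro h
    rw [abs_lt] at h
    linarith [h.1]
  · intro h
    rw [abs_lt] at h
    linarith [h.2]

theorem intervalIntegral_eq_of_indicator (v : ℝ → ℂ) {b : ℝ} (hb : 0 ≤ b)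
    (h0 : ∀ x, x ≤ 0 → v x = 0) (hv : ∀ x, b ≤ x → v x = 0) :
    ∫ x in (0 : ℝ)..b, v x = ∫ x, v x := by
  rw [intervalIntegral.integral_of_le hb, setIntegral_eq_integral_of_forall_compl_eq_zero]
  intro x hx
  by_cases h : x ≤ 0
  · exact h0 x h
  · exact hv x (le_of_lt (not_le.1 fun h' => hx ⟨not_le.1 h, h'⟩))

/-- Grönwall's inequality, integrating from the right end point. -/
theorem le_of_le_add_mul_integral {f : ℝ → ℝ} {a K L : ℝ} (hf : Continuous f) (ha : 0 ≤ a)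
    (hf0 : ∀ x, 0 ≤ f x) (hK : 0 ≤ K) (hL : 0 < L)
    (h : ∀ t ∈ Set.Icc 0 a, f t ≤ K + L * ∫ x in t..a, f x) :
    ∀ t ∈ Set.Icc 0 a, f t ≤ 2 * K * Real.exp (2 * L * a) := by
  -- at a maximum point of `f(t) e^{2Lt}` the integral term is at most half of `f(t)`
  obtain ⟨t₀, ht₀, hmax⟩ := (isCompact_Icc (a := (0 : ℝ)) (b := a)).exists_isMaxOn
    ⟨0, le_rfl, ha⟩ (f := fun t => f t * Real.exp (2 * L * t))
    (hf.mul (by fun_prop)).continuousOn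
  set M := f t₀ * Real.exp (2 * L * t₀) with hM
  have hle : ∀ x ∈ Set.Icc 0 a, f x ≤ M * Real.exp (-(2 * L) * x) := by
    intro x hx
    have h1 : f x * Real.exp (2 * L * x) ≤ M := hmax hx
    calc f x = f x * Real.exp (2 * L * x) * Real.exp (-(2 * L) * x) := by
          rw [mul_assoc, ← Real.exp_add]
          simp
      _ ≤ _ := by gcongr
  have hM0 : 0 ≤ M := mul_nonneg (hf0 _) (Real.exp_pos _).le
  have hint : ∫ x in t₀..a, f x ≤ M * (Real.exp (-(2 * L) * t₀) / (2 * L)) := by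
    calc ∫ x in t₀..a, f x ≤ ∫ x in t₀..a, M * Real.exp (-(2 * L) * x) :=
          intervalIntegral.integral_mono_on ht₀.2 (hf.intervalIntegrable _ _)
            ((by fun_prop : Continuous fun x => M * Real.exp (-(2 * L) * x)).intervalIntegrable _ _)
            fun x hx => hle x ⟨ht₀.1.trans hx.1, hx.2⟩
      _ ≤ _ := by
          rw [intervalIntegral.integral_const_mul]
          gcongr
          have hd : ∀ x ∈ Set.uIcc t₀ a, HasDerivAt
              (fun x => -(Real.exp (-(2 * L) * x) / (2 * L))) (Real.exp (-(2 * L) * x)) x := by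
            intro x _
            have := ((((hasDerivAt_id x).const_mul (-(2 * L))).exp).div_const (2 * L)).neg
            refine this.congr_deriv ?_
            simp
            field_simp
          rw [intervalIntegral.integral_eq_sub_of_hasDerivAt hd
            ((by fun_prop : Continuous fun x => Real.exp (-(2 * L) * x)).intervalIntegrable _ _)]
          have : 0 ≤ Real.exp (-(2 * L) * a) / (2 * L) := by positivity
          linarith
  have hMK : M ≤ 2 * K * Real.exp (2 * L * t₀) := by
    have h1 := h t₀ ht₀
    have h2 : L * ∫ x in t₀..a, f x ≤ M * Real.exp (-(2 * L) * t₀) / 2 := by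
      refine (mul_le_mul_of_nonneg_left hint hL.le).trans_eq ?_
      field_simp
    have h3 : M ≤ (K + M * Real.exp (-(2 * L) * t₀) / 2) * Real.exp (2 * L * t₀) := by
      rw [hM]
      exact mul_le_mul_of_nonneg_right (h1.trans (by linarith)) (Real.exp_pos _).le
    have h4 : Real.exp (-(2 * L) * t₀) * Real.exp (2 * L * t₀) = 1 := by
      rw [← Real.exp_add]
      simp
    have h5 : (K + M * Real.exp (-(2 * L) * t₀) / 2) * Real.exp (2 * L * t₀) =
        K * Real.exp (2 * L * t₀) + M / 2 := by
      linear_combination M / 2 * h4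
    linarith
  intro t ht
  calc f t ≤ M * Real.exp (-(2 * L) * t) := hle t ht
    _ ≤ M * 1 := by
        gcongr
        rw [Real.exp_le_one_iff]
        nlinarith [ht.1]
    _ ≤ 2 * K * Real.exp (2 * L * t₀) := by linarith
    _ ≤ _ := by
        have := ht₀.2
        gcongr

theorem norm_jostBracket_le {A : ℝ} {ψ₁ ψ₂ : ℂ → ℂ} (hA : 0 ≤ A) (h₁ : IsJostLike A ψ₁)
    (h₂ : IsJostLike A ψ₂) {T g : ℝ} (hT : 0 < T) (hg : 0 ≤ g)
    (h : ∀ z : ℝ, |z| ≤ T → ‖ψ₂ z - ψ₁ z‖ ≤ g) (k : ℕ) (z : ℝ) :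
    ‖jostBracket ψ₁ ψ₂ z‖ ≤ 2 * A * g + 2 * A ^ 2 * (|z| / T) ^ k := by
  have b1 : ‖ψ₁ z‖ ≤ A := h₁.norm_le z (by simp)
  have b2 : ‖ψ₁ (-(z : ℂ))‖ ≤ A := h₁.norm_le _ (by simp)
  have b3 : ‖ψ₂ z‖ ≤ A := h₂.norm_le z (by simp)
  have b4 : ‖ψ₂ (-(z : ℂ))‖ ≤ A := h₂.norm_le _ (by simp)
  unfold jostBracket
  by_cases hz : |z| ≤ T
  · have e : ψ₁ z * ψ₂ (-z) - ψ₁ (-z) * ψ₂ z =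
        ψ₁ z * (ψ₂ (-z) - ψ₁ (-z)) - ψ₁ (-z) * (ψ₂ z - ψ₁ z) := by ring
    have d1 := h z hz
    have d2 := h (-z) (by rwa [abs_neg])
    push_cast at d2
    rw [e]
    calc _ ≤ A * g + A * g := by
          refine (norm_sub_le _ _).trans ?_
          rw [norm_mul, norm_mul]
          gcongr
      _ ≤ _ := by
          have : 0 ≤ 2 * A ^ 2 * (|z| / T) ^ k := by positivity
          linarith
  · have h1 : 1 ≤ (|z| / T) ^ k := one_le_pow₀ ((one_le_div hT).2 (not_le.1 hz).le)
    calc _ ≤ A * A + A * A := by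
          refine (norm_sub_le _ _).trans ?_
          rw [norm_mul, norm_mul]
          gcongr
      _ = 2 * A ^ 2 * 1 := by ring
      _ ≤ 2 * A ^ 2 * (|z| / T) ^ k := by gcongr
      _ ≤ _ := by
          have : 0 ≤ 2 * A * g := by positivity
          linarith

/-- Stability of the inverse problem from the Jost function on `[-T, T]`: the parameter `l` is the
length over which `∫_x^a (q₂ - q₁)` is averaged, and `ω` bounds its oscillation over that length. -/
theorem exists_norm_tailDiff_le {a Q : ℝ} (ha : 0 ≤ a) (k : ℕ) :
    ∃ B, 0 ≤ B ∧ ∀ q₁ q₂ : ℝ → ℂ, IsTruncatedPotential a Q q₁ → IsTruncatedPotential a Q q₂ →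
      ∀ l T g ω : ℝ, 0 < l → 0 < T → 0 ≤ g → 0 ≤ ω →
      (∀ z : ℝ, |z| ≤ T → ‖jostIntegral q₂ z - jostIntegral q₁ z‖ ≤ g) →
      (∀ x y : ℝ, 0 ≤ x → x ≤ y → y ≤ x + l → ‖tailDiff q₁ q₂ y - tailDiff q₁ q₂ x‖ ≤ ω) →
      ∀ x ∈ Set.Icc 0 a, ‖tailDiff q₁ q₂ x‖ ≤ B * (ω + l⁻¹ * (g + ((l * T) ^ k)⁻¹)) := by
  rcases lt_or_ge Q 0 with hQneg | hQ
  · exact ⟨0, le_rfl, fun q₁ _ h₁ => absurd h₁.nonneg (not_le.2 hQneg)⟩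
  obtain ⟨w, ρ, hwc, hwi, hwt, hρc, hρ0, hρl, hρr, hρi, hρm⟩ := exists_bump_weight
  set A := 1 + 2 * a + a * Real.exp (a * Q) * Q + Real.exp Q * Q with hA
  have hA0 : 0 ≤ A := by positivity
  set C := 2⁻¹ * Real.exp (a * Q) * Q with hC
  have hC0 : 0 ≤ C := by positivity
  set L := 4 * (2 * C + 2 * a * C ^ 2) + 1 with hL
  have hL0 : 0 < L := by positivity
  set m₀ := ∫ z, ‖w z‖ with hm₀
  set m₁ := ∫ z, |z| ^ k * ‖w z‖ with hm₁
  have hm₀0 : 0 ≤ m₀ := integral_nonneg fun _ => norm_nonneg _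
  have hm₁0 : 0 ≤ m₁ := integral_nonneg fun _ => by positivity
  set K₀ := 1 + 4 * A * m₀ + 4 * A ^ 2 * m₁ with hK₀
  refine ⟨2 * K₀ * Real.exp (2 * L * a), by positivity, ?_⟩
  intro q₁ q₂ hq₁ hq₂ l T g ω hl hT hg hω hclose hosc
  set f := tailDiff q₁ q₂ with hf
  have hfc : Continuous f := hq₁.continuous_tailDiff hq₂
  set E := ω + l⁻¹ * (g + ((l * T) ^ k)⁻¹) with hE
  have hE0 : 0 ≤ E := by positivity
  have hw0i : Integrable w := by
    rw [← integrable_norm_iff hwc.aestronglyMeasurable]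
    simpa using hwi 0
  suffices hmain : ∀ t₀ ∈ Set.Icc 0 a, ‖f t₀‖ ≤ K₀ * E + L * ∫ x in t₀..a, ‖f x‖ by
    intro x hx
    have := le_of_le_add_mul_integral hfc.norm ha (fun _ => norm_nonneg _)
      (by positivity : 0 ≤ K₀ * E) hL0 hmain x hx
    calc _ ≤ _ := this
      _ = _ := by ring
  intro t₀ ht₀
  -- the Fourier transform of this weight is a bump of width `l` to the right of `2 t₀`
  set W : ℝ → ℂ := fun z => w (l * z) * Complex.exp (Complex.I * z * (-(2 * t₀) : ℝ)) with hW
  have hwli : Integrable fun z => w (l * z) := hw0i.comp_mul_left' hl.ne'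
  have hWi : Integrable W := integrable_mul_exp hwli _
  have hWt : ∀ s, waveTransform W s = ((l⁻¹ * ρ ((s - 2 * t₀) / l) : ℝ) : ℂ) := by
    intro s
    rw [hW, waveTransform_mul_exp, ← sub_eq_add_neg]
    have h1 := Measure.integral_comp_mul_left
      (fun y : ℝ => w y * Complex.exp (Complex.I * y * ((s - 2 * t₀) / l : ℝ))) l
    have h2 := hwt ((s - 2 * t₀) / l)
    unfold waveTransform at h2
    rw [h2, abs_of_pos (inv_pos.2 hl), Complex.real_smul] at h1
    rw [waveTransform]
    push_cast at h1 ⊢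
    rw [← h1]
    congr 1 with z
    congr 2
    have : (l : ℂ) ≠ 0 := by exact_mod_cast hl.ne'
    field_simp
  have hpos : ∀ s, 0 ≤ l⁻¹ * ρ ((s - 2 * t₀) / l) := fun s => mul_nonneg (by positivity) (hρ0 _)
  have hneg : ∀ s, s ≤ 2 * t₀ → waveTransform W s = 0 := by
    intro s hs
    rw [hWt, hρl _ (div_nonpos_of_nonpos_of_nonneg (by linarith) hl.le)]
    simp
  have hρli : Integrable fun s => l⁻¹ * ρ ((s - 2 * t₀) / l) :=
    ((hρi.comp_div hl.ne').comp_sub_right (2 * t₀)).const_mul _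
  have hρlm : ∫ s, l⁻¹ * ρ ((s - 2 * t₀) / l) = 1 := by
    rw [integral_const_mul, integral_sub_right_eq_self (fun s => ρ (s / l)) (2 * t₀),
      Measure.integral_comp_div ρ l, hρm, abs_of_pos hl, smul_eq_mul, mul_one,
      inv_mul_cancel₀ hl.ne']
  have hmass : ∀ y, 0 ≤ y → waveNorm W y ≤ 1 := by
    intro y hy
    unfold waveNorm
    rw [← hρlm, intervalIntegral.integral_of_le (by linarith)]
    simp only [hWt, Complex.norm_real, Real.norm_eq_abs, abs_of_nonneg (hpos _)]
    exact setIntegral_le_integral hρli (Eventually.of_forall hpos)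
  have hV := hq₁.norm_integral_tailDiff_mul_waveTransform_le hq₂ ha hC hWi ht₀ hneg hmass
  rw [← hf] at hV
  -- the pairing with the bump is half of `f t₀`, up to the oscillation of `f`
  have hρ2i : Integrable fun x => l⁻¹ * ρ ((2 * x - 2 * t₀) / l) :=
    hρli.comp_mul_left' (two_ne_zero)
  have hρ2m : ∫ x, l⁻¹ * ρ ((2 * x - 2 * t₀) / l) = 2⁻¹ := by
    rw [Measure.integral_comp_mul_left (fun s => l⁻¹ * ρ ((s - 2 * t₀) / l)) 2, hρlm]
    norm_num
  have hfull : ∫ x in (0 : ℝ)..a, f x * waveTransform W (2 * x) =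
      ∫ x, f x * waveTransform W (2 * x) := by
    refine intervalIntegral_eq_of_indicator _ ha (fun x hx => ?_) fun x hx => ?_
    · rw [hneg _ (by linarith [ht₀.1]), mul_zero]
    · rw [hf, hq₁.tailDiff_of_le hq₂ hx, zero_mul]
  have hlow : ∀ x, ‖(f x - f t₀) * waveTransform W (2 * x)‖ ≤
      ω * (l⁻¹ * ρ ((2 * x - 2 * t₀) / l)) := by
    intro x
    rw [norm_mul, hWt, Complex.norm_real, Real.norm_eq_abs, abs_of_nonneg (hpos _)]
    by_cases h1 : t₀ < x
    · by_cases h2 : x ≤ t₀ + l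
      · exact mul_le_mul_of_nonneg_right (hosc t₀ x ht₀.1 h1.le h2) (hpos _)
      · rw [hρr _ ((one_le_div hl).2 (by linarith))]
        simp
    · rw [hρl _ (div_nonpos_of_nonpos_of_nonneg (by linarith) hl.le)]
      simp
  have hWc : Continuous fun x => waveTransform W (2 * x) :=
    (continuous_waveTransform hWi).comp (continuous_const_mul 2)
  have hdi : Integrable fun x => (f x - f t₀) * waveTransform W (2 * x) :=
    (hρ2i.const_mul ω).mono' ((hfc.sub continuous_const).mul hWc).aestronglyMeasurable
      (Eventually.of_forall hlow)
  have hci : Integrable fun x => f t₀ * waveTransform W (2 * x) := by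
    simp only [hWt]
    exact hρ2i.ofReal.const_mul _
  have hhalf : f t₀ * 2⁻¹ = (∫ x, f x * waveTransform W (2 * x)) -
      ∫ x, (f x - f t₀) * waveTransform W (2 * x) := by
    have h1 : ∫ x, f t₀ * waveTransform W (2 * x) = f t₀ * 2⁻¹ := by
      simp only [hWt]
      rw [integral_const_mul, integral_complex_ofReal, hρ2m]
      norm_num
    rw [← h1, eq_sub_iff_add_eq, ← integral_add hci hdi]
    congr 1 with x
    ring
  have hdn : ‖∫ x, (f x - f t₀) * waveTransform W (2 * x)‖ ≤ ω * 2⁻¹ := by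
    rw [← hρ2m, ← integral_const_mul]
    exact norm_integral_le_of_norm_le (hρ2i.const_mul ω) (Eventually.of_forall hlow)
  -- the pairing with the Jost functions: they are close on `[-T, T]`, the weight is small beyond
  have hJ : ‖∫ z : ℝ, W z * jostBracket (jostIntegral q₁) (jostIntegral q₂) z‖ ≤
      2 * A * g * (l⁻¹ * m₀) + 2 * A ^ 2 * (((l * T) ^ k)⁻¹ * (l⁻¹ * m₁)) := by
    have h1 := Measure.integral_comp_mul_left (fun z => ‖w z‖) l
    have h2 := Measure.integral_comp_mul_left (fun z => |z| ^ k * ‖w z‖) l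
    rw [abs_of_pos (inv_pos.2 hl), smul_eq_mul] at h1 h2
    have i1 : Integrable fun z => ‖w (l * z)‖ := hwli.norm
    have i2 : Integrable fun z => |l * z| ^ k * ‖w (l * z)‖ := (hwi k).comp_mul_left' hl.ne'
    rw [← h1, ← h2, ← integral_const_mul, ← integral_const_mul, ← integral_const_mul,
      ← integral_add (i1.const_mul _) ((i2.const_mul _).const_mul _)]
    refine norm_integral_le_of_norm_le ((i1.const_mul _).add ((i2.const_mul _).const_mul _))
      (Eventually.of_forall fun z => ?_)
    have h3 := norm_jostBracket_le hA0 (hq₁.isJostLike ha) (hq₂.isJostLike ha) hT hg hclose k z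
    rw [norm_mul, hW, norm_mul, norm_exp_I_mul_ofReal, mul_one]
    refine (mul_le_mul_of_nonneg_left h3 (norm_nonneg _)).trans_eq ?_
    rw [abs_mul, abs_of_pos hl, mul_pow, mul_pow, div_pow]
    field_simp
  have hfin : ‖f t₀‖ * 2⁻¹ ≤ 2 * A * g * (l⁻¹ * m₀) + 2 * A ^ 2 * (((l * T) ^ k)⁻¹ * (l⁻¹ * m₁)) +
      2 * (2 * C + 2 * a * C ^ 2) * (∫ x in t₀..a, ‖f x‖) + ω * 2⁻¹ := by
    have h1 : ‖f t₀ * 2⁻¹‖ = ‖f t₀‖ * 2⁻¹ := by simp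
    rw [← h1, hhalf, ← hfull]
    exact (norm_sub_le _ _).trans (by linarith)
  have hI0 : 0 ≤ ∫ x in t₀..a, ‖f x‖ :=
    intervalIntegral.integral_nonneg ht₀.2 fun _ _ => norm_nonneg _
  have hK : ω + 4 * A * g * (l⁻¹ * m₀) + 4 * A ^ 2 * (((l * T) ^ k)⁻¹ * (l⁻¹ * m₁)) ≤ K₀ * E := by
    have p1 : 0 ≤ l⁻¹ * g := by positivity
    have p2 : 0 ≤ l⁻¹ * ((l * T) ^ k)⁻¹ := by positivity
    have p3 : 0 ≤ A * m₀ := by positivity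
    have p4 : 0 ≤ A ^ 2 * m₁ := by positivity
    have e : K₀ * E - (ω + 4 * A * g * (l⁻¹ * m₀) + 4 * A ^ 2 * (((l * T) ^ k)⁻¹ * (l⁻¹ * m₁))) =
        l⁻¹ * g + l⁻¹ * ((l * T) ^ k)⁻¹ + 4 * (A * m₀) * (ω + l⁻¹ * ((l * T) ^ k)⁻¹) +
          4 * (A ^ 2 * m₁) * (ω + l⁻¹ * g) := by
      rw [hK₀, hE]
      ring
    have : 0 ≤ K₀ * E - (ω + 4 * A * g * (l⁻¹ * m₀) +
        4 * A ^ 2 * (((l * T) ^ k)⁻¹ * (l⁻¹ * m₁))) := by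
      rw [e]
      positivity
    linarith
  have hL1 : L * (∫ x in t₀..a, ‖f x‖) = 4 * (2 * C + 2 * a * C ^ 2) * (∫ x in t₀..a, ‖f x‖) +
      ∫ x in t₀..a, ‖f x‖ := by
    rw [hL]
    ring
  linarith

/-! ### Splitting off the zeros of an entire function in a disk -/

theorem analyticOrderAt_prod_sub {ι : Type*} (ζ : ι → ℂ) (s : Finset ι) (w : ℂ) :
    analyticOrderAt (fun x => ∏ i ∈ s, (x - ζ i)) w = ({i ∈ s | ζ i = w}.card : ℕ∞) := by
  classical
  induction s using Finset.induction_on with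
  | empty =>
    simp only [Finset.prod_empty, Finset.filter_empty, Finset.card_empty, Nat.cast_zero]
    exact (analyticAt_const).analyticOrderAt_eq_zero.2 one_ne_zero
  | insert i s hi ih =>
    have h1 : (fun x => ∏ j ∈ insert i s, (x - ζ j)) =
        (fun x => x - ζ i) * fun x => ∏ j ∈ s, (x - ζ j) := by
      ext x
      simp [Finset.prod_insert hi]
    have h2 : AnalyticAt ℂ (fun x : ℂ => x - ζ i) w := by fun_prop
    rw [h1, analyticOrderAt_mul h2 (by fun_prop), ih, Finset.filter_insert]
    split_ifs with h
    · subst h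
      have h3 : analyticOrderAt (fun x : ℂ => x - ζ i) (ζ i) = 1 :=
        analyticOrderAt_id_sub_const_self
      rw [h3, Finset.card_insert_of_notMem (by simp [hi])]
      push_cast
      ring
    · rw [h2.analyticOrderAt_eq_zero.2 (sub_ne_zero.2 (Ne.symm h)), zero_add]

theorem Differentiable.exists_eq_prod_sub_mul {ι : Type*} {ψ : ℂ → ℂ} (hψ : Differentiable ℂ ψ)
    (ζ : ι → ℂ) (s : Finset ι)
    (h : ∀ w, ({i ∈ s | ζ i = w}.card : ℕ∞) ≤ analyticOrderAt ψ w) :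
    ∃ F : ℂ → ℂ, Differentiable ℂ F ∧ ∀ x, ψ x = (∏ i ∈ s, (x - ζ i)) * F x := by
  classical
  induction s using Finset.induction_on with
  | empty => exact ⟨ψ, hψ, fun x => by simp⟩
  | insert i s hi ih =>
    obtain ⟨F, hF, hψF⟩ := ih fun w => le_trans (by
      gcongr
      exact Finset.subset_insert i s) (h w)
    have hF0 : F (ζ i) = 0 := by
      have h1 : ψ = (fun x => ∏ j ∈ s, (x - ζ j)) * F := funext hψF
      have h2 := h (ζ i)
      rw [h1, analyticOrderAt_mul (by fun_prop) (hF.analyticAt _), analyticOrderAt_prod_sub,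
        Finset.filter_insert, if_pos rfl, Finset.card_insert_of_notMem (by simp [hi])] at h2
      push_cast at h2
      refine apply_eq_zero_of_analyticOrderAt_ne_zero (z₀ := ζ i) fun h3 => ?_
      rw [h3, add_zero] at h2
      norm_cast at h2
      omega
    refine ⟨dslope F (ζ i), differentiableOn_univ.1
      ((Complex.differentiableOn_dslope univ_mem).2 hF.differentiableOn), fun x => ?_⟩
    have h1 := sub_smul_dslope F (ζ i) x
    rw [hF0, sub_zero, smul_eq_mul] at h1
    rw [hψF, Finset.prod_insert hi, ← h1]
    ring

/-- `ψ` is the product of the monic polynomial with the roots `ζ` in `‖z‖ ≤ R` and of an entire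
function `F` without zeros in that disk. -/
structure IsZeroFactorization {ι : Type*} [Fintype ι] (R : ℝ) (ψ : ℂ → ℂ) (ζ : ι → ℂ)
    (F : ℂ → ℂ) : Prop where
  differentiable : Differentiable ℂ F
  eq_mul : ∀ x, ψ x = (∏ i, (x - ζ i)) * F x
  norm_le : ∀ i, ‖ζ i‖ ≤ R
  ne_zero : ∀ x, ‖x‖ ≤ R → F x ≠ 0

theorem exists_isZeroFactorization {ι : Type*} [Fintype ι] {R : ℝ} {ψ : ℂ → ℂ}
    (hψ : Differentiable ℂ ψ) {ζ : ι → ℂ} (hζ : ∀ i, ‖ζ i‖ ≤ R)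
    (h : ∀ w, ‖w‖ ≤ R → (Nat.card {i // ζ i = w} : ℕ∞) = analyticOrderAt ψ w) :
    ∃ F, IsZeroFactorization R ψ ζ F := by
  classical
  have hcard : ∀ w, Nat.card {i // ζ i = w} = ({i | ζ i = w} : Finset ι).card := fun w => by
    rw [Nat.card_eq_fintype_card, Fintype.card_subtype]
  have hle : ∀ w, (({i | ζ i = w} : Finset ι).card : ℕ∞) ≤ analyticOrderAt ψ w := by
    intro w
    by_cases hw : ‖w‖ ≤ R
    · rw [← h w hw, hcard]
    · have h1 : ({i | ζ i = w} : Finset ι) = ∅ := by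
        refine Finset.filter_eq_empty_iff.2 fun i _ hi => hw (hi ▸ hζ i)
      simp [h1]
  obtain ⟨F, hF, hψF⟩ := hψ.exists_eq_prod_sub_mul ζ Finset.univ hle
  refine ⟨F, hF, hψF, hζ, fun w hw => ?_⟩
  have h1 : ψ = (fun x => ∏ j, (x - ζ j)) * F := funext hψF
  have h2 := h w hw
  rw [hcard, h1, analyticOrderAt_mul (by fun_prop) (hF.analyticAt _),
    analyticOrderAt_prod_sub] at h2
  refine (hF.analyticAt w).analyticOrderAt_eq_zero.1 ?_
  generalize analyticOrderAt F w = o at h2 ⊢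
  induction o using ENat.recTopCoe with
  | top => simp at h2
  | coe n =>
    norm_cast at h2 ⊢
    omega

/-- Two entire functions with close zeros in the sense of `ZerosClose` have factorizations over
a common index set in which the roots, zero at the origin included, are close to one another. -/
theorem ZerosClose.exists_isZeroFactorization {ψ₁ ψ₂ : ℂ → ℂ} {R ε : ℝ}
    (h : ZerosClose ψ₁ ψ₂ R ε) (hR : 0 ≤ R) (hε : 0 ≤ ε) (hψ₁ : Differentiable ℂ ψ₁)
    (hψ₂ : Differentiable ℂ ψ₂) (hne : ψ₁ ≠ 0) :
    ∃ (N m : ℕ) (ζ₁ ζ₂ : Fin N ⊕ Fin m → ℂ) (F₁ F₂ : ℂ → ℂ),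
      IsZeroFactorization R ψ₁ ζ₁ F₁ ∧ IsZeroFactorization R ψ₂ ζ₂ F₂ ∧
      ∀ i, ‖ζ₁ i - ζ₂ i‖ ≤ R ^ 2 * ε := by
  obtain ⟨h0, N, z₁, z₂, hz₁, hz₂, hz⟩ := h
  have htop : analyticOrderAt ψ₁ 0 ≠ ⊤ := fun h1 =>
    hne (funext fun x => AnalyticOnNhd.eqOn_zero_of_preconnected_of_eventuallyEq_zero
      (fun x _ => hψ₁.analyticAt x) isPreconnected_univ (Set.mem_univ 0)
      (analyticOrderAt_eq_top.1 h1) (Set.mem_univ x))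
  obtain ⟨m, hm⟩ := ENat.ne_top_iff_exists.1 htop
  have key : ∀ {ψ : ℂ → ℂ} {z : Fin N → ℂ}, Differentiable ℂ ψ → (m : ℕ∞) = analyticOrderAt ψ 0 →
      IsZeroList ψ R z → ∃ F, IsZeroFactorization R ψ (Sum.elim z fun _ : Fin m => 0) F := by
    intro ψ z hψ hmψ hz
    refine _root_.exists_isZeroFactorization hψ ?_ fun w hw => ?_
    · rintro (i | i)
      · exact (hz.1 i).2
      · simpa using hR
    · have h1 : Nat.card {i // Sum.elim z (fun _ : Fin m => (0 : ℂ)) i = w} =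
          Nat.card {i // z i = w} + Nat.card {_i : Fin m // (0 : ℂ) = w} := by
        rw [Nat.card_congr (Equiv.subtypeSum), Nat.card_sum]
        rfl
      rw [h1]
      by_cases hw0 : w = 0
      · subst hw0
        have h2 : IsEmpty {i // z i = 0} := ⟨fun i => (hz.1 i.1).1 i.2⟩
        simp [hmψ]
      · have h2 : IsEmpty {_i : Fin m // (0 : ℂ) = w} := ⟨fun i => hw0 i.2.symm⟩
        simpa using hz.2 w hw0 hw
  obtain ⟨F₁, hF₁⟩ := key hψ₁ hm hz₁
  obtain ⟨F₂, hF₂⟩ := key hψ₂ (hm.trans h0) hz₂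
  refine ⟨N, m, _, _, F₁, F₂, hF₁, hF₂, ?_⟩
  rintro (i | i)
  · have h1 := (hz₁.1 i).1
    have h2 := (hz₂.1 i).1
    have h3 : z₁ i - z₂ i = z₁ i * z₂ i * ((z₂ i)⁻¹ - (z₁ i)⁻¹) := by
      field_simp
    simp only [Sum.elim_inl]
    rw [h3, norm_mul, norm_mul, pow_two]
    exact mul_le_mul (mul_le_mul (hz₁.1 i).2 (hz₂.1 i).2 (norm_nonneg _) hR) (hz i).le
      (norm_nonneg _) (by positivity)
  · simp only [Sum.elim_inr, sub_zero, norm_zero]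
    positivity

/-! ### Growth of the zero-free factor and its logarithm -/

/-- The maximum principle for a disk centred at the origin. -/
theorem norm_le_of_forall_norm_eq {f : ℂ → ℂ} {r C : ℝ} (hr : 0 < r)
    (hf : DifferentiableOn ℂ f (Metric.closedBall 0 r)) (hC : ∀ w, ‖w‖ = r → ‖f w‖ ≤ C) {w : ℂ}
    (hw : ‖w‖ ≤ r) : ‖f w‖ ≤ C := by
  refine Complex.norm_le_of_forall_mem_frontier_norm_le (U := Metric.ball 0 r)
    Metric.isBounded_ball ?_ (fun z hz => hC z ?_) ?_
  · rw [← closure_ball 0 hr.ne'] at hf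
    exact hf.diffContOnCl
  · rw [frontier_ball 0 hr.ne'] at hz
    simpa using hz
  · rw [closure_ball 0 hr.ne']
    simpa using hw

/-- A holomorphic function without zeros in a disk has a logarithm there. -/
theorem exists_eq_mul_exp_of_ne_zero {F : ℂ → ℂ} {c : ℂ} {ρ : ℝ} (hρ : 0 < ρ)
    (hF : DifferentiableOn ℂ F (Metric.ball c ρ)) (hF0 : ∀ w ∈ Metric.ball c ρ, F w ≠ 0) :
    ∃ L : ℂ → ℂ, DifferentiableOn ℂ L (Metric.ball c ρ) ∧ L c = 0 ∧
      ∀ w ∈ Metric.ball c ρ, F w = F c * Complex.exp (L w) := by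
  have hd : DifferentiableOn ℂ (fun w => deriv F w / F w) (Metric.ball c ρ) :=
    (hF.deriv Metric.isOpen_ball).div hF hF0
  obtain ⟨L, hLc, hL⟩ := hd.isExactOn_ball.with_val_at c 0
  have hc : c ∈ Metric.ball c ρ := Metric.mem_ball_self hρ
  refine ⟨L, fun w hw => (hL w hw).differentiableAt.differentiableWithinAt, hLc, fun w hw => ?_⟩
  have h1 : ∀ x ∈ Metric.ball c ρ,
      HasDerivAt (fun w => F w * Complex.exp (-L w)) 0 x := by
    intro x hx
    have h2 := ((hF.differentiableAt (Metric.isOpen_ball.mem_nhds hx)).hasDerivAt).mul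
      (hL x hx).neg.cexp
    have h3 : deriv F x * Complex.exp ((-L) x) +
        F x * (Complex.exp ((-L) x) * -(deriv F x / F x)) = 0 := by
      have := hF0 x hx
      field_simp
      ring
    rwa [h3] at h2
  have h2 := IsOpen.is_const_of_deriv_eq_zero Metric.isOpen_ball
    (convex_ball c ρ).isPreconnected
    (fun x hx => (h1 x hx).differentiableAt.differentiableWithinAt) (fun x hx => (h1 x hx).deriv)
    hw hc
  simp only [hLc, neg_zero, Complex.exp_zero, mul_one] at h2
  rw [← h2, mul_assoc, ← Complex.exp_add]
  simp

namespace IsJostLike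

variable {A : ℝ} {ψ : ℂ → ℂ}

theorem im_le_of_eq_zero (hψ : IsJostLike A ψ) (hA : 1 ≤ A) {w : ℂ} (hw : ψ w = 0) : w.im ≤ A := by
  by_contra! h
  have h1 : A < ‖w‖ := h.trans_le ((le_abs_self _).trans (Complex.abs_im_le_norm w))
  have h2 := hψ.norm_sub_one_le w (by linarith) (by linarith)
  rw [hw, zero_sub, norm_neg, norm_one, le_div_iff₀ (by linarith)] at h2
  linarith

theorem norm_sub_one_le_of_im (hψ : IsJostLike A ψ) (hA : 1 ≤ A) {w : ℂ} (hw : 16 * A ≤ w.im) :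
    ‖ψ w - 1‖ ≤ A / ‖w‖ ∧ ‖ψ w - 1‖ ≤ 1 / 16 := by
  have h1 : 16 * A ≤ ‖w‖ := hw.trans ((le_abs_self _).trans (Complex.abs_im_le_norm w))
  have h2 := hψ.norm_sub_one_le w (by linarith) (by linarith)
  refine ⟨h2, h2.trans ?_⟩
  rw [div_le_div_iff₀ (by linarith) (by norm_num)]
  linarith

theorem half_le_norm (hψ : IsJostLike A ψ) (hA : 1 ≤ A) {w : ℂ} (hw : 16 * A ≤ w.im) :
    1 / 2 ≤ ‖ψ w‖ := by
  have h1 := (hψ.norm_sub_one_le_of_im hA hw).2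
  have h2 := norm_sub_norm_le 1 (ψ w)
  rw [norm_sub_rev, norm_one] at h2
  linarith

end IsJostLike

namespace IsZeroFactorization

variable {ι : Type*} [Fintype ι] {A R : ℝ} {ψ : ℂ → ℂ} {ζ : ι → ℂ} {F : ℂ → ℂ}

theorem apply_eq_zero (h : IsZeroFactorization R ψ ζ F) (i : ι) : ψ (ζ i) = 0 := by
  rw [h.eq_mul, Finset.prod_eq_zero (Finset.mem_univ i) (sub_self _), zero_mul]

theorem one_le_norm_sub (h : IsZeroFactorization R ψ ζ F) (hψ : IsJostLike A ψ) (hA : 1 ≤ A)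
    {w : ℂ} (hw : 16 * A ≤ w.im) (i : ι) : 1 ≤ ‖w - ζ i‖ := by
  have h1 := hψ.im_le_of_eq_zero hA (h.apply_eq_zero i)
  have h2 := (le_abs_self _).trans (Complex.abs_im_le_norm (w - ζ i))
  rw [Complex.sub_im] at h2
  linarith

/-- A Jensen-type inequality: passing from a point `c` with `‖c‖ ≤ R` to the circle of radius
`(1 + 2 t) R`, each linear factor grows at least by the factor `t`, which restricts the growth of
the zero-free factor. -/
theorem pow_card_mul_norm_le (h : IsZeroFactorization R ψ ζ F) (hψ : IsJostLike A ψ) (hR : 0 < R)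
    {t : ℝ} (ht : 0 ≤ t) {c w : ℂ} (hc : ‖c‖ ≤ R) (hw : ‖w‖ ≤ (1 + 2 * t) * R) :
    t ^ Fintype.card ι * ‖ψ c‖ * ‖F w‖ ≤ A * Real.exp (A * ((1 + 2 * t) * R)) * ‖F c‖ := by
  have key : ∀ w : ℂ, ‖w‖ = (1 + 2 * t) * R → ‖((t : ℂ) ^ Fintype.card ι * ψ c) * F w‖ ≤
      A * Real.exp (A * ((1 + 2 * t) * R)) * ‖F c‖ := by
    intro w hw
    have h1 : t ^ Fintype.card ι * ∏ i, ‖c - ζ i‖ ≤ ∏ i, ‖w - ζ i‖ := by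
      rw [← Finset.card_univ, ← Finset.prod_const, ← Finset.prod_mul_distrib]
      refine Finset.prod_le_prod (fun i _ => by positivity) fun i _ => ?_
      have h2 := norm_sub_norm_le w (ζ i)
      have h3 := norm_sub_le c (ζ i)
      have h4 := h.norm_le i
      nlinarith
    have h2 := hψ.norm_le_exp w
    rw [hw, h.eq_mul w, norm_mul, norm_prod] at h2
    rw [norm_mul, norm_mul, norm_pow, Complex.norm_real, Real.norm_of_nonneg ht, h.eq_mul c,
      norm_mul, norm_prod]
    calc t ^ Fintype.card ι * ((∏ i, ‖c - ζ i‖) * ‖F c‖) * ‖F w‖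
        = (t ^ Fintype.card ι * ∏ i, ‖c - ζ i‖) * ‖F w‖ * ‖F c‖ := by ring
      _ ≤ (∏ i, ‖w - ζ i‖) * ‖F w‖ * ‖F c‖ := by gcongr
      _ ≤ _ := by gcongr
  have h1 := norm_le_of_forall_norm_eq (f := fun w => ((t : ℂ) ^ Fintype.card ι * ψ c) * F w)
    (by positivity) (h.differentiable.const_mul _).differentiableOn key hw
  rwa [norm_mul, norm_mul, norm_pow, Complex.norm_real, Real.norm_of_nonneg ht] at h1

/-- A crude bound for the number of zeros in `‖z‖ ≤ R`; only its independence of `ψ` matters. -/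
theorem card_le (h : IsZeroFactorization R ψ ζ F) (hψ : IsJostLike A ψ) (hA : 1 ≤ A)
    (hR : 16 * A ≤ R) : (Fintype.card ι : ℝ) ≤ 2 * A * Real.exp (5 * A * R) := by
  set c : ℂ := ((16 * A : ℝ) : ℂ) * Complex.I with hc
  have hcR : ‖c‖ ≤ R := by
    rw [hc, norm_mul, Complex.norm_I, mul_one, Complex.norm_real, Real.norm_of_nonneg (by linarith)]
    exact hR
  have h1 := h.pow_card_mul_norm_le hψ (by linarith) zero_le_two hcR (w := c) (by linarith)
  have h2 := hψ.half_le_norm hA (w := c) (by simp [hc])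
  have h3 : 0 < ‖F c‖ := norm_pos_iff.2 (h.ne_zero c hcR)
  have h4 := le_of_mul_le_mul_right h1 h3
  have h5 : (Fintype.card ι : ℝ) ≤ 2 ^ Fintype.card ι := by
    exact_mod_cast Nat.lt_two_pow_self.le
  have h6 : (2 : ℝ) ^ Fintype.card ι * (1 / 2) ≤ 2 ^ Fintype.card ι * ‖ψ c‖ := by gcongr
  have h7 : A * ((1 + 2 * 2) * R) = 5 * A * R := by ring
  rw [h7] at h4
  linarith

/-- The logarithm of the zero-free factor, normalised at a point `c` high up in the upper
half-plane, grows at most linearly in the radius, by the Borel–Carathéodory inequality. -/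
theorem exists_log (h : IsZeroFactorization R ψ ζ F) (hψ : IsJostLike A ψ) (hA : 1 ≤ A) {c : ℂ}
    (hc : 16 * A ≤ c.im) (hcR : ‖c‖ ≤ R / 8) :
    ∃ L : ℂ → ℂ, DifferentiableOn ℂ L (Metric.ball c (7 * R / 8)) ∧ L c = 0 ∧
      (∀ w ∈ Metric.ball c (7 * R / 8), F w = F c * Complex.exp (L w)) ∧
      ∀ w ∈ Metric.closedBall c (R / 4), ‖L w‖ ≤ 5 * A * R := by
  have hc1 : c.im ≤ ‖c‖ := (le_abs_self _).trans (Complex.abs_im_le_norm c)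
  have hR : 0 < R := by linarith
  have hball : ∀ w ∈ Metric.ball c (7 * R / 8), ‖w‖ ≤ R := by
    intro w hw
    have h1 := norm_add_le (w - c) c
    rw [mem_ball_iff_norm] at hw
    rw [sub_add_cancel] at h1
    linarith
  obtain ⟨L, hL, hLc, hFL⟩ := exists_eq_mul_exp_of_ne_zero
    (show 0 < 7 * R / 8 by linarith) (c := c) h.differentiable.differentiableOn
    (fun w hw => h.ne_zero w (hball w hw))
  refine ⟨L, hL, hLc, hFL, fun w hw => ?_⟩
  have hFc : 0 < ‖F c‖ := norm_pos_iff.2 (h.ne_zero c (by linarith))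
  have hmaps : Set.MapsTo (fun w => L (c + w)) (Metric.ball 0 (7 * R / 8))
      {z | z.re ≤ 5 * A * R} := by
    intro w hw
    rw [mem_ball_zero_iff] at hw
    have hw' : c + w ∈ Metric.ball c (7 * R / 8) := by simpa using hw
    have h1 := h.pow_card_mul_norm_le hψ hR zero_le_one (c := c) (w := c + w) (by linarith)
      (by linarith [hball _ hw'])
    have h2 := hψ.half_le_norm hA hc
    rw [hFL _ hw', norm_mul, Complex.norm_exp, one_pow, one_mul] at h1
    have h3 : ‖ψ c‖ * Real.exp (L (c + w)).re ≤ A * Real.exp (A * ((1 + 2 * 1) * R)) := by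
      refine le_of_mul_le_mul_right ?_ hFc
      calc _ = ‖ψ c‖ * (‖F c‖ * Real.exp (L (c + w)).re) := by ring
        _ ≤ _ := h1
    have h4 : Real.exp (L (c + w)).re ≤ Real.exp (5 * A * R) := by
      have h5 : 2 * A ≤ Real.exp (2 * A * R) := by
        have := Real.add_one_le_exp (2 * A * R)
        nlinarith
      have h6 : Real.exp (5 * A * R) = Real.exp (2 * A * R) * Real.exp (A * ((1 + 2 * 1) * R)) := by
        rw [← Real.exp_add]
        ring_nf
      rw [h6]
      have h7 := mul_le_mul_of_nonneg_right h5 (Real.exp_nonneg (A * ((1 + 2 * 1) * R)))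
      have h8 := mul_le_mul_of_nonneg_right h2 (Real.exp_nonneg (L (c + w)).re)
      linarith
    exact Real.exp_le_exp.1 h4
  have hd : DifferentiableOn ℂ (fun w => L (c + w)) (Metric.ball 0 (7 * R / 8)) :=
    hL.comp (by fun_prop) fun w hw => by simpa using hw
  rw [mem_closedBall_iff_norm] at hw
  have h1 := Complex.borelCaratheodory_zero (z := w - c) (by positivity) hd hmaps (by linarith)
    (by simpa using hw.trans_lt (by linarith)) (by simpa using hLc)
  rw [add_sub_cancel] at h1
  refine h1.trans ?_
  rw [div_le_iff₀ (by linarith)]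
  have h2 : 2 * ‖w - c‖ ≤ 7 * R / 8 - ‖w - c‖ := by linarith
  have h3 : 0 ≤ 5 * A * R := by positivity
  nlinarith

end IsZeroFactorization

/-! ### Comparison of two functions with close zeros -/

theorem norm_prod_sub_div_prod_sub_sub_one_le {ι : Type*} [Fintype ι] {ζ₁ ζ₂ : ι → ℂ} {w : ℂ}
    {η : ℝ} (hη : ∀ i, ‖ζ₁ i - ζ₂ i‖ ≤ η) (hw : ∀ i, 1 ≤ ‖w - ζ₁ i‖)
    (hs : Fintype.card ι * η ≤ 1) (hs0 : 0 ≤ Fintype.card ι * η) :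
    ‖(∏ i, (w - ζ₂ i)) / (∏ i, (w - ζ₁ i)) - 1‖ ≤ 2 * (Fintype.card ι * η) := by
  have hne : ∀ i, w - ζ₁ i ≠ 0 := fun i => norm_pos_iff.1 (one_pos.trans_le (hw i))
  have h1 : (∏ i, (w - ζ₂ i)) / (∏ i, (w - ζ₁ i)) =
      ∏ i, (1 + (ζ₁ i - ζ₂ i) / (w - ζ₁ i)) := by
    rw [← Finset.prod_div_distrib]
    refine Finset.prod_congr rfl fun i _ => ?_
    have := hne i
    field_simp
    ring
  have h2 : ∑ i, ‖(ζ₁ i - ζ₂ i) / (w - ζ₁ i)‖ ≤ Fintype.card ι * η := by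
    rw [← nsmul_eq_mul, ← Finset.card_univ]
    refine Finset.sum_le_card_nsmul _ _ _ fun i _ => ?_
    rw [norm_div]
    exact (div_le_self (norm_nonneg _) (hw i)).trans (hη i)
  rw [h1]
  refine (Finset.norm_prod_one_add_sub_one_le _ _).trans ?_
  have h3 := (le_abs_self _).trans (Real.abs_exp_sub_one_le (x := Fintype.card ι * η)
    (by rwa [abs_of_nonneg hs0]))
  rw [abs_of_nonneg hs0] at h3
  linarith [Real.exp_le_exp.2 h2]

theorem norm_mul_sub_one_le (a b : ℂ) : ‖a * b - 1‖ ≤ ‖a‖ * ‖b - 1‖ + ‖a - 1‖ := by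
  have h1 : a * b - 1 = a * (b - 1) + (a - 1) := by ring
  rw [h1, ← norm_mul]
  exact norm_add_le _ _

/-- A continuous logarithm of `q` near `1` that is the principal one at a point of a convex open
set is the principal one throughout. -/
theorem eq_log_of_exp_eq {U : Set ℂ} (hU : IsOpen U) (hUc : Convex ℝ U) {G q : ℂ → ℂ}
    (hG : DifferentiableOn ℂ G U) (hq : DifferentiableOn ℂ q U) (hq1 : ∀ w ∈ U, ‖q w - 1‖ < 1)
    (hexp : ∀ w ∈ U, Complex.exp (G w) = q w) {c w : ℂ} (hc : c ∈ U)
    (hGc : G c = Complex.log (q c)) (hw : w ∈ U) : G w = Complex.log (q w) := by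
  have hslit : ∀ w ∈ U, q w ∈ Complex.slitPlane := fun w hw => by
    simpa using Complex.mem_slitPlane_of_norm_lt_one (hq1 w hw)
  have hd : DifferentiableOn ℂ (fun w => G w - Complex.log (q w)) U := hG.sub (hq.clog hslit)
  have h1 : Set.EqOn (deriv fun w => G w - Complex.log (q w)) 0 U := by
    intro x hx
    have h2 := (hd.differentiableAt (hU.mem_nhds hx)).hasDerivAt.cexp
    have h3 : (fun w => Complex.exp (G w - Complex.log (q w))) =ᶠ[𝓝 x] fun _ => 1 := by
      filter_upwards [hU.mem_nhds hx] with y hy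
      have h4 := Complex.slitPlane_ne_zero (hslit y hy)
      rw [Complex.exp_sub, hexp y hy, Complex.exp_log h4, div_self h4]
    have h4 := h2.unique ((hasDerivAt_const x (1 : ℂ)).congr_of_eventuallyEq h3)
    exact (mul_eq_zero.1 h4).resolve_left (Complex.exp_ne_zero _)
  have h2 := hU.is_const_of_deriv_eq_zero hUc.isPreconnected hd h1 hw hc
  simp only [hGc, sub_self] at h2
  exact sub_eq_zero.1 h2

/-- A two-constants estimate on the rectangle of width `2ρ` and height `ρ` below `c`: near `c`, a
bound `C` on the upper side is only slightly spoilt by the much weaker bound `C e ^ Λ` which is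
available on the whole rectangle. -/
theorem norm_le_mul_exp_of_rectangle {h : ℂ → ℂ} {c : ℂ} {ρ Λ C : ℝ} (hρ : 0 < ρ) (hΛ : 0 ≤ Λ)
    (hC : 0 ≤ C)
    (hd : DifferentiableOn ℂ h
      (Set.Icc (c.re - ρ) (c.re + ρ) ×ℂ Set.Icc (c.im - ρ) c.im))
    (hK : ∀ w ∈ Set.Icc (c.re - ρ) (c.re + ρ) ×ℂ Set.Icc (c.im - ρ) c.im,
      ‖h w‖ ≤ C * Real.exp Λ)
    (htop : ∀ w ∈ Set.Icc (c.re - ρ) (c.re + ρ) ×ℂ Set.Icc (c.im - ρ) c.im, w.im = c.im →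
      ‖h w‖ ≤ C)
    {w : ℂ} (hw : w ∈ Set.Icc (c.re - ρ) (c.re + ρ) ×ℂ Set.Icc (c.im - ρ) c.im) :
    ‖h w‖ ≤ C * Real.exp (Λ *
      (((w.re - c.re) ^ 2 + (c.im - w.im) * (2 * ρ - (c.im - w.im))) / ρ ^ 2)) := by
  set β : ℂ → ℂ := fun w => -((Λ / ρ ^ 2 : ℝ) : ℂ) *
    ((w - c) ^ 2 + 2 * ρ * Complex.I * (w - c)) with hβ
  -- the real part of `β` is nonpositive on the upper side and at most `-Λ` on the other sides
  have hre : ∀ w, (β w).re = -(Λ *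
      (((w.re - c.re) ^ 2 + (c.im - w.im) * (2 * ρ - (c.im - w.im))) / ρ ^ 2)) := by
    intro w
    simp only [hβ, pow_two, Complex.mul_re, Complex.mul_im, Complex.add_re, Complex.add_im,
      Complex.sub_re, Complex.sub_im, Complex.neg_re, Complex.neg_im, Complex.ofReal_re,
      Complex.ofReal_im, Complex.I_re, Complex.I_im, Complex.re_ofNat, Complex.im_ofNat]
    ring
  have hcl : closure (Set.Ioo (c.re - ρ) (c.re + ρ) ×ℂ Set.Ioo (c.im - ρ) c.im) =
      Set.Icc (c.re - ρ) (c.re + ρ) ×ℂ Set.Icc (c.im - ρ) c.im := by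
    rw [Complex.closure_reProdIm, closure_Ioo (by linarith), closure_Ioo (by linarith)]
  have hmain : ‖h w * Complex.exp (β w)‖ ≤ C := by
    refine Complex.norm_le_of_forall_mem_frontier_norm_le
      (U := Set.Ioo (c.re - ρ) (c.re + ρ) ×ℂ Set.Ioo (c.im - ρ) c.im)
      (f := fun w => h w * Complex.exp (β w))
      ((Metric.isBounded_Ioo _ _).reProdIm (Metric.isBounded_Ioo _ _)) ?_ ?_ (by rwa [hcl])
    · refine DifferentiableOn.diffContOnCl ?_
      rw [hcl]
      exact hd.mul (by fun_prop)
    · intro z hz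
      have hzK : z ∈ Set.Icc (c.re - ρ) (c.re + ρ) ×ℂ Set.Icc (c.im - ρ) c.im :=
        hcl ▸ frontier_subset_closure hz
      rw [Complex.frontier_reProdIm, closure_Ioo (by linarith), closure_Ioo (by linarith),
        frontier_Ioo (by linarith), frontier_Ioo (by linarith)] at hz
      obtain ⟨⟨h1, h2⟩, h3, h4⟩ := hzK
      rw [norm_mul, Complex.norm_exp, hre]
      have hbar : ρ ^ 2 ≤ (z.re - c.re) ^ 2 + (c.im - z.im) * (2 * ρ - (c.im - z.im)) →
          ‖h z‖ * Real.exp (-(Λ * (((z.re - c.re) ^ 2 +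
            (c.im - z.im) * (2 * ρ - (c.im - z.im))) / ρ ^ 2))) ≤ C := by
        intro h5
        have h6 : Λ ≤ Λ * (((z.re - c.re) ^ 2 +
            (c.im - z.im) * (2 * ρ - (c.im - z.im))) / ρ ^ 2) :=
          le_mul_of_one_le_right hΛ ((one_le_div (by positivity)).2 h5)
        calc _ ≤ (C * Real.exp Λ) * Real.exp (-Λ) := by
              gcongr
              exact hK z ⟨⟨h1, h2⟩, h3, h4⟩
          _ = C := by
              rw [mul_assoc, ← Real.exp_add, add_neg_cancel, Real.exp_zero, mul_one]
      have h7 : 0 ≤ (c.im - z.im) * (2 * ρ - (c.im - z.im)) :=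
        mul_nonneg (by linarith) (by linarith)
      rcases hz with ⟨-, h5 | h5⟩ | ⟨h5 | h5, -⟩
      · refine hbar ?_
        have h6 : c.im - z.im = ρ := by linarith [show z.im = _ from h5]
        rw [h6]
        nlinarith [sq_nonneg (z.re - c.re)]
      · have h8 : z.im = c.im := h5
        refine (mul_le_of_le_one_right (norm_nonneg _) ?_).trans (htop z ⟨⟨h1, h2⟩, h3, h4⟩ h8)
        rw [Real.exp_le_one_iff, neg_nonpos]
        positivity
      · refine hbar ?_
        have h6 : z.re - c.re = -ρ := by linarith [show z.re = _ from h5]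
        rw [h6]
        nlinarith
      · refine hbar ?_
        have h6 : z.re - c.re = ρ := by linarith [show z.re = _ from h5]
        rw [h6]
        nlinarith
  rw [norm_mul, Complex.norm_exp, hre, Real.exp_neg, ← div_eq_mul_inv,
    div_le_iff₀ (Real.exp_pos _)] at hmain
  exact hmain

/-! ### Closeness of Jost functions with close zeros on a real interval -/

section ZeroComparison

variable {ι : Type*} [Fintype ι] {A R η : ℝ} {ψ₁ ψ₂ : ℂ → ℂ} {ζ₁ ζ₂ : ι → ℂ} {F₁ F₂ : ℂ → ℂ}

/-- High up in the half-plane both functions are close to `1` and their zeros are far away, so the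
zero-free factors are close to one another. -/
theorem norm_factor_div_factor_sub_one_le (h₁ : IsZeroFactorization R ψ₁ ζ₁ F₁)
    (h₂ : IsZeroFactorization R ψ₂ ζ₂ F₂) (hψ₁ : IsJostLike A ψ₁) (hψ₂ : IsJostLike A ψ₂)
    (hA : 1 ≤ A) (hη : ∀ i, ‖ζ₁ i - ζ₂ i‖ ≤ η) (hs : Fintype.card ι * η ≤ 1)
    (hs0 : 0 ≤ Fintype.card ι * η) {w : ℂ} (hw : 16 * A ≤ w.im) (hwR : ‖w‖ ≤ R) :
    ‖F₂ w / F₁ w - 1‖ ≤ 4 * A / ‖w‖ + 4 * (Fintype.card ι * η) := by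
  have hw1 : 16 * A ≤ ‖w‖ := hw.trans ((le_abs_self _).trans (Complex.abs_im_le_norm w))
  have hw0 : 0 < ‖w‖ := by linarith
  have h1 := hψ₁.half_le_norm hA hw
  have hne : ψ₁ w ≠ 0 := norm_pos_iff.1 (by linarith)
  have hP1 : ∏ i, (w - ζ₁ i) ≠ 0 := Finset.prod_ne_zero_iff.2 fun i _ =>
    norm_pos_iff.1 (one_pos.trans_le (h₁.one_le_norm_sub hψ₁ hA hw i))
  have hP2 : ∏ i, (w - ζ₂ i) ≠ 0 := Finset.prod_ne_zero_iff.2 fun i _ =>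
    norm_pos_iff.1 (one_pos.trans_le (h₂.one_le_norm_sub hψ₂ hA hw i))
  have hF1 := h₁.ne_zero w hwR
  have h2 : F₂ w / F₁ w = ψ₂ w / ψ₁ w * ((∏ i, (w - ζ₁ i)) / ∏ i, (w - ζ₂ i)) := by
    rw [h₁.eq_mul, h₂.eq_mul]
    field_simp
  have h3 : ‖ψ₂ w / ψ₁ w - 1‖ ≤ 4 * A / ‖w‖ := by
    have h4 : ψ₂ w / ψ₁ w - 1 = ((ψ₂ w - 1) - (ψ₁ w - 1)) / ψ₁ w := by
      field_simp
      ring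
    have h5 := norm_sub_le (ψ₂ w - 1) (ψ₁ w - 1)
    have h6 := (hψ₁.norm_sub_one_le_of_im hA hw).1
    have h7 := (hψ₂.norm_sub_one_le_of_im hA hw).1
    rw [h4, norm_div, div_le_iff₀ (by linarith)]
    have h8 : 4 * A / ‖w‖ * (1 / 2) ≤ 4 * A / ‖w‖ * ‖ψ₁ w‖ := by gcongr
    have h9 : 4 * A / ‖w‖ * (1 / 2) = 2 * (A / ‖w‖) := by ring
    linarith
  have h4 := norm_prod_sub_div_prod_sub_sub_one_le (w := w) (ζ₁ := ζ₂) (ζ₂ := ζ₁)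
    (fun i => by rw [norm_sub_rev]; exact hη i) (h₂.one_le_norm_sub hψ₂ hA hw) hs hs0
  have h5 : ‖ψ₂ w / ψ₁ w‖ ≤ 2 := by
    have h6 : 4 * A / ‖w‖ ≤ 1 := (div_le_one hw0).2 (by linarith)
    have h7 := norm_le_norm_add_norm_sub' (ψ₂ w / ψ₁ w) 1
    rw [norm_one] at h7
    linarith
  rw [h2]
  refine (norm_mul_sub_one_le _ _).trans ?_
  have h6 := mul_le_mul h5 h4 (norm_nonneg _) zero_le_two
  linarith

/-- The zero-free factors have a quotient `exp G`, with `G` of linear growth in general and with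
`z G(z)` bounded high up in the half-plane. -/
theorem exists_log_factor_div_factor (h₁ : IsZeroFactorization R ψ₁ ζ₁ F₁)
    (h₂ : IsZeroFactorization R ψ₂ ζ₂ F₂) (hψ₁ : IsJostLike A ψ₁) (hψ₂ : IsJostLike A ψ₂)
    (hA : 1 ≤ A) (hη : ∀ i, ‖ζ₁ i - ζ₂ i‖ ≤ η) (hs : Fintype.card ι * η * R ≤ 1 / 16)
    (hs0 : 0 ≤ Fintype.card ι * η) {c : ℂ} (hc : 16 * A < c.im) (hcR : ‖c‖ ≤ R / 8) :
    ∃ G : ℂ → ℂ, DifferentiableOn ℂ G (Metric.ball c (7 * R / 8)) ∧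
      (∀ w ∈ Metric.ball c (7 * R / 8), F₂ w = F₁ w * Complex.exp (G w)) ∧
      (∀ w ∈ Metric.closedBall c (R / 4), ‖G w‖ ≤ 11 * A * R) ∧
      ∀ w ∈ Metric.ball c (7 * R / 8), 16 * A < w.im → ‖w * G w‖ ≤ 7 * A := by
  have hcn : c.im ≤ ‖c‖ := (le_abs_self _).trans (Complex.abs_im_le_norm c)
  have hR : 128 ≤ R := by linarith
  have hs1 : Fintype.card ι * η ≤ 1 / 16 := by nlinarith
  have hball : ∀ w ∈ Metric.ball c (7 * R / 8), ‖w‖ ≤ R := by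
    intro w hw
    have h1 := norm_add_le (w - c) c
    rw [mem_ball_iff_norm] at hw
    rw [sub_add_cancel] at h1
    linarith
  have hcb : c ∈ Metric.ball c (7 * R / 8) := Metric.mem_ball_self (by linarith)
  obtain ⟨L₁, hL₁, hL₁c, hF₁, hb₁⟩ := h₁.exists_log hψ₁ hA hc.le hcR
  obtain ⟨L₂, hL₂, hL₂c, hF₂, hb₂⟩ := h₂.exists_log hψ₂ hA hc.le hcR
  have hne₁ : ∀ w ∈ Metric.ball c (7 * R / 8), F₁ w ≠ 0 := fun w hw => h₁.ne_zero w (hball w hw)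
  have hne₂ : ∀ w ∈ Metric.ball c (7 * R / 8), F₂ w ≠ 0 := fun w hw => h₂.ne_zero w (hball w hw)
  have hq : ∀ w ∈ Metric.ball c (7 * R / 8), 16 * A < w.im →
      ‖F₂ w / F₁ w - 1‖ ≤ 4 * A / ‖w‖ + 4 * (Fintype.card ι * η) ∧ ‖F₂ w / F₁ w - 1‖ ≤ 1 / 2 := by
    intro w hw hwi
    have h1 := norm_factor_div_factor_sub_one_le h₁ h₂ hψ₁ hψ₂ hA hη (by linarith) hs0 hwi.le
      (hball w hw)
    have hw1 : 16 * A ≤ ‖w‖ := hwi.le.trans ((le_abs_self _).trans (Complex.abs_im_le_norm w))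
    have h2 : 4 * A / ‖w‖ ≤ 1 / 4 := by
      rw [div_le_iff₀ (by linarith)]
      linarith
    exact ⟨h1, by linarith⟩
  have hlog : ∀ w ∈ Metric.ball c (7 * R / 8), 16 * A < w.im →
      ‖Complex.log (F₂ w / F₁ w)‖ ≤ 3 / 2 * ‖F₂ w / F₁ w - 1‖ := by
    intro w hw hwi
    have h1 := Complex.norm_log_one_add_half_le_self (hq w hw hwi).2
    rwa [add_sub_cancel] at h1
  set κ := Complex.log (F₂ c / F₁ c) with hκ
  have hκ1 : ‖κ‖ ≤ 1 := (hlog c hcb hc).trans (by linarith [(hq c hcb hc).2])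
  have hexp : ∀ w ∈ Metric.ball c (7 * R / 8),
      F₂ w = F₁ w * Complex.exp (L₂ w - L₁ w + κ) := by
    intro w hw
    have h1 := hne₁ c hcb
    rw [Complex.exp_add, Complex.exp_sub, hκ, Complex.exp_log (div_ne_zero (hne₂ c hcb) h1),
      hF₁ w hw, hF₂ w hw]
    have h2 := Complex.exp_ne_zero (L₁ w)
    field_simp
  have hG : DifferentiableOn ℂ (fun w => L₂ w - L₁ w + κ) (Metric.ball c (7 * R / 8)) :=
    (hL₂.sub hL₁).add_const κ
  refine ⟨fun w => L₂ w - L₁ w + κ, hG, hexp, fun w hw => ?_, fun w hw hwi => ?_⟩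
  · have h1 := norm_add_le (L₂ w - L₁ w) κ
    have h2 := norm_sub_le (L₂ w) (L₁ w)
    have h3 := hb₁ w hw
    have h4 := hb₂ w hw
    have h5 : 1 ≤ A * R := by nlinarith
    simp only
    linarith
  · have hU : IsOpen (Metric.ball c (7 * R / 8) ∩ {w | 16 * A < w.im}) :=
      Metric.isOpen_ball.inter (isOpen_lt continuous_const Complex.continuous_im)
    have h1 : L₂ w - L₁ w + κ = Complex.log (F₂ w / F₁ w) :=
      eq_log_of_exp_eq (G := fun w => L₂ w - L₁ w + κ) (q := fun w => F₂ w / F₁ w) hU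
        ((convex_ball _ _).inter (convex_halfSpace_im_gt _)) (hG.mono Set.inter_subset_left)
        (h₂.differentiable.differentiableOn.div h₁.differentiable.differentiableOn
          fun x hx => hne₁ x hx.1)
        (fun x hx => (hq x hx.1 hx.2).2.trans_lt (by norm_num))
        (fun x hx => by
          rw [hexp x hx.1, mul_div_cancel_left₀ _ (hne₁ x hx.1)])
        (c := c) ⟨hcb, hc⟩ (by simp [hL₁c, hL₂c, hκ]) ⟨hw, hwi⟩
    have hw1 : 16 * A ≤ ‖w‖ := hwi.le.trans ((le_abs_self _).trans (Complex.abs_im_le_norm w))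
    have hw0 : 0 < ‖w‖ := by linarith
    simp only [h1, norm_mul]
    have h2 := hlog w hw hwi
    have h3 := (hq w hw hwi).1
    have h4 : ‖w‖ * (4 * A / ‖w‖ + 4 * (Fintype.card ι * η)) =
        4 * A + 4 * (Fintype.card ι * η * ‖w‖) := by
      field_simp
    have h5 : Fintype.card ι * η * ‖w‖ ≤ 1 / 16 :=
      (mul_le_mul_of_nonneg_left (hball w hw) hs0).trans hs
    have h6 := mul_le_mul_of_nonneg_left (h2.trans (mul_le_mul_of_nonneg_left h3
      (by norm_num : (0 : ℝ) ≤ 3 / 2))) hw0.le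
    linarith

/-- The logarithm of the quotient of the zero-free factors is `O(log R / R)` in a disk of radius
comparable to `R / log R`. -/
theorem exists_log_factor_div_factor_le (h₁ : IsZeroFactorization R ψ₁ ζ₁ F₁)
    (h₂ : IsZeroFactorization R ψ₂ ζ₂ F₂) (hψ₁ : IsJostLike A ψ₁) (hψ₂ : IsJostLike A ψ₂)
    (hA : 1 ≤ A) (hη : ∀ i, ‖ζ₁ i - ζ₂ i‖ ≤ η) (hs : Fintype.card ι * η * R ≤ 1 / 16)
    (hs0 : 0 ≤ Fintype.card ι * η) (hlogR : 1 ≤ Real.log R)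
    (hR : 112 * A * Real.exp 5 * Real.log R ≤ R) :
    ∃ G : ℂ → ℂ, ∀ w : ℂ, ‖w‖ ≤ R / (16 * Real.log R) →
      F₂ w = F₁ w * Complex.exp (G w) ∧
      ‖G w‖ ≤ 112 * A * Real.exp 5 * Real.log R / R := by
  set ℓ := Real.log R with hℓ
  have he : 32 ≤ Real.exp 5 := by
    have h1 : (2 : ℝ) ^ 5 ≤ Real.exp 1 ^ 5 := by
      gcongr
      linarith [Real.add_one_le_exp 1]
    rw [← Real.exp_nat_mul] at h1
    norm_num at h1
    exact h1
  -- any height above `16 A` serves as the upper side of the rectangle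
  set y := 17 * A with hy
  have hRy : 200 * y * ℓ ≤ R := by
    have : 200 * y * ℓ ≤ 112 * A * Real.exp 5 * ℓ := by
      rw [hy]
      gcongr ?_ * ℓ
      nlinarith
    linarith
  have hy0 : 17 ≤ y := by linarith
  have hRy1 : 200 * y ≤ R := by nlinarith
  have hRpos : 0 < R := by linarith
  set c : ℂ := (y : ℂ) * Complex.I with hc
  have hcre : c.re = 0 := by simp [hc]
  have hcim : c.im = y := by simp [hc]
  have hcn : ‖c‖ = y := by
    rw [hc, norm_mul, Complex.norm_I, mul_one, Complex.norm_real, Real.norm_of_nonneg (by linarith)]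
  obtain ⟨G, hG, hFG, hG1, hG2⟩ := exists_log_factor_div_factor h₁ h₂ hψ₁ hψ₂ hA hη hs hs0
    (c := c) (by rw [hcim]; linarith) (by rw [hcn]; linarith)
  set r := R / (16 * ℓ) with hr
  have hr0 : 0 < r := by positivity
  have hrR : r ≤ R / 16 := div_le_div_of_nonneg_left hRpos.le (by norm_num) (by linarith)
  have hrℓ : 16 * r * ℓ = R := by
    rw [hr]
    field_simp
  have hball : ∀ w : ℂ, ‖w‖ ≤ r → w ∈ Metric.ball c (7 * R / 8) := by
    intro w hw
    rw [mem_ball_iff_norm]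
    have := norm_sub_le w c
    linarith
  set ρ := R / 8 with hρ
  set K := Set.Icc (c.re - ρ) (c.re + ρ) ×ℂ Set.Icc (c.im - ρ) c.im with hK
  have hKball : ∀ w ∈ K, w ∈ Metric.closedBall c (R / 4) := by
    rintro w ⟨⟨h1, h2⟩, h3, h4⟩
    rw [mem_closedBall_iff_norm]
    refine (Complex.norm_le_abs_re_add_abs_im _).trans ?_
    rw [Complex.sub_re, Complex.sub_im]
    have h5 : |w.re - c.re| ≤ ρ := abs_le.2 ⟨by linarith, by linarith⟩
    have h6 : |w.im - c.im| ≤ ρ := abs_le.2 ⟨by linarith, by linarith⟩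
    linarith
  have hKball' : ∀ w ∈ K, w ∈ Metric.ball c (7 * R / 8) := fun w hw =>
    Metric.closedBall_subset_ball (by linarith) (hKball w hw)
  -- the crude bound `‖w G(w)‖ = O(R²)` on the rectangle
  have hcrude : ∀ w ∈ K, ‖w * G w‖ ≤ 7 * A * Real.exp (3 * ℓ) := by
    intro w hw
    have h1 := hG1 w (hKball w hw)
    have h2 : ‖w‖ ≤ R := by
      have h3 := mem_closedBall_iff_norm.1 (hKball w hw)
      have h4 := norm_add_le (w - c) c
      rw [sub_add_cancel] at h4
      linarith
    have h3 : Real.exp (3 * ℓ) = R ^ 3 := by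
      rw [hℓ, ← Real.log_rpow hRpos, Real.exp_log (by positivity)]
      norm_cast
    rw [h3, norm_mul]
    calc ‖w‖ * ‖G w‖ ≤ R * (11 * A * R) := by gcongr
      _ = A * R ^ 2 * 11 := by ring
      _ ≤ A * R ^ 2 * (7 * R) := by
          gcongr
          linarith
      _ = _ := by ring
  -- on the circle, below the height `y` by the two-constants estimate and above it directly
  have hcircle : ∀ w : ℂ, ‖w‖ = r → ‖G w‖ ≤ 112 * A * Real.exp 5 * ℓ / R := by
    intro w hw
    have hwG : ‖w * G w‖ ≤ 7 * A * Real.exp 5 := by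
      by_cases hwi : w.im ≤ y
      · have h1 : |w.re| ≤ r := hw ▸ Complex.abs_re_le_norm w
        have h2 : |w.im| ≤ r := hw ▸ Complex.abs_im_le_norm w
        have h1' := abs_le.1 h1
        have h2' := abs_le.1 h2
        have hwK : w ∈ K := by
          refine ⟨⟨?_, ?_⟩, ?_, ?_⟩
          · rw [hcre]; linarith
          · rw [hcre]; linarith
          · rw [hcim]; linarith
          · rw [hcim]; linarith
        refine (norm_le_mul_exp_of_rectangle (h := fun w => w * G w) (by positivity)
          (by positivity) (by positivity)
          (differentiableOn_id.mul (hG.mono hKball')) hcrude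
          (fun w hw hwi => hG2 w (hKball' w hw) (by rw [hwi, hcim]; linarith)) hwK).trans ?_
        refine mul_le_mul_of_nonneg_left (Real.exp_le_exp.2 ?_) (by positivity)
        rw [hcre, hcim, sub_zero, ← mul_div_assoc, div_le_iff₀ (by positivity)]
        have h3 : w.re ^ 2 ≤ r ^ 2 := sq_le_sq' h1'.1 h1'.2
        have h4 : (y - w.im) * (2 * ρ - (y - w.im)) ≤ (r + y) * (2 * ρ) := by
          have h5 : 0 ≤ y - w.im := by linarith
          have h6 : y - w.im ≤ r + y := by linarith
          nlinarith
        have h5 : ρ = 2 * r * ℓ := by rw [hρ]; linarith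
        have h6 : r ≤ r * ℓ := le_mul_of_one_le_right hr0.le hlogR
        have h7 : 100 * y ≤ 8 * r := by nlinarith
        calc 3 * ℓ * (w.re ^ 2 + (y - w.im) * (2 * ρ - (y - w.im)))
            ≤ 3 * ℓ * (r ^ 2 + (r + y) * (2 * ρ)) := by gcongr
          _ ≤ 5 * ρ ^ 2 := by
            rw [h5]
            have h8 : ℓ * r ^ 2 ≤ ℓ ^ 2 * r ^ 2 := by nlinarith [sq_nonneg r]
            have h9 : ℓ ^ 2 * r * (100 * y) ≤ ℓ ^ 2 * r * (8 * r) := by gcongr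
            nlinarith
      · push Not at hwi
        refine (hG2 w (hball w hw.le) (by linarith)).trans ?_
        nlinarith
    rw [norm_mul, hw] at hwG
    rw [le_div_iff₀ hRpos, ← hrℓ]
    have h1 := mul_le_mul_of_nonneg_right hwG (by positivity : 0 ≤ 16 * ℓ)
    linarith
  refine ⟨G, fun w hw => ⟨hFG w (hball w hw), ?_⟩⟩
  exact norm_le_of_forall_norm_eq hr0 (hG.mono fun z hz => hball z (by simpa using hz)) hcircle hw

/-- The difference of the polynomial parts, multiplied with the zero-free factor, is controlled by
the maximum principle on a circle far away from the zeros. -/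
theorem norm_factor_mul_prod_sub_prod_le (h₁ : IsZeroFactorization R ψ₁ ζ₁ F₁)
    (hψ₁ : IsJostLike A ψ₁) (hR : 1 ≤ R)
    (hη : ∀ i, ‖ζ₁ i - ζ₂ i‖ ≤ η) (hs : Fintype.card ι * η ≤ 1)
    (hs0 : 0 ≤ Fintype.card ι * η) {w : ℂ} (hw : ‖w‖ ≤ 3 * R) :
    ‖F₁ w * (∏ i, (w - ζ₂ i) - ∏ i, (w - ζ₁ i))‖ ≤
      2 * (Fintype.card ι * η) * (A * Real.exp (3 * A * R)) := by
  refine norm_le_of_forall_norm_eq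
    (f := fun w => F₁ w * (∏ i, (w - ζ₂ i) - ∏ i, (w - ζ₁ i))) (by positivity)
    (h₁.differentiable.mul (by fun_prop)).differentiableOn (fun w hw => ?_) hw
  have h1 : ∀ i, 1 ≤ ‖w - ζ₁ i‖ := fun i => by
    have := norm_sub_norm_le w (ζ₁ i)
    linarith [h₁.norm_le i]
  have hP1 : ∏ i, (w - ζ₁ i) ≠ 0 := Finset.prod_ne_zero_iff.2 fun i _ =>
    norm_pos_iff.1 (one_pos.trans_le (h1 i))
  have h2 := norm_prod_sub_div_prod_sub_sub_one_le hη h1 hs hs0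
  have h3 : F₁ w * (∏ i, (w - ζ₂ i) - ∏ i, (w - ζ₁ i)) =
      ((∏ i, (w - ζ₂ i)) / (∏ i, (w - ζ₁ i)) - 1) * ψ₁ w := by
    rw [h₁.eq_mul]
    field_simp
  have h4 := hψ₁.norm_le_exp w
  rw [hw, show A * (3 * R) = 3 * A * R by ring] at h4
  rw [h3, norm_mul]
  exact mul_le_mul h2 h4 (norm_nonneg _) (by positivity)

/-- With `E = F₁ (P₂ - P₁)` and `F₂ = F₁ e^G` one has `ψ₂ - ψ₁ = (ψ₁ + E) (e^G - 1) + E`. -/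
theorem norm_sub_le_of_isZeroFactorization (h₁ : IsZeroFactorization R ψ₁ ζ₁ F₁)
    (h₂ : IsZeroFactorization R ψ₂ ζ₂ F₂) (hψ₁ : IsJostLike A ψ₁) (hψ₂ : IsJostLike A ψ₂)
    (hA : 1 ≤ A) (hη : ∀ i, ‖ζ₁ i - ζ₂ i‖ ≤ η) (hs : Fintype.card ι * η * R ≤ 1 / 16)
    (hs' : 2 * (Fintype.card ι * η) * (A * Real.exp (3 * A * R)) ≤ 1)
    (hs0 : 0 ≤ Fintype.card ι * η) (hlogR : 1 ≤ Real.log R)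
    (hR : 112 * A * Real.exp 5 * Real.log R ≤ R) {x : ℝ} (hx : |x| ≤ R / (16 * Real.log R)) :
    ‖ψ₂ x - ψ₁ x‖ ≤ 448 * A ^ 2 * Real.exp 5 * (Real.log R / R) +
      2 * (Fintype.card ι * η) * (A * Real.exp (3 * A * R)) := by
  obtain ⟨G, hG⟩ := exists_log_factor_div_factor_le h₁ h₂ hψ₁ hψ₂ hA hη hs hs0 hlogR hR
  have hx' : ‖(x : ℂ)‖ ≤ R / (16 * Real.log R) := by simpa using hx
  obtain ⟨hFG, hGx⟩ := hG x hx'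
  have he : 1 ≤ Real.exp 5 := Real.one_le_exp (by norm_num)
  have hR1 : 1 ≤ R := by
    refine le_trans ?_ hR
    have h1 : 1 ≤ A * Real.exp 5 := one_le_mul_of_one_le_of_one_le hA he
    nlinarith
  have hRpos : 0 < R := by linarith
  have hG1 : ‖G x‖ ≤ 1 := hGx.trans ((div_le_one hRpos).2 hR)
  have hxR : ‖(x : ℂ)‖ ≤ 3 * R := by
    refine hx'.trans ((div_le_self hRpos.le ?_).trans (by linarith))
    linarith
  have hE := norm_factor_mul_prod_sub_prod_le h₁ hψ₁ hR1 hη (by nlinarith) hs0 hxR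
  set E := F₁ x * (∏ i, ((x : ℂ) - ζ₂ i) - ∏ i, ((x : ℂ) - ζ₁ i)) with hEdef
  have h3 : ψ₂ x - ψ₁ x = (ψ₁ x + E) * (Complex.exp (G x) - 1) + E := by
    rw [h₁.eq_mul, h₂.eq_mul, hFG, hEdef]
    ring
  have h4 : ‖ψ₁ x + E‖ ≤ 2 * A :=
    (norm_add_le _ _).trans (by linarith [hψ₁.norm_le x (by simp)])
  have h5 := mul_le_mul h4 ((Complex.norm_exp_sub_one_le hG1).trans
    (mul_le_mul_of_nonneg_left hGx zero_le_two)) (norm_nonneg _) (by linarith)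
  rw [h3]
  refine (norm_add_le _ _).trans (add_le_add ?_ hE)
  rw [norm_mul]
  refine h5.trans (le_of_eq ?_)
  ring

end ZeroComparison

/-- Closeness of the zeros in the disk of radius `R` makes Jost-like functions uniformly close on a
real interval of length comparable to `R / log R`. -/
theorem exists_norm_sub_le_of_zerosClose {A : ℝ} (hA : 1 ≤ A) : ∃ R₁ C : ℝ, 0 ≤ C ∧
    ∀ R, R₁ < R → ∃ K, 0 < K ∧ ∀ (ψ₁ ψ₂ : ℂ → ℂ) (ε : ℝ), IsJostLike A ψ₁ → IsJostLike A ψ₂ →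
      0 ≤ ε → K * ε ≤ 1 → ZerosClose ψ₁ ψ₂ R ε → ∀ x : ℝ, |x| ≤ R / (16 * Real.log R) →
        ‖ψ₂ x - ψ₁ x‖ ≤ C * (Real.log R / R) + K * ε := by
  have hev : ∀ᶠ R in atTop, 1 ≤ Real.log R ∧ 112 * A * Real.exp 5 * Real.log R ≤ R ∧ 1 ≤ R := by
    have h1 := Real.isLittleO_log_id_atTop.bound
      (show 0 < (112 * A * Real.exp 5)⁻¹ by positivity)
    filter_upwards [h1, Real.tendsto_log_atTop.eventually_ge_atTop 1, eventually_ge_atTop 1]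
      with R h2 h3 h4
    refine ⟨h3, ?_, h4⟩
    rw [id, Real.norm_of_nonneg (by linarith), Real.norm_of_nonneg (by linarith),
      inv_mul_eq_div, le_div_iff₀ (by positivity)] at h2
    linarith
  obtain ⟨R₁, hR₁⟩ := eventually_atTop.1 hev
  refine ⟨R₁, 448 * A ^ 2 * Real.exp 5, by positivity, fun R hR => ?_⟩
  obtain ⟨hlogR, hRA, hR1⟩ := hR₁ R hR.le
  refine ⟨64 * A ^ 2 * Real.exp (8 * A * R) * R ^ 3, by positivity, ?_⟩
  intro ψ₁ ψ₂ ε hψ₁ hψ₂ hε hKε hz x hx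
  have hRA' : 16 * A ≤ R := by
    refine le_trans ?_ hRA
    have h1 : 1 ≤ Real.exp 5 := Real.one_le_exp (by norm_num)
    have h2 : 1 ≤ Real.exp 5 * Real.log R := one_le_mul_of_one_le_of_one_le h1 hlogR
    nlinarith
  have hne : ψ₁ ≠ 0 := by
    rintro rfl
    have h1 := hψ₁.half_le_norm hA (w := ((16 * A : ℝ) : ℂ) * Complex.I) (by simp)
    norm_num at h1
  obtain ⟨N, m, ζ₁, ζ₂, F₁, F₂, h₁, h₂, hη⟩ := hz.exists_isZeroFactorization (by linarith) hε
    hψ₁.differentiable hψ₂.differentiable hne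
  have hcard := h₁.card_le hψ₁ hA hRA'
  have hs0 : 0 ≤ Fintype.card (Fin N ⊕ Fin m) * (R ^ 2 * ε) := by positivity
  have hs : Fintype.card (Fin N ⊕ Fin m) * (R ^ 2 * ε) ≤
      2 * A * Real.exp (5 * A * R) * (R ^ 2 * ε) := by gcongr
  have he8 : Real.exp (8 * A * R) = Real.exp (5 * A * R) * Real.exp (3 * A * R) := by
    rw [← Real.exp_add]
    ring_nf
  have he3 : 1 ≤ Real.exp (3 * A * R) := Real.one_le_exp (by positivity)
  have hE : 2 * (Fintype.card (Fin N ⊕ Fin m) * (R ^ 2 * ε)) * (A * Real.exp (3 * A * R)) ≤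
      64 * A ^ 2 * Real.exp (8 * A * R) * R ^ 3 * ε := by
    calc _ ≤ 2 * (2 * A * Real.exp (5 * A * R) * (R ^ 2 * ε)) * (A * Real.exp (3 * A * R)) := by
          gcongr
      _ = 4 * A ^ 2 * Real.exp (8 * A * R) * R ^ 2 * ε := by rw [he8]; ring
      _ ≤ _ := by
          gcongr
          · norm_num
          · norm_num
  refine (norm_sub_le_of_isZeroFactorization h₁ h₂ hψ₁ hψ₂ hA hη ?_ (hE.trans hKε) hs0 hlogR hRA
    hx).trans (by linarith)
  have h1 : Fintype.card (Fin N ⊕ Fin m) * (R ^ 2 * ε) * R ≤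
      2 * A * Real.exp (5 * A * R) * (R ^ 2 * ε) * R := by gcongr
  have h2 : 32 * (A * Real.exp (5 * A * R) * R ^ 3 * ε) ≤
      64 * A ^ 2 * Real.exp (8 * A * R) * R ^ 3 * ε := by
    have h3 : A * Real.exp (5 * A * R) ≤ A ^ 2 * Real.exp (8 * A * R) := by
      rw [he8]
      have h4 : A ≤ A ^ 2 := by nlinarith
      have h5 : Real.exp (5 * A * R) ≤ Real.exp (5 * A * R) * Real.exp (3 * A * R) :=
        le_mul_of_one_le_right (Real.exp_nonneg _) he3
      gcongr
    have h6 : 0 ≤ R ^ 3 * ε := by positivity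
    have h7 := mul_le_mul_of_nonneg_right h3 h6
    have h8 : 0 ≤ A ^ 2 * Real.exp (8 * A * R) * (R ^ 3 * ε) := by positivity
    linarith
  linarith

/-! ### The rate of convergence -/

/-- Hölder's inequality on an interval. -/
theorem norm_intervalIntegral_le_of_eLpNorm_le {p : ℝ≥0∞} (hp : 1 ≤ p) {f : ℝ → ℂ}
    (hf : Integrable f) {D : ℝ} (hD : 0 ≤ D)
    (h : eLpNorm f p (volume.restrict (Set.Ioi 0)) ≤ ENNReal.ofReal D) {x y : ℝ} (hx : 0 ≤ x)
    (hxy : x ≤ y) : ‖∫ t in x..y, f t‖ ≤ D * (y - x) ^ (1 - recip p) := by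
  have hr : recip p ≤ 1 := by
    rw [recip]
    exact ENNReal.toReal_le_of_le_ofReal zero_le_one (by simpa using hp)
  have h1 : eLpNorm f 1 (volume.restrict (Set.Ioc x y)) ≤
      ENNReal.ofReal (D * (y - x) ^ (1 - recip p)) := by
    refine (eLpNorm_le_eLpNorm_mul_rpow_measure_univ hp hf.1.restrict).trans ?_
    rw [ENNReal.ofReal_mul hD, Measure.restrict_apply_univ, Real.volume_Ioc,
      ENNReal.ofReal_rpow_of_nonneg (by linarith) (by
        rw [ENNReal.toReal_one, one_div_one, one_div, ← ENNReal.toReal_inv]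
        exact sub_nonneg.2 hr)]
    refine mul_le_mul' ((eLpNorm_mono_measure f (Measure.restrict_mono
      (Set.Ioc_subset_Ioi_self.trans (Set.Ioi_subset_Ioi hx)) le_rfl)).trans h) (le_of_eq ?_)
    rw [ENNReal.toReal_one, one_div_one, one_div, ← ENNReal.toReal_inv, recip]
  rw [intervalIntegral.integral_of_le hxy]
  have h2 : ENNReal.ofReal ‖∫ t in Set.Ioc x y, f t‖ ≤
      ENNReal.ofReal (D * (y - x) ^ (1 - recip p)) := by
    rw [ofReal_norm]
    refine (enorm_integral_le_lintegral_enorm _).trans ?_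
    rwa [← eLpNorm_one_eq_lintegral_enorm]
  exact (ENNReal.ofReal_le_ofReal_iff
    (mul_nonneg hD (Real.rpow_nonneg (by linarith) _))).1 h2

/-- With the averaging length `l = R ^ (-γ)` all error terms are `O(R ^ (-β))`, where `β = γ σ` and
`γ = 1 - 2 β`; any smaller power of `R` absorbs the constants. -/
theorem eventually_error_le {β γ σ δ B C D c₀ : ℝ} {k : ℕ} (hβ : 0 < β) (hγ : γ = 1 - 2 * β)
    (hσ : γ * σ = β) (hδ : 0 < δ) (hB : 0 ≤ B) (hC : 0 ≤ C) (hc₀ : 0 < c₀) (hk : 1 ≤ k * β) :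
    ∀ᶠ R : ℝ in atTop, B * (D * (R ^ (-γ)) ^ σ + (R ^ (-γ))⁻¹ * (C * (Real.log R / R) +
      ((R ^ (-γ) * (R / (16 * Real.log R))) ^ k)⁻¹)) ≤ c₀ * R ^ (-((1 - δ) * β)) := by
  have h1 := (isLittleO_log_rpow_atTop hβ).bound (show (0 : ℝ) < 16⁻¹ by norm_num)
  have h2 := (tendsto_rpow_atTop (mul_pos hδ hβ)).eventually_ge_atTop (B * (D + C + 1) / c₀)
  filter_upwards [h1, h2, eventually_ge_atTop 1, Real.tendsto_log_atTop.eventually_ge_atTop 1]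
    with R hlog hpow hR1 hlog1
  have hR : 0 < R := by linarith
  rw [Real.norm_of_nonneg (by linarith), Real.norm_of_nonneg (Real.rpow_nonneg hR.le _),
    inv_mul_eq_div, le_div_iff₀ (by norm_num)] at hlog
  have e1 : (R ^ (-γ)) ^ σ = R ^ (-β) := by
    rw [← Real.rpow_mul hR.le]
    congr 1
    linarith
  have e2 : (R ^ (-γ))⁻¹ * (C * (Real.log R / R)) ≤ C * R ^ (-β) := by
    have h3 : R ^ γ * (R ^ β / R) = R ^ (-β) := by
      rw [← Real.rpow_sub_one hR.ne', ← Real.rpow_add hR]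
      congr 1
      linarith
    rw [← h3, Real.rpow_neg hR.le, inv_inv, mul_left_comm]
    gcongr
    linarith
  have e3 : (R ^ (-γ))⁻¹ * ((R ^ (-γ) * (R / (16 * Real.log R))) ^ k)⁻¹ ≤ R ^ (-β) := by
    -- `l T` is at least `R ^ β`
    have h3 : R ^ β ≤ R ^ (-γ) * (R / (16 * Real.log R)) := by
      rw [mul_div_assoc', le_div_iff₀ (by linarith), ← Real.rpow_add_one hR.ne']
      have h4 : -γ + 1 = β + β := by linarith
      rw [h4, Real.rpow_add hR]
      gcongr
      linarith
    calc (R ^ (-γ))⁻¹ * ((R ^ (-γ) * (R / (16 * Real.log R))) ^ k)⁻¹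
        ≤ (R ^ (-γ))⁻¹ * ((R ^ β) ^ k)⁻¹ := by gcongr
      _ = R ^ (γ - β * k) := by
        rw [Real.rpow_neg hR.le, inv_inv, ← Real.rpow_natCast, ← Real.rpow_mul hR.le,
          ← Real.rpow_neg hR.le, ← Real.rpow_add hR, sub_eq_add_neg]
      _ ≤ R ^ (-β) := Real.rpow_le_rpow_of_exponent_le hR1 (by linarith)
  have e4 : R ^ (-((1 - δ) * β)) = R ^ (δ * β) * R ^ (-β) := by
    rw [← Real.rpow_add hR]
    congr 1
    ring
  rw [div_le_iff₀ hc₀] at hpow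
  rw [e1, e4, mul_add (R ^ (-γ))⁻¹]
  calc _ ≤ B * (D * R ^ (-β) + (C * R ^ (-β) + R ^ (-β))) := by gcongr
    _ = B * (D + C + 1) * R ^ (-β) := by ring
    _ ≤ R ^ (δ * β) * c₀ * R ^ (-β) := by gcongr
    _ = _ := by ring

theorem IsPotential.integral_eq_tailDiff {a Q : ℝ} (hQ : 0 ≤ Q) {q₁ q₂ : ℝ → ℂ}
    (h₁ : IsPotential a Q q₁) (h₂ : IsPotential a Q q₂) {x : ℝ} (hx : x ∈ Set.Icc 0 a) :
    ∫ t in x..a, (q₂ t - q₁ t) =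
      tailDiff ((Set.Ioc 0 a).indicator q₁) ((Set.Ioc 0 a).indicator q₂) x := by
  have h := (h₁.isTruncatedPotential hQ).tailDiff_eq (h₂.isTruncatedPotential hQ) x a
  rw [(h₁.isTruncatedPotential hQ).tailDiff_of_le (h₂.isTruncatedPotential hQ) le_rfl,
    sub_zero] at h
  rw [h, intervalIntegral.integral_of_le hx.2, intervalIntegral.integral_of_le hx.2]
  refine setIntegral_congr_fun measurableSet_Ioc fun t ht => ?_
  have ht' : t ∈ Set.Ioc 0 a := ⟨hx.1.trans_lt ht.1, ht.2⟩
  simp only [Set.indicator_of_mem ht']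

theorem IsTruncatedPotential.norm_tailDiff_le {a Q : ℝ} {q₁ q₂ : ℝ → ℂ}
    (h₁ : IsTruncatedPotential a Q q₁) (h₂ : IsTruncatedPotential a Q q₂) (x : ℝ) :
    ‖tailDiff q₁ q₂ x‖ ≤ 2 * Q := by
  have hi := h₂.integrable.norm.add h₁.integrable.norm
  calc ‖tailDiff q₁ q₂ x‖ ≤ ∫ t in Set.Ioi x, (‖q₂ t‖ + ‖q₁ t‖) :=
        norm_integral_le_of_norm_le hi.integrableOn
          (Eventually.of_forall fun t => norm_sub_le _ _)
    _ ≤ ∫ t, (‖q₂ t‖ + ‖q₁ t‖) :=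
        setIntegral_le_integral hi (Eventually.of_forall fun t => by positivity)
    _ = (∫ t, ‖q₂ t‖) + ∫ t, ‖q₁ t‖ := integral_add h₂.integrable.norm h₁.integrable.norm
    _ ≤ 2 * Q := by linarith [h₁.norm_le, h₂.norm_le]

theorem constC₀_pos {a Q₁ D : ℝ} (p : ℝ≥0∞) (ha : 0 < a) (hQ₁ : 0 < Q₁) (hD : 0 < D) :
    0 < constC₀ a Q₁ p D := by
  unfold constC₀
  positivity

theorem mainTheorem1 (a Q₁ D δ : ℝ) (p : ℝ≥0∞) (ha : 0 < a) (hQ₁ : 0 < Q₁) (hD : 0 < D)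
    (hp : 1 < p) (hδ : δ ∈ Set.Ioo (0 : ℝ) 1) :
    ∃ (R₀ : ℝ) (χ : ℝ → ℝ) (Ψ : ℝ → ℝ → ℝ), 0 < R₀ ∧
      (χ =O[atTop] fun R => R ^ (-remainderExp δ p) * Real.log R ^ (1 - recip p)) ∧
      (∀ R, R₀ < R → Ψ R =O[𝓝[>] (0 : ℝ)] fun ε => ε) ∧
      ∀ q₁ q₂ : ℝ → ℂ, IsPotential a Q₁ q₁ → IsPotential a Q₁ q₂ →
        eLpNorm (q₂ - q₁) p (volume.restrict (Set.Ioi 0)) ≤ ENNReal.ofReal D →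
        ∀ R ε : ℝ, R₀ < R → 0 < ε →
          ZerosClose (jostFunction q₁) (jostFunction q₂) R ε →
          ∀ x ∈ Set.Icc 0 a,
            ‖∫ t in x..a, (q₂ t - q₁ t)‖ ≤
              Ψ R ε + constC₀ a Q₁ p D * R ^ (-rateExp δ p) * (1 + χ R) := by
  have hr1 : recip p < 1 := by
    rw [recip, ← ENNReal.toReal_one]
    exact (ENNReal.toReal_lt_toReal (by simp [(one_pos.trans hp).ne']) ENNReal.one_ne_top).2
      (ENNReal.inv_lt_one.2 hp)
  set r := recip p with hr
  have hr3 : 0 < 3 - 2 * r := by linarith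
  set β := (1 - r) / (3 - 2 * r) with hβ
  have hβ0 : 0 < β := div_pos (by linarith) hr3
  set γ := 1 / (3 - 2 * r) with hγ
  have hγβ : γ = 1 - 2 * β := by
    rw [hγ, hβ]
    field_simp
    ring
  have hγσ : γ * (1 - r) = β := by
    rw [hγ, hβ]
    ring
  -- the order of decay that makes the remainder `l⁻¹ (l T)^{-k}` at most `R ^ (-β)`
  obtain ⟨k, hk⟩ := exists_nat_ge (1 / β)
  rw [div_le_iff₀ hβ0] at hk
  set A := 1 + 2 * a + a * Real.exp (a * Q₁) * Q₁ + Real.exp Q₁ * Q₁ with hA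
  have hA1 : 1 ≤ A := by
    have h1 : 0 ≤ a * Real.exp (a * Q₁) * Q₁ := by positivity
    have h2 : 0 ≤ Real.exp Q₁ * Q₁ := by positivity
    linarith
  obtain ⟨B, hB, htail⟩ := exists_norm_tailDiff_le (Q := Q₁) ha.le k
  obtain ⟨R₁, C, hC, hclose⟩ := exists_norm_sub_le_of_zerosClose hA1
  choose! K hK0 hK using hclose
  obtain ⟨R₂, hR₂⟩ := eventually_atTop.1 (eventually_error_le (B := B) (C := C) (D := D) hβ0 hγβ
    hγσ hδ.1 hB hC (constC₀_pos p ha hQ₁ hD) hk)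
  refine ⟨max (max R₁ R₂) 1, 0, fun R ε => (B * ((R ^ (-γ))⁻¹ * K R) + 2 * Q₁ * K R) * ε,
    by positivity, isBigO_zero _ _, fun R _ => isBigO_const_mul_self _ _ _, ?_⟩
  intro q₁ q₂ h₁ h₂ hq R ε hR hε hz x hx
  have hRR₁ : R₁ < R := (le_max_left _ _).trans_lt ((le_max_left _ _).trans_lt hR)
  have hRR₂ : R₂ ≤ R := (le_max_right _ _).trans ((le_max_left _ _).trans hR.le)
  have hR1 : 1 < R := (le_max_right _ _).trans_lt hR
  have hR0 : 0 < R := by linarith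
  have hKR := hK0 R hRR₁
  have t₁ := h₁.isTruncatedPotential hQ₁.le
  have t₂ := h₂.isTruncatedPotential hQ₁.le
  rw [h₁.jostFunction_eq ha.le hQ₁.le, h₂.jostFunction_eq ha.le hQ₁.le] at hz
  rw [h₁.integral_eq_tailDiff hQ₁.le h₂ hx, Pi.zero_apply, add_zero, mul_one]
  have hl : 0 < R ^ (-γ) := Real.rpow_pos_of_pos hR0 _
  rcases lt_or_ge 1 (K R * ε) with hε1 | hε1
  · -- for such `ε` the trivial bound `2 Q₁` is below the term `2 Q₁ K ε`
    have h3 := t₁.norm_tailDiff_le t₂ x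
    have h4 : 0 ≤ B * ((R ^ (-γ))⁻¹ * K R) * ε := by positivity
    have h5 : 0 ≤ constC₀ a Q₁ p D * R ^ (-rateExp δ p) :=
      mul_nonneg (constC₀_pos p ha hQ₁ hD).le (Real.rpow_nonneg hR0.le _)
    nlinarith
  · have hT : 0 < R / (16 * Real.log R) := by
      have := Real.log_pos hR1
      positivity
    have hg : 0 ≤ C * (Real.log R / R) + K R * ε := by
      have := Real.log_pos hR1
      positivity
    have hdiff : eLpNorm (fun t => (Set.Ioc 0 a).indicator q₂ t - (Set.Ioc 0 a).indicator q₁ t) p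
        (volume.restrict (Set.Ioi 0)) ≤ ENNReal.ofReal D := by
      refine le_trans (le_of_eq (eLpNorm_congr_ae ?_)) hq
      filter_upwards [h₁.ae_eq_indicator, h₂.ae_eq_indicator] with t e1 e2
      rw [e1, e2, Pi.sub_apply]
    have h3 := htail _ _ t₁ t₂ (R ^ (-γ)) (R / (16 * Real.log R))
      (C * (Real.log R / R) + K R * ε) (D * (R ^ (-γ)) ^ (1 - r)) hl hT hg (by positivity)
      (hK R hRR₁ _ _ ε (t₁.isJostLike ha.le) (t₂.isJostLike ha.le) hε.le hε1 hz)
      (fun u v hu huv hvl => by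
        rw [norm_sub_rev, t₁.tailDiff_eq t₂]
        refine (norm_intervalIntegral_le_of_eLpNorm_le hp.le (t₂.integrable.sub t₁.integrable)
          hD.le hdiff hu huv).trans ?_
        refine mul_le_mul_of_nonneg_left (Real.rpow_le_rpow (by linarith) (by linarith)
          (by linarith)) hD.le) x hx
    have h4 := hR₂ R hRR₂
    have h5 : 0 ≤ 2 * Q₁ * K R * ε := by positivity
    have h6 : rateExp δ p = (1 - δ) * β := rfl
    rw [h6]
    linarith
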